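/- Let $N\ge 1$ and $j\ge 0$ be integers. Consider the space of chains $(\mathbb A,(B_1,C_1),\dots,(B_j,C_j))$ with $\mathbb A\in \mathrm{Mat}_N(\mathbb C)$ and $B_k,C_k\in GL_N(\mathbb C)$, which has dimension $N^2(2j+1)$. Write $E_{i,l}$ for the matrix units, $E$ for the identity matrix, $\overset{1}{X}=X\otimes E$, $\overset{2}{X}=E\otimes X$, let $t_1,t_2$ denote transposition in the first and second tensor factor, and put $$r_{12}=\sum_i E_{i,i}\otimes E_{i,i}+2\sum_{i>l}E_{i,l}\otimes E_{l,i},\qquad Q_{12}=-r_{12}^{t_2}.$$ The type (ii) Poisson bracket on this space is given, together with antisymmetry, by $$\{\overset{1}{\mathbb A}\overset{\otimes}{,}\overset{2}{\mathbb A}\}=r_{12}\overset{1}{\mathbb A}\overset{2}{\mathbb A}-\overset{1}{\mathbb A}\overset{2}{\mathbb A}r_{12}+\overset{1}{\mathbb A}r_{12}^{t_1}\overset{2}{\mathbb A}-\overset{2}{\mathbb A}r_{12}^{t_1}\overset{1}{\mathbb A},$$ $$\{\overset{1}{X}\overset{\otimes}{,}\overset{2}{Y}\}=r_{12}\overset{1}{X}\overset{2}{Y}-\overset{1}{X}\overset{2}{Y}r_{12}\quad\text{for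 }(X,Y)=(B_k,B_k),(C_k,C_k),(C_k,B_k),$$ $$\{\overset{1}{X}\overset{\otimes}{,}\overset{2}{\mathbb A}\}=\overset{1}{X}Q_{12}\overset{2}{\mathbb A}+\overset{1}{X}\overset{2}{\mathbb A}Q_{12}^{t_2}\quad\text{for }X=B_1,C_1,$$ $$\{\overset{1}{X}\overset{\otimes}{,}\overset{2}{Y}\}=\overset{1}{X}Q_{12}\overset{2}{Y}\quad\text{for }X\in\{B_{k+1},C_{k+1}\},\ Y\in\{B_k,C_k\},\ 1\le k\le j-1,$$ all other brackets between these matrices being zero; the bracket $\{x_{i,a},y_{k,b}\}$ is the coefficient of $E_{i,a}\otimes E_{k,b}$ in $\{\overset{1}{X}\overset{\otimes}{,}\overset{2}{Y}\}$, and the bracket is extended to rational functions of the matrix entries as a biderivation. A Casimir function is a rational function whose bracket with every rational function vanishes. Let $S=\mathbb A^{\mathrm T}B_1^{-1}B_2^{\mathrm T}B_3^{-1}\cdots$, with the factor $B_k^{-1}$ for odd $k\le j$ and $B_k^{\mathrm T}$ for even $k\le j$. Let $M^q_{C_k}$ be the upper-right $q\times q$ minor of $C_k$ (first $q$ rows,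 last $q$ columns), and let $M^q_S$ be the upper-right $q\times q$ minor of $S$ if $j$ is even, and the upper-left principal $q\times q$ minor of $S$ if $j$ is odd ($M^0=1$). Then the following functions are Casimir functions of this bracket. * For all $j$: the $[N/2]$ functions $Y_p$ in the expansion $$\frac{\det(\lambda\mathbb A+\lambda^{-1}\mathbb A^{\mathrm T})}{\det\mathbb A}=\lambda^N+\lambda^{-N}+\sum_{p=1}^{[N/2]}(\lambda^{N-2p}+\lambda^{2p-N})Y_p .$$ * For all $j$: the $Nj$ functions $Z^{(k)}_p$ in the expansions $$\frac{\det(B_k+\lambda C_k)}{\det B_k}=1+\sum_{p=1}^N\lambda^pZ^{(k)}_p,\qquad k=1,\dots,j.$$ * For even $j$: the $[(N+1)/2]$ functions $$X_p=\frac{M_S^p\prod_{k=1}^jM_{C_k}^p}{M_S^{N-p}\prod_{k=1}^jM_{C_k}^{N-p}},\qquad 0\le p<N/2 .$$ * For odd $j=2r+1$: the $[N/2]$ functions $$X_p=\frac{M_S^pM_S^{N-p}\prod_{k=1}^r\bigl(M_{C_{2k}}^pM_{C_{2k}}^{N-p}\bigr)}{\prod_{k=1}^{r+1}\bigl(M_{C_{2k-1}}^pM_{C_{2k-1}}^{N-p}\bigr)}\cdot\frac{\prod_{k=1}^{r+1}\det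 B_{2k-1}\det C_{2k-1}}{\det\mathbb A\,\prod_{k=1}^{r}\det B_{2k}\det C_{2k}},\qquad 1\le p\le [N/2].$$ For each $j$, all the listed functions together are algebraically independent over $\mathbb C$. Their number is $N(j+1)$ for even $j$ and $2[N/2]+Nj$ for odd $j$. The highest dimension of the Poisson leaves (the leaf through a point having as tangent space the space of values of Hamiltonian vector fields there) equals $N^2(2j+1)$ minus this number, and it is even. -/

import Mathlib

open scoped Kronecker Matrix

noncomputable section

namespace PoissonChain

/-- The matrices of a chain `(𝔸, (B₁,C₁), …, (B_j,C_j))`: `none` is `𝔸`, `some (k, false)` is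
`B_{k+1}` and `some (k, true)` is `C_{k+1}` (so `k : Fin j` counts the pairs from `0`). -/
abbrev Slot (j : ℕ) : Type := Option (Fin j × Bool)

/-- The coordinates on the space of chains: `(s, i, k)` is the `(i, k)` entry of the matrix `s`. -/
abbrev Coord (N j : ℕ) : Type := Slot j × Fin N × Fin N

section RMatrix

variable {N : ℕ} {R : Type*} [CommRing R]

/-- Operators on `R^N ⊗ R^N`; the entry `(i, k) (a, b)` is the coefficient of
`E_{i,a} ⊗ E_{k,b}`. -/
abbrev Op2 (N : ℕ) (R : Type*) : Type _ := Matrix (Fin N × Fin N) (Fin N × Fin N) R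

/-- `X ⊗ E`. -/
def in1 (X : Matrix (Fin N) (Fin N) R) : Op2 N R := X ⊗ₖ (1 : Matrix (Fin N) (Fin N) R)

/-- `E ⊗ X`. -/
def in2 (X : Matrix (Fin N) (Fin N) R) : Op2 N R := (1 : Matrix (Fin N) (Fin N) R) ⊗ₖ X

/-- The trigonometric `r`-matrix `∑ᵢ E_{i,i} ⊗ E_{i,i} + 2 ∑_{i > j} E_{i,j} ⊗ E_{j,i}`. -/
def rMatrix (N : ℕ) (R : Type*) [CommRing R] : Op2 N R :=
  ∑ i : Fin N, Matrix.single i i (1 : R) ⊗ₖ Matrix.single i i (1 : R) +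
    2 • ∑ i : Fin N, ∑ j : Fin N with j < i,
      Matrix.single i j (1 : R) ⊗ₖ Matrix.single j i (1 : R)

/-- Transposition in the first tensor factor. -/
def transp1 (T : Op2 N R) : Op2 N R := Matrix.of fun p q => T (q.1, p.2) (p.1, q.2)

/-- Transposition in the second tensor factor. -/
def transp2 (T : Op2 N R) : Op2 N R := Matrix.of fun p q => T (p.1, q.2) (q.1, p.2)

/-- Exchange of the two tensor factors, `T₁₂ ↦ T₂₁`. -/
def flip12 (T : Op2 N R) : Op2 N R := Matrix.of fun p q => T p.swap q.swap

/-- The type (ii) choice `Q₁₂ = -r₁₂^{t₂}`. -/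
def qMatrix (N : ℕ) (R : Type*) [CommRing R] : Op2 N R := -transp2 (rMatrix N R)

/-- `{𝔸 ⊗, 𝔸} = r 𝔸₁𝔸₂ - 𝔸₁𝔸₂ r + 𝔸₁ r^{t₁} 𝔸₂ - 𝔸₂ r^{t₁} 𝔸₁`. -/
def bracketAA (A : Matrix (Fin N) (Fin N) R) : Op2 N R :=
  rMatrix N R * (in1 A * in2 A) - in1 A * in2 A * rMatrix N R
    + in1 A * transp1 (rMatrix N R) * in2 A - in2 A * transp1 (rMatrix N R) * in1 A

/-- `{X ⊗, Y} = r X₁Y₂ - X₁Y₂ r`, used for `(X, Y) = (B, B), (C, C), (C, B)` in one pair. -/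
def bracketPair (X Y : Matrix (Fin N) (Fin N) R) : Op2 N R :=
  rMatrix N R * (in1 X * in2 Y) - in1 X * in2 Y * rMatrix N R

/-- `{X ⊗, 𝔸} = X₁ Q 𝔸₂ + X₁ 𝔸₂ Q^{t₂}`, used for `X = B₁, C₁`. -/
def bracketXA (X A : Matrix (Fin N) (Fin N) R) : Op2 N R :=
  in1 X * qMatrix N R * in2 A + in1 X * in2 A * transp2 (qMatrix N R)

/-- `{X ⊗, Y} = X₁ Q Y₂`, used for `X = B_{k+1}, C_{k+1}` and `Y = B_k, C_k`. -/
def bracketNext (X Y : Matrix (Fin N) (Fin N) R) : Op2 N R :=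
  in1 X * qMatrix N R * in2 Y

/-- The type (ii) bracket `{x s ⊗, x t}` of two of the matrices of a chain `x`. The brackets in
the opposite order are given by antisymmetry, `{Y ⊗, X}₁₂ = -{X ⊗, Y}₂₁`. -/
def chainBracket {j : ℕ} (x : Slot j → Matrix (Fin N) (Fin N) R) : Slot j → Slot j → Op2 N R
  | none, none => bracketAA (x none)
  | some (k, b), none =>
      if (k : ℕ) = 0 then bracketXA (x (some (k, b))) (x none) else 0
  | none, some (l, c) =>
      if (l : ℕ) = 0 then -flip12 (bracketXA (x (some (l, c))) (x none)) else 0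
  | some (k, b), some (l, c) =>
      if k = l then
        (if b = false ∧ c = true then -flip12 (bracketPair (x (some (l, c))) (x (some (k, b))))
          else bracketPair (x (some (k, b))) (x (some (l, c))))
      else if (k : ℕ) = l + 1 then bracketNext (x (some (k, b))) (x (some (l, c)))
      else if (l : ℕ) = k + 1 then -flip12 (bracketNext (x (some (l, c))) (x (some (k, b))))
      else 0

/-- The Poisson tensor at `x`: its `u, v` entry is the bracket of the coordinates `u` and `v`. The
bracket of the entry `(i, a)` of `X` and the entry `(k, b)` of `Y` is the `(i, k) (a, b)` entry of
`{X ⊗, Y}`. -/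
def poissonTensor {j : ℕ} (x : Slot j → Matrix (Fin N) (Fin N) R) :
    Matrix (Coord N j) (Coord N j) R :=
  Matrix.of fun u v => chainBracket x u.1 v.1 (u.2.1, v.2.1) (u.2.2, v.2.2)

/-- The minor of `M` on the first `q` rows and the last `q` columns. -/
def upperRightMinor (M : Matrix (Fin N) (Fin N) R) (q : ℕ) (hq : q ≤ N) : R :=
  (M.submatrix (fun i : Fin q => (⟨i, by omega⟩ : Fin N))
    (fun i : Fin q => (⟨N - q + i, by omega⟩ : Fin N))).det

/-- The minor of `M` on the first `q` rows and the first `q` columns. -/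
def upperLeftMinor (M : Matrix (Fin N) (Fin N) R) (q : ℕ) (hq : q ≤ N) : R :=
  (M.submatrix (fun i : Fin q => (⟨i, by omega⟩ : Fin N))
    (fun i : Fin q => (⟨i, by omega⟩ : Fin N))).det

end RMatrix

section Functions

variable (N j : ℕ)

/-- The polynomial functions on the space of chains. -/
abbrev PolyFun : Type := MvPolynomial (Coord N j) ℂ

/-- The rational functions on the space of chains. -/
abbrev RatFun : Type := FractionRing (PolyFun N j)

/-- The chain whose matrix entries are the coordinate functions. -/
def genericChain : Slot j → Matrix (Fin N) (Fin N) (RatFun N j) :=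
  fun s => Matrix.of fun i k =>
    algebraMap (PolyFun N j) (RatFun N j) (MvPolynomial.X (s, i, k))

/-- The matrix `𝔸` of coordinate functions. -/
def matA : Matrix (Fin N) (Fin N) (RatFun N j) := genericChain N j none

/-- The matrix `B_{k+1}` of coordinate functions. -/
def matB (k : Fin j) : Matrix (Fin N) (Fin N) (RatFun N j) := genericChain N j (some (k, false))

/-- The matrix `C_{k+1}` of coordinate functions. -/
def matC (k : Fin j) : Matrix (Fin N) (Fin N) (RatFun N j) := genericChain N j (some (k, true))

variable {N j}

/-- The partial derivative of a rational function, by the quotient rule. -/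
def partialDeriv (u : Coord N j) (f : RatFun N j) : RatFun N j :=
  let a := IsFractionRing.num (PolyFun N j) f
  let d : PolyFun N j := IsFractionRing.den (PolyFun N j) f
  algebraMap (PolyFun N j) (RatFun N j)
      (MvPolynomial.pderiv u a * d - a * MvPolynomial.pderiv u d) /
    algebraMap (PolyFun N j) (RatFun N j) d ^ 2

/-- The type (ii) Poisson bracket of two rational functions. -/
def bracket (f g : RatFun N j) : RatFun N j :=
  ∑ u : Coord N j, ∑ v : Coord N j,
    partialDeriv u f * poissonTensor (genericChain N j) u v * partialDeriv v g

/-- A Casimir function Poisson commutes with every function. -/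
def IsCasimir (f : RatFun N j) : Prop := ∀ g : RatFun N j, bracket f g = 0

variable (N j)

/-- `S = 𝔸ᵀ B₁⁻¹ B₂ᵀ B₃⁻¹ ⋯`, with `B_k⁻¹` for odd `k` and `B_kᵀ` for even `k`, where `B_{k+1}` is
`matB N j k`. -/
def matS : Matrix (Fin N) (Fin N) (RatFun N j) :=
  (matA N j)ᵀ *
    (List.ofFn fun k : Fin j => if Even (k : ℕ) then (matB N j k)⁻¹ else (matB N j k)ᵀ).prod

/-- For even `j`: `X_p = M_S^p ∏ M_{C_k}^p / (M_S^{N-p} ∏ M_{C_k}^{N-p})`, with upper right minors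
throughout. -/
def casimirXEven (p : ℕ) (hp : p ≤ N) : RatFun N j :=
  (upperRightMinor (matS N j) p hp * ∏ k : Fin j, upperRightMinor (matC N j k) p hp) /
    (upperRightMinor (matS N j) (N - p) (N.sub_le p) *
      ∏ k : Fin j, upperRightMinor (matC N j k) (N - p) (N.sub_le p))

/-- The positions of the pairs with an odd number `k + 1`. -/
def oddPairs : Finset (Fin j) := Finset.univ.filter fun k => Even (k : ℕ)

/-- The positions of the pairs with an even number `k + 1`. -/
def evenPairs : Finset (Fin j) := Finset.univ.filter fun k => Odd (k : ℕ)

/-- For odd `j`: the functions `X_p`, with upper left minors of `S` and upper right minors of the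
matrices `C_k`. -/
def casimirXOdd (p : ℕ) (hp : p ≤ N) : RatFun N j :=
  (upperLeftMinor (matS N j) p hp * upperLeftMinor (matS N j) (N - p) (N.sub_le p) *
      ∏ k ∈ evenPairs j, (upperRightMinor (matC N j k) p hp *
        upperRightMinor (matC N j k) (N - p) (N.sub_le p))) /
    (∏ k ∈ oddPairs j, (upperRightMinor (matC N j k) p hp *
        upperRightMinor (matC N j k) (N - p) (N.sub_le p))) *
  ((∏ k ∈ oddPairs j, ((matB N j k).det * (matC N j k).det)) /
    ((matA N j).det * ∏ k ∈ evenPairs j, ((matB N j k).det * (matC N j k).det)))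

/-- `Y_1, …, Y_{[N/2]}` (`Y p` is `Y_{p+1}`) are the coefficients of
`det (λ 𝔸 + λ⁻¹ 𝔸ᵀ) / det 𝔸 = λ^N + λ^{-N} + ∑ₚ (λ^{N-2p} + λ^{2p-N}) Y_p`. -/
def IsYExpansion (Y : Fin (N / 2) → RatFun N j) : Prop :=
  LaurentPolynomial.C (matA N j).det⁻¹ *
      Matrix.det ((LaurentPolynomial.T 1 : LaurentPolynomial (RatFun N j)) •
          (matA N j).map LaurentPolynomial.C +
        (LaurentPolynomial.T (-1) : LaurentPolynomial (RatFun N j)) •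
          (matA N j)ᵀ.map LaurentPolynomial.C) =
    LaurentPolynomial.T (N : ℤ) + LaurentPolynomial.T (-(N : ℤ)) +
      ∑ p : Fin (N / 2),
        (LaurentPolynomial.T ((N : ℤ) - 2 * ((p : ℕ) + 1)) +
            LaurentPolynomial.T (2 * ((p : ℕ) + 1) - (N : ℤ))) *
          LaurentPolynomial.C (Y p)

/-- `Z^{(k)}_1, …, Z^{(k)}_N` (`Z k p` is `Z^{(k+1)}_{p+1}`) are the coefficients of
`det (B_k + λ C_k) / det B_k = 1 + ∑ₚ λ^p Z^{(k)}_p`. -/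
def IsZExpansion (Z : Fin j → Fin N → RatFun N j) : Prop :=
  ∀ k : Fin j,
    Polynomial.C (matB N j k).det⁻¹ *
        Matrix.det ((matB N j k).map Polynomial.C +
          (Polynomial.X : Polynomial (RatFun N j)) • (matC N j k).map Polynomial.C) =
      1 + ∑ p : Fin N, Polynomial.X ^ ((p : ℕ) + 1) * Polynomial.C (Z k p)

end Functions

section Leaves

variable {N j : ℕ}

/-- The space of chains: `𝔸` is an arbitrary matrix and all `B_k` and `C_k` are invertible. -/
def phaseSpace (N j : ℕ) : Set (Slot j → Matrix (Fin N) (Fin N) ℂ) :=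
  {x | ∀ s : Fin j × Bool, IsUnit (x (some s))}

/-- The values at `x` of the Hamiltonian vector fields. This is the tangent space at `x` of the
Poisson leaf through `x`, as the leaves are the integral manifolds of this distribution. -/
def hamiltonianSpace (x : Slot j → Matrix (Fin N) (Fin N) ℂ) :
    Submodule ℂ (Coord N j → ℂ) :=
  LinearMap.range (poissonTensor x).mulVecLin

/-- The dimension of the Poisson leaf through `x`. -/
def leafDim (x : Slot j → Matrix (Fin N) (Fin N) ℂ) : ℕ :=
  Module.finrank ℂ (hamiltonianSpace x)

/-- `d` is the highest dimension of the Poisson leaves. -/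
def IsMaxLeafDim (N j d : ℕ) : Prop := IsGreatest (leafDim '' phaseSpace N j) d

end Leaves

end PoissonChain

end

/-! The Hamiltonian vector field of a single matrix entry moves every matrix of the chain by `M ↦ L
M + M R`. The gauges `L` and `R` are not unique, because `r₁₂ + r₂₁` is twice the flip, and each
family of Casimirs uses a suitable choice. With one choice `𝔸` moves by `G 𝔸 + 𝔸 Gᵀ`, so that `det
(λ 𝔸 + λ⁻¹ 𝔸ᵀ)` and `det 𝔸` pick up the same factor; with another, `B_k` and `C_k` share `L` and
`R`, so that `det (B_k + λ C_k)` and `det B_k` do. This gives the functions `Y` and `Z`. For the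
functions `X` the gauges of neighbouring factors of `S` cancel, and the outer gauges that remain,
like those of each `C_k`, are triangular. The corner minors are then multiplied by scalars given by
partial traces (`Varies.upperRightMinor`, `Varies.upperLeftMinor`), and these cancel in `X_p`. All
such first-order computations are carried out over the dual numbers.

Independence and the leaf dimension are both decided at one point: the chain of antidiagonal
matrices whose row `i` (counted from `0`) contains `2 ^ i` in `𝔸`, `1` in every `B_k` and `i + 1` in
every `C_k`. There the Casimirs separate, to first order, as many coordinate directions as there are
Casimirs (`eq_zero_of_casimirs_even`, `eq_zero_of_casimirs_odd`), so their gradients are independent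
over the field of rational functions. In characteristic zero this gives algebraic independence
(`algebraicIndependent_of_gradient`). Since gradients of Casimirs are annihilated by the Poisson
tensor, whose rank at a point is at most the generic rank, it also bounds every leaf from above
(`leafDim_add_card_le`).

For the reverse bound, the Poisson tensor at the same point is so sparse that its kernel can be
solved by hand: a kernel vector is supported on the antidiagonals and determined by as many entries
as there are Casimirs (`eq_zero_of_even`, `eq_zero_of_odd`). Hence the leaf through this point
attains the bound, and its parity is arithmetic. -/

namespace PoissonChain

/-! ### Brackets of matrix entries in coordinates -/

section Entries

variable {N : ℕ} {R : Type*} [CommRing R]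

/-- The coefficient `1`, `2` or `0` of the `r`-matrix according to `m = k`, `k < m` or `m < k`. -/
def rho (R : Type*) [CommRing R] (m k : Fin N) : R := if m = k then 1 else if k < m then 2 else 0

@[simp] theorem rho_self (m : Fin N) : rho R m m = 1 := by simp [rho]

theorem rho_of_lt {m k : Fin N} (h : k < m) : rho R m k = 2 := by simp [rho, h, h.ne']

theorem rho_of_gt {m k : Fin N} (h : m < k) : rho R m k = 0 := by simp [rho, h.ne, h.not_gt]

/-- This is `r₁₂ + r₂₁ = 2P` with `P` the flip. It is the source of the freedom to move a variation
between the left and the right factor. -/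
theorem rho_add_rho (m k : Fin N) : rho R m k + rho R k m = 2 := by
  rcases lt_trichotomy m k with h | rfl | h
  · rw [rho_of_lt h, rho_of_gt h]; ring
  · rw [rho_self]; ring
  · rw [rho_of_lt h, rho_of_gt h]; ring

theorem rho_rev (m k : Fin N) : rho R m.rev k.rev = rho R k m := by
  rcases lt_trichotomy m k with h | rfl | h
  · rw [rho_of_lt h, rho_of_lt (Fin.rev_lt_rev.2 h)]
  · simp
  · rw [rho_of_gt h, rho_of_gt (Fin.rev_lt_rev.2 h)]

theorem map_rho {S : Type*} [CommRing S] (f : R →+* S) (m k : Fin N) :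
    f (rho R m k) = rho S m k := by
  simp only [rho, apply_ite f, map_one, map_zero, map_ofNat]

theorem rMatrix_apply (i k p m : Fin N) :
    rMatrix N R (i, k) (p, m) = if i = m then (if k = p then rho R i p else 0) else 0 := by
  simp only [rMatrix, Matrix.add_apply, Matrix.sum_apply, Matrix.smul_apply,
    Matrix.kroneckerMap_apply, Matrix.single_apply]
  simp only [Finset.sum_filter]
  rw [Finset.sum_eq_single i, Finset.sum_eq_single i, Finset.sum_eq_single p]
  · by_cases h1 : i = m
    · subst h1
      by_cases h2 : k = p
      · subst h2
        by_cases h3 : i = k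
        · subst h3; simp
        · simp [rho, h3]
      · have h2' : p ≠ k := fun h => h2 h.symm
        simp [h2, h2']
        intros; subst_vars; exact absurd rfl h2
    · simp [h1]
  · intro b _ hb
    simp [hb]
  · simp
  · intro b _ hb
    refine Finset.sum_eq_zero fun c _ => ?_
    simp +contextual [hb]
  · simp
  · intro b _ hb
    simp [hb]
  · simp

theorem sum_mul_rMatrix (F : Fin N → Fin N → R) (a b : Fin N) :
    ∑ p, ∑ m, F p m * rMatrix N R (p, m) (a, b) = F b a * rho R b a := by
  rw [Finset.sum_eq_single b, Finset.sum_eq_single a]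
  · simp [rMatrix_apply]
  all_goals simp +contextual [rMatrix_apply]

theorem sum_rMatrix_mul (F : Fin N → Fin N → R) (i k : Fin N) :
    ∑ p, ∑ m, rMatrix N R (i, k) (p, m) * F p m = rho R i k * F k i := by
  rw [Finset.sum_eq_single k, Finset.sum_eq_single i]
  · simp [rMatrix_apply]
  · simp +contextual [rMatrix_apply, eq_comm]
  · simp
  · simp +contextual [rMatrix_apply, eq_comm]
  · simp

theorem sum_mul_rMatrix_mul (F G : Fin N → R) (a k : Fin N) :
    ∑ p, ∑ m, F p * rMatrix N R (p, m) (a, k) * G m = F k * rho R k a * G a := by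
  have := sum_mul_rMatrix (fun p m => F p * G m) a k
  rw [mul_right_comm, ← this]
  exact Finset.sum_congr rfl fun p _ => Finset.sum_congr rfl fun m _ => by ring

theorem sum_mul_rMatrix_mul' (F G : Fin N → R) (a k : Fin N) :
    ∑ p, ∑ m, F p * rMatrix N R (a, k) (p, m) * G m = F k * rho R a k * G a := by
  have := sum_rMatrix_mul (fun p m => F p * G m) a k
  rw [mul_comm (F k), mul_assoc, ← this]
  exact Finset.sum_congr rfl fun p _ => Finset.sum_congr rfl fun m _ => by ring

theorem in1_mul_in2_apply (X Y : Matrix (Fin N) (Fin N) R) (p q : Fin N × Fin N) :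
    (in1 X * in2 Y) p q = X p.1 q.1 * Y p.2 q.2 := by
  rw [in1, in2, ← Matrix.mul_kronecker_mul, Matrix.mul_one, Matrix.one_mul]; rfl

theorem in1_mul_mul_in2_apply (X Y : Matrix (Fin N) (Fin N) R) (T : Op2 N R) (i k a b : Fin N) :
    (in1 X * T * in2 Y) (i, k) (a, b) = ∑ p, ∑ m, X i p * T (p, k) (a, m) * Y m b := by
  simp only [Matrix.mul_apply, in1, in2, Fintype.sum_prod_type, Matrix.kroneckerMap_apply,
    Matrix.one_apply, mul_ite, ite_mul, mul_one, mul_zero, one_mul, zero_mul,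
    Finset.sum_ite_eq', Finset.sum_ite_eq, Finset.mem_univ, if_true, Finset.sum_mul,
    Finset.sum_ite_irrel, Finset.sum_const_zero]
  rw [Finset.sum_comm]

theorem in2_mul_mul_in1_apply (X Y : Matrix (Fin N) (Fin N) R) (T : Op2 N R) (i k a b : Fin N) :
    (in2 Y * T * in1 X) (i, k) (a, b) = ∑ p, ∑ m, Y k m * T (i, m) (p, b) * X p a := by
  simp only [Matrix.mul_apply, in1, in2, Fintype.sum_prod_type, Matrix.kroneckerMap_apply,
    Matrix.one_apply, mul_ite, ite_mul, mul_one, mul_zero, one_mul, zero_mul,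
    Finset.sum_ite_eq', Finset.sum_ite_eq, Finset.mem_univ, if_true, Finset.sum_mul,
    Finset.sum_ite_irrel, Finset.sum_const_zero]

theorem mul_rMatrix_apply (X Y : Matrix (Fin N) (Fin N) R) (i k a b : Fin N) :
    (in1 X * in2 Y * rMatrix N R) (i, k) (a, b) = X i b * Y k a * rho R b a := by
  rw [Matrix.mul_apply, Fintype.sum_prod_type]
  simp only [in1_mul_in2_apply]
  exact sum_mul_rMatrix (fun p m => X i p * Y k m) a b

theorem bracketPair_apply (X Y : Matrix (Fin N) (Fin N) R) (i k a b : Fin N) :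
    bracketPair X Y (i, k) (a, b) =
      rho R i k * X k a * Y i b - rho R b a * X i b * Y k a := by
  rw [bracketPair, Matrix.sub_apply, mul_rMatrix_apply, Matrix.mul_apply, Fintype.sum_prod_type]
  simp only [in1_mul_in2_apply]
  rw [sum_rMatrix_mul (fun p m => X p a * Y m b) i k]
  ring

theorem bracketNext_apply (X Y : Matrix (Fin N) (Fin N) R) (i k a b : Fin N) :
    bracketNext X Y (i, k) (a, b) = -(rho R k a * X i k * Y a b) := by
  rw [bracketNext, in1_mul_mul_in2_apply]
  simp only [qMatrix, transp2, Matrix.neg_apply, Matrix.of_apply, mul_neg, neg_mul,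
    Finset.sum_neg_distrib]
  rw [sum_mul_rMatrix_mul (fun p => X i p) (fun m => Y m b) a k]
  ring

theorem bracketXA_apply (X A : Matrix (Fin N) (Fin N) R) (i k a b : Fin N) :
    bracketXA X A (i, k) (a, b) =
      -(rho R k a * X i k * A a b) - rho R b a * X i b * A k a := by
  have h : transp2 (qMatrix N R) = -rMatrix N R := by
    ext p q; simp [transp2, qMatrix]
  have h1 := bracketNext_apply X A i k a b
  rw [bracketNext] at h1
  rw [bracketXA, Matrix.add_apply, h, h1, Matrix.mul_neg, Matrix.neg_apply, mul_rMatrix_apply]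
  ring

theorem bracketAA_apply (A : Matrix (Fin N) (Fin N) R) (i k a b : Fin N) :
    bracketAA A (i, k) (a, b) =
      rho R i k * A k a * A i b - rho R b a * A i b * A k a
        + rho R a k * A i k * A a b - rho R b i * A k i * A b a := by
  have h1 := bracketPair_apply A A i k a b
  rw [bracketPair] at h1
  rw [bracketAA, Matrix.sub_apply, Matrix.add_apply, h1, in1_mul_mul_in2_apply,
    in2_mul_mul_in1_apply]
  simp only [transp1, Matrix.of_apply]
  have h2 : ∑ p, ∑ m, A k m * rMatrix N R (p, m) (i, b) * A p a = A k i * A b a * rho R b i := by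
    rw [← sum_mul_rMatrix (fun p m => A k m * A p a)]
    exact Finset.sum_congr rfl fun p _ => Finset.sum_congr rfl fun m _ => by ring
  rw [sum_mul_rMatrix_mul' (fun p => A i p) (fun m => A m b) a k, h2]
  ring

theorem flip12_apply {R : Type*} (T : Op2 N R) (i k a b : Fin N) :
    flip12 T (i, k) (a, b) = T (k, i) (b, a) := rfl

variable {j : ℕ}

/-- The bracket is polynomial in the entries with integer coefficients, hence compatible with ring
homomorphisms; this allows the generic Poisson tensor to be specialised at a point. -/
theorem chainBracket_map {S : Type*} [CommRing S] (f : R →+* S)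
    (x : Slot j → Matrix (Fin N) (Fin N) R) (s t : Slot j) (p q : Fin N × Fin N) :
    chainBracket (fun s => (x s).map f) s t p q = f (chainBracket x s t p q) := by
  obtain ⟨i, k⟩ := p
  obtain ⟨a, b⟩ := q
  have hf : ∀ (M : Matrix (Fin N) (Fin N) R) (i k : Fin N), (M.map f) i k = f (M i k) :=
    fun _ _ _ => rfl
  rcases s with _ | ⟨m, c⟩ <;> rcases t with _ | ⟨n, d⟩ <;> simp only [chainBracket] <;>
    repeat' split_ifs
  all_goals simp only [bracketAA_apply, bracketXA_apply, bracketPair_apply, bracketNext_apply,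
    flip12_apply, Matrix.neg_apply, Matrix.zero_apply, map_add, map_sub, map_neg, map_mul,
    map_rho, map_zero, hf]

theorem poissonTensor_map {S : Type*} [CommRing S] (f : R →+* S)
    (x : Slot j → Matrix (Fin N) (Fin N) R) :
    poissonTensor (fun s => (x s).map f) = (poissonTensor x).map f := by
  ext u v
  exact chainBracket_map f x _ _ _ _

end Entries

/-! ### First order jets and partial derivatives on localizations -/

section Jets

open TrivSqZeroExt MvPolynomial

variable {k σ : Type*} [CommRing k] {A : Type*} [CommRing A]

/-- The first order jet `X u ↦ χ (X u) + ε v u` at `χ` in the direction `v`. -/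
noncomputable def jetPoly (χ : MvPolynomial σ k →+* A) (v : σ → A) :
    MvPolynomial σ k →+* DualNumber A :=
  eval₂Hom ((inlHom A A).comp (χ.comp C)) fun u => inl (χ (X u)) + inr (v u)

@[simp] theorem jetPoly_X (χ : MvPolynomial σ k →+* A) (v : σ → A) (u : σ) :
    jetPoly χ v (X u) = inl (χ (X u)) + inr (v u) := by
  simp [jetPoly]

@[simp] theorem jetPoly_C (χ : MvPolynomial σ k →+* A) (v : σ → A) (c : k) :
    jetPoly χ v (C c) = inl (χ (C c)) := by
  simp [jetPoly]

@[simp] theorem fst_jetPoly (χ : MvPolynomial σ k →+* A) (v : σ → A) (p : MvPolynomial σ k) :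
    fst (jetPoly χ v p) = χ p := by
  have : (fstHom A A A).toRingHom.comp (jetPoly χ v) = χ := by
    apply MvPolynomial.ringHom_ext <;> intro <;> simp
  exact congrArg (fun f => f p) this

theorem snd_jetPoly [Fintype σ] (χ : MvPolynomial σ k →+* A) (v : σ → A)
    (p : MvPolynomial σ k) :
    snd (jetPoly χ v p) = ∑ u, v u * χ (pderiv u p) := by
  classical
  induction p using MvPolynomial.induction_on with
  | C a => simp
  | add p q hp hq => simp [hp, hq, mul_add, Finset.sum_add_distrib]
  | mul_X p i hp =>
    have h1 : ∑ u, v u * (χ p * χ (pderiv u (X i))) = χ p * v i := by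
      rw [Finset.sum_eq_single i]
      · simp [mul_comm]
      · intro b _ hb
        simp [pderiv_X_of_ne (Ne.symm hb)]
      · simp
    simp only [map_mul, jetPoly_X, DualNumber.snd_mul, fst_jetPoly, hp, pderiv_mul, map_add,
      mul_add, Finset.sum_add_distrib, h1, snd_add, snd_inl, snd_inr, fst_inl, fst_inr]
    have h2 : (∑ u, v u * χ (pderiv u p)) * χ (X i) =
        ∑ u, v u * (χ (pderiv u p) * χ (X i)) := by
      rw [Finset.sum_mul]
      exact Finset.sum_congr rfl fun u _ => by ring
    rw [← h2]
    ring

variable {O : Type*} [CommRing O] [Algebra (MvPolynomial σ k) O]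
  (M : Submonoid (MvPolynomial σ k)) [IsLocalization M O]

/-- A dual number is a unit as soon as its constant part is one, which is what makes jets extend to
denominators. -/
theorem isUnit_jetPoly (ψ : O →+* A) (v : σ → A) (y : M) :
    IsUnit (jetPoly (ψ.comp (algebraMap (MvPolynomial σ k) O)) v y) := by
  rw [TrivSqZeroExt.isUnit_iff_isUnit_fst, fst_jetPoly]
  exact (IsLocalization.map_units O y).map ψ

/-- The first order jet at `ψ` in the direction `v`, on a localization of the polynomial ring. -/
noncomputable def jet (ψ : O →+* A) (v : σ → A) : O →+* DualNumber A :=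
  IsLocalization.lift (M := M) (isUnit_jetPoly M ψ v)

@[simp] theorem jet_algebraMap (ψ : O →+* A) (v : σ → A) (p : MvPolynomial σ k) :
    jet M ψ v (algebraMap _ O p) =
      jetPoly (ψ.comp (algebraMap (MvPolynomial σ k) O)) v p := by
  simp [jet]

@[simp] theorem fst_jet (ψ : O →+* A) (v : σ → A) (f : O) : fst (jet M ψ v f) = ψ f := by
  have : (fstHom A A A).toRingHom.comp (jet M ψ v) = ψ := by
    apply IsLocalization.ringHom_ext M
    ext x <;> simp
  exact congrArg (fun g => g f) this

variable [Fintype σ] [DecidableEq σ]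

/-- The partial derivative on a localization of the polynomial ring. -/
noncomputable def pd (u : σ) (f : O) : O := snd (jet M (RingHom.id O) (Pi.single u 1) f)

-- Differentiating `f d = n` gives the quotient rule with denominators cleared, so no division is
-- needed in the localization.
omit [DecidableEq σ] in
theorem snd_jet_mul (ψ : O →+* A) (v : σ → A) {f : O} {n d : MvPolynomial σ k}
    (h : f * algebraMap _ O d = algebraMap _ O n) :
    snd (jet M ψ v f) * ψ (algebraMap _ O d) + ψ f * ∑ u, v u * ψ (algebraMap _ O (pderiv u d)) =
      ∑ u, v u * ψ (algebraMap _ O (pderiv u n)) := by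
  have := congrArg (fun g => snd (jet M ψ v g)) h
  simp only [map_mul, DualNumber.snd_mul, jet_algebraMap, fst_jet, fst_jetPoly, snd_jetPoly] at this
  rw [add_comm]
  simpa using this

theorem pd_mul {u : σ} {f : O} {n d : MvPolynomial σ k}
    (h : f * algebraMap _ O d = algebraMap _ O n) :
    pd M u f * algebraMap _ O d + f * algebraMap _ O (pderiv u d) =
      algebraMap _ O (pderiv u n) := by
  simpa [pd, Pi.single_apply] using snd_jet_mul M (RingHom.id O) (Pi.single u 1) h

/-- The chain rule: both sides satisfy the cleared quotient rule, and the value of the denominator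
is a unit. -/
theorem snd_jet (ψ : O →+* A) (v : σ → A) (f : O) :
    snd (jet M ψ v f) = ∑ u, v u * ψ (pd M u f) := by
  obtain ⟨⟨n, d⟩, h⟩ := IsLocalization.surj M f
  have h1 := snd_jet_mul M ψ v h
  have hd : IsUnit (ψ (algebraMap _ O (d : MvPolynomial σ k))) :=
    (IsLocalization.map_units O d).map ψ
  apply hd.mul_right_cancel
  rw [eq_sub_of_add_eq h1, Finset.mul_sum, Finset.sum_mul, ← Finset.sum_sub_distrib]
  refine Finset.sum_congr rfl fun u _ => ?_
  rw [← pd_mul M h]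
  simp only [map_add, map_mul]
  ring

/-- Used to compare derivatives in the local ring of a point with derivatives in the field of
fractions. -/
theorem map_pd {O' : Type*} [CommRing O'] [Algebra (MvPolynomial σ k) O']
    (M' : Submonoid (MvPolynomial σ k)) [IsLocalization M' O'] (ι : O →+* O')
    (hι : ∀ p : MvPolynomial σ k, ι (algebraMap _ O p) = algebraMap _ O' p) (u : σ) (f : O) :
    pd M' u (ι f) = ι (pd M u f) := by
  obtain ⟨⟨n, d⟩, h⟩ := IsLocalization.surj M f
  have h' : ι f * algebraMap _ O' (d : MvPolynomial σ k) = algebraMap _ O' n := by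
    rw [← hι, ← hι, ← map_mul, h]
  have hd : IsUnit (algebraMap _ O' (d : MvPolynomial σ k)) := by
    rw [← hι]; exact (IsLocalization.map_units O d).map ι
  apply hd.mul_right_cancel
  rw [eq_sub_of_add_eq (pd_mul M' h'), ← hι, ← hι, ← hι, ← pd_mul M h]
  simp only [map_add, map_mul]
  ring

end Jets

/-! ### Hamiltonian vector fields as jets -/

section Brackets

open TrivSqZeroExt

variable {N j : ℕ}

/-- Replaces the quotient rule for the reduced fraction by a derivative read off from a ring
homomorphism, so that products, inverses and determinants can be differentiated by functoriality. -/
theorem partialDeriv_eq_pd (u : Coord N j) (f : RatFun N j) :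
    partialDeriv u f = pd (nonZeroDivisors (PolyFun N j)) u f := by
  have h : f * algebraMap (PolyFun N j) (RatFun N j) (IsFractionRing.den (PolyFun N j) f) =
      algebraMap (PolyFun N j) (RatFun N j) (IsFractionRing.num (PolyFun N j) f) :=
    IsFractionRing.num_mul_den_eq_num_iff_eq.2 rfl
  have hd : algebraMap (PolyFun N j) (RatFun N j) (IsFractionRing.den (PolyFun N j) f) ≠ 0 :=
    IsFractionRing.to_map_ne_zero_of_mem_nonZeroDivisors (Subtype.property _)
  simp only [partialDeriv]
  rw [div_eq_iff (pow_ne_zero 2 hd), map_sub, map_mul, map_mul,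
    ← pd_mul (nonZeroDivisors (PolyFun N j)) h, ← h]
  ring

/-- The jet of rational functions along the Hamiltonian vector field of the coordinate `v`. -/
noncomputable def hamJet (v : Coord N j) : RatFun N j →+* DualNumber (RatFun N j) :=
  jet (nonZeroDivisors (PolyFun N j)) (RingHom.id (RatFun N j))
    fun u => poissonTensor (genericChain N j) u v

@[simp] theorem fst_hamJet (v : Coord N j) (f : RatFun N j) : fst (hamJet v f) = f := by
  simp [hamJet]

theorem snd_hamJet (v : Coord N j) (f : RatFun N j) :
    snd (hamJet v f) = ∑ u, partialDeriv u f * poissonTensor (genericChain N j) u v := by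
  simp only [hamJet, snd_jet, partialDeriv_eq_pd, RingHom.id_apply]
  exact Finset.sum_congr rfl fun u _ => mul_comm _ _

/-- Since the bracket is a biderivation, commuting with the coordinates is enough. -/
theorem isCasimir_of_snd_hamJet {f : RatFun N j} (h : ∀ v, snd (hamJet v f) = 0) :
    IsCasimir f := by
  intro g
  rw [bracket, Finset.sum_comm]
  refine Finset.sum_eq_zero fun v _ => ?_
  rw [← Finset.sum_mul, ← snd_hamJet, h, zero_mul]

theorem hamJet_genericChain (t : Slot j) (r b : Fin N) (s : Slot j) (i a : Fin N) :
    hamJet (t, r, b) (genericChain N j s i a) =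
      inl (genericChain N j s i a) +
        inr (chainBracket (genericChain N j) s t (i, r) (a, b)) := by
  simp [hamJet, genericChain, poissonTensor]

end Brackets

/-! ### Infinitesimal gauge transformations and logarithmic derivatives -/

section Gauge

open TrivSqZeroExt

variable {n m : Type*} [Fintype n] [DecidableEq n] [Fintype m] [DecidableEq m]
  {K : Type*} [CommRing K]

/-- The infinitesimal gauge transformation `1 + ε L`. -/
def gauge (L : Matrix n n K) : Matrix n n (DualNumber K) := 1 + L.map inr

omit [DecidableEq n] in
theorem map_inr_mul_map_inl (L M : Matrix n n K) :
    (L.map inr * M.map inl : Matrix n n (DualNumber K)) = (L * M).map inr := by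
  ext i k : 1
  refine TrivSqZeroExt.ext ?_ ?_ <;> simp [Matrix.mul_apply, fst_sum, snd_sum, mul_comm]

omit [DecidableEq n] in
theorem map_inl_mul_map_inr (L M : Matrix n n K) :
    (L.map inl * M.map inr : Matrix n n (DualNumber K)) = (L * M).map inr := by
  ext i k : 1
  refine TrivSqZeroExt.ext ?_ ?_ <;> simp [Matrix.mul_apply, fst_sum, snd_sum, mul_comm]

omit [DecidableEq n] in
theorem map_inr_mul_map_inr (L M : Matrix n n K) :
    (L.map inr * M.map inr : Matrix n n (DualNumber K)) = 0 := by
  ext i k : 1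
  simp [Matrix.mul_apply]

theorem gauge_mul_gauge (L M : Matrix n n K) : gauge L * gauge M = gauge (L + M) := by
  rw [gauge, gauge, gauge, mul_add, add_mul, add_mul, map_inr_mul_map_inr]
  ext i k : 1
  refine TrivSqZeroExt.ext ?_ ?_ <;> simp [← add_assoc, add_comm]

omit [Fintype n] in
@[simp] theorem gauge_zero : gauge (0 : Matrix n n K) = 1 := by
  ext i k : 1
  simp [gauge]

omit [Fintype n] in
theorem gauge_transpose (L : Matrix n n K) : (gauge L)ᵀ = gauge Lᵀ := by
  simp [gauge, Matrix.transpose_map]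

omit [Fintype n] [Fintype m] in
theorem gauge_submatrix {f : m → n} (hf : Function.Injective f) (L : Matrix n n K) :
    (gauge L).submatrix f f = gauge (L.submatrix f f) := by
  ext i k : 1
  simp [gauge, Matrix.one_apply, hf.eq_iff]

theorem det_gauge (L : Matrix n n K) : (gauge L).det = 1 + inr L.trace := by
  have h : (L.map inr : Matrix n n (DualNumber K)) = (DualNumber.eps : DualNumber K) • L.map inl := by
    ext i k : 1
    refine TrivSqZeroExt.ext ?_ ?_ <;> simp
  have ht : (L.map inl : Matrix n n (DualNumber K)).trace = inl L.trace := by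
    refine TrivSqZeroExt.ext ?_ ?_ <;> simp [Matrix.trace, fst_sum, snd_sum]
  rw [gauge, h, Matrix.det_one_add_smul, DualNumber.eps_pow_two, mul_zero, add_zero, ht]
  refine TrivSqZeroExt.ext ?_ ?_ <;> simp

theorem gauge_mul_mul_gauge (L M R : Matrix n n K) :
    gauge L * M.map inl * gauge R = M.map inl + (L * M + M * R).map inr := by
  rw [gauge, gauge, add_mul, mul_add, one_mul, mul_one, map_inr_mul_map_inl, add_mul,
    map_inl_mul_map_inr, map_inr_mul_map_inr]
  ext i k : 1
  refine TrivSqZeroExt.ext ?_ ?_ <;> simp [add_comm]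

/-- Under the jet `φ` the matrix `M` varies by `L * M + M * R`. -/
def Varies (φ : K →+* DualNumber K) (M L R : Matrix n n K) : Prop :=
  M.map φ = gauge L * M.map inl * gauge R

/-- Under the jet `φ` the function `f` has logarithmic derivative `δ`. -/
def HasLogDeriv (φ : K →+* DualNumber K) (f δ : K) : Prop :=
  φ f = (1 + inr δ) * inl f

variable {φ : K →+* DualNumber K}

theorem one_add_inr_mul (a b : K) :
    ((1 + inr a) * (1 + inr b) : DualNumber K) = 1 + inr (a + b) := by
  refine TrivSqZeroExt.ext ?_ ?_ <;> simp [add_comm]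

theorem HasLogDeriv.one : HasLogDeriv φ 1 0 := by simp [HasLogDeriv]

theorem HasLogDeriv.mul {f g δ η : K} (hf : HasLogDeriv φ f δ) (hg : HasLogDeriv φ g η) :
    HasLogDeriv φ (f * g) (δ + η) := by
  rw [HasLogDeriv] at *
  rw [map_mul, hf, hg, ← one_add_inr_mul, inl_mul]
  ring

theorem HasLogDeriv.prod {ι : Type*} {s : Finset ι} {f δ : ι → K}
    (h : ∀ i ∈ s, HasLogDeriv φ (f i) (δ i)) :
    HasLogDeriv φ (∏ i ∈ s, f i) (∑ i ∈ s, δ i) := by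
  classical
  induction s using Finset.induction_on with
  | empty => simpa using HasLogDeriv.one
  | insert a s ha ih =>
    rw [Finset.prod_insert ha, Finset.sum_insert ha]
    exact (h a (Finset.mem_insert_self a s)).mul
      (ih fun i hi => h i (Finset.mem_insert_of_mem hi))

theorem HasLogDeriv.snd_eq_zero {f : K} (h : HasLogDeriv φ f 0) : snd (φ f) = 0 := by
  rw [h]; simp

theorem HasLogDeriv.inv {K : Type*} [Field K] {φ : K →+* DualNumber K} {f δ : K}
    (hf : HasLogDeriv φ f δ) : HasLogDeriv φ f⁻¹ (-δ) := by
  by_cases h0 : f = 0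
  · simp [h0, HasLogDeriv]
  · rw [HasLogDeriv] at *
    have h1 : φ f⁻¹ * φ f = 1 := by rw [← map_mul, inv_mul_cancel₀ h0, map_one]
    have h2 : ((1 + inr (-δ)) * inl f⁻¹) * φ f = 1 := by
      rw [hf, mul_mul_mul_comm, one_add_inr_mul, ← inl_mul, inv_mul_cancel₀ h0]
      simp
    exact (IsUnit.of_mul_eq_one_right _ h1).mul_right_cancel (h1.trans h2.symm)

theorem HasLogDeriv.div {K : Type*} [Field K] {φ : K →+* DualNumber K} {f g δ η : K}
    (hf : HasLogDeriv φ f δ) (hg : HasLogDeriv φ g η) : HasLogDeriv φ (f / g) (δ - η) := by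
  rw [div_eq_mul_inv, sub_eq_add_neg]
  exact hf.mul hg.inv

theorem varies_iff {M L R : Matrix n n K} (hφ : ∀ a, fst (φ a) = a) :
    Varies φ M L R ↔ ∀ i a, snd (φ (M i a)) = (L * M + M * R) i a := by
  rw [Varies, gauge_mul_mul_gauge]
  constructor
  · intro h i a
    have := congrArg (fun X => snd (X i a)) h
    simpa using this
  · intro h
    ext i a : 1
    refine TrivSqZeroExt.ext ?_ ?_
    · simp [hφ]
    · simpa using h i a

/-- The inner gauges cancel because `(1 + ε R)(1 - ε R) = 1`; this drives all telescoping along the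
chain. -/
theorem Varies.mul {M M' L R R' : Matrix n n K} (h : Varies φ M L R) (h' : Varies φ M' (-R) R') :
    Varies φ (M * M') L R' := by
  rw [Varies] at *
  have h1 : gauge R * gauge (-R) = 1 := by rw [gauge_mul_gauge, add_neg_cancel, gauge_zero]
  have h2 : (M * M').map (inl : K → DualNumber K) = M.map inl * M'.map inl :=
    Matrix.map_mul (f := inlHom K K)
  calc (M * M').map φ = M.map φ * M'.map φ := Matrix.map_mul
    _ = gauge L * M.map inl * (gauge R * gauge (-R)) * M'.map inl * gauge R' := by
        rw [h, h']; simp only [mul_assoc]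
    _ = _ := by rw [h1, h2, mul_one]; simp only [mul_assoc]

theorem Varies.transpose {M L R : Matrix n n K} (h : Varies φ M L R) : Varies φ Mᵀ Rᵀ Lᵀ := by
  rw [Varies] at *
  rw [Matrix.transpose_map, h, Matrix.transpose_mul, Matrix.transpose_mul, gauge_transpose,
    gauge_transpose, ← Matrix.transpose_map, mul_assoc]

theorem Varies.inv {M L R : Matrix n n K} (hM : IsUnit M.det) (h : Varies φ M L R) :
    Varies φ M⁻¹ (-R) (-L) := by
  rw [Varies] at *
  have h1 : gauge R * gauge (-R) = 1 := by rw [gauge_mul_gauge, add_neg_cancel, gauge_zero]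
  have h3 : gauge L * gauge (-L) = 1 := by rw [gauge_mul_gauge, add_neg_cancel, gauge_zero]
  have h2 : M.map (inl : K → DualNumber K) * M⁻¹.map inl = 1 := by
    have : (M * M⁻¹).map (inl : K → DualNumber K) = M.map inl * M⁻¹.map inl :=
      Matrix.map_mul (f := inlHom K K)
    rw [← this, Matrix.mul_nonsing_inv _ hM]
    exact Matrix.map_one _ (inl_zero K) (inl_one K)
  have h4 : M.map φ * (gauge (-R) * M⁻¹.map inl * gauge (-L)) = 1 := by
    calc _ = gauge L * (M.map inl * (gauge R * gauge (-R)) * M⁻¹.map inl) * gauge (-L) := by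
          rw [h]; simp only [mul_assoc]
      _ = 1 := by rw [h1, mul_one, h2, mul_one, h3]
  have h5 : M⁻¹.map φ * M.map φ = 1 := by
    rw [← Matrix.map_mul, Matrix.nonsing_inv_mul _ hM]
    exact Matrix.map_one _ (map_zero φ) (map_one φ)
  exact left_inv_eq_right_inv h5 h4

theorem Varies.det {M L R : Matrix n n K} (h : Varies φ M L R) :
    HasLogDeriv φ M.det (L.trace + R.trace) := by
  have h1 : φ M.det = (M.map φ).det := RingHom.map_det φ M
  have h2 : (inl M.det : DualNumber K) = (M.map inl).det := RingHom.map_det (inlHom K K) M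
  rw [HasLogDeriv, h1, h2, h, Matrix.det_mul, Matrix.det_mul, det_gauge, det_gauge,
    ← one_add_inr_mul]
  ring

-- If the selected rows of `G` vanish outside the selected indices, then those rows of `G X` combine
-- only the same rows of `X`. This is how triangular gauges act on a minor by a determinant.
omit [Fintype n] [DecidableEq n] [Fintype m] [DecidableEq m] in
theorem submatrix_mul_of_range {R : Type*} [CommRing R] [Fintype n] [Fintype m] {f : m → n}
    (hf : Function.Injective f) {l : Type*} (g : l → n) (G X : Matrix n n R)
    (h : ∀ i k, k ∉ Set.range f → G (f i) k = 0) :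
    (G * X).submatrix f g = G.submatrix f f * X.submatrix f g := by
  classical
  ext i a
  simp only [Matrix.submatrix_apply, Matrix.mul_apply]
  rw [← Finset.sum_subset (Finset.subset_univ (Finset.univ.image f)), Finset.sum_image]
  · exact fun _ _ _ _ e => hf e
  · intro x _ hx
    rw [h i x (by simpa using hx), zero_mul]

omit [Fintype n] [DecidableEq n] [Fintype m] [DecidableEq m] in
theorem mul_submatrix_of_range {R : Type*} [CommRing R] [Fintype n] [Fintype m] {f : m → n}
    (hf : Function.Injective f) {l : Type*} (g : l → n) (X H : Matrix n n R)
    (h : ∀ i k, k ∉ Set.range f → H k (f i) = 0) :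
    (X * H).submatrix g f = X.submatrix g f * H.submatrix f f := by
  classical
  ext a i
  simp only [Matrix.submatrix_apply, Matrix.mul_apply]
  rw [← Finset.sum_subset (Finset.subset_univ (Finset.univ.image f)), Finset.sum_image]
  · exact fun _ _ _ _ e => hf e
  · intro x _ hx
    rw [h i x (by simpa using hx), mul_zero]

theorem Varies.submatrix {M L R : Matrix n n K} (h : Varies φ M L R) {f g : m → n}
    (hf : Function.Injective f) (hg : Function.Injective g)
    (hL : ∀ i k, k ∉ Set.range f → L (f i) k = 0)
    (hR : ∀ i k, k ∉ Set.range g → R k (g i) = 0) :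
    Varies φ (M.submatrix f g) (L.submatrix f f) (R.submatrix g g) := by
  rw [Varies] at *
  change (M.map φ).submatrix f g = _ * (M.map inl).submatrix f g * _
  rw [h, mul_submatrix_of_range hg, submatrix_mul_of_range hf,
    gauge_submatrix hf, gauge_submatrix hg]
  · intro i k hk
    have : f i ≠ k := fun e => hk ⟨i, e⟩
    simp [gauge, hL i k hk, this]
  · intro i k hk
    have : k ≠ g i := fun e => hk ⟨i, e.symm⟩
    simp [gauge, hR i k hk, this]

/-- The pencil determinant `det (X A + B)`. -/
noncomputable def pencilDet (A B : Matrix n n K) : Polynomial K :=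
  ((Polynomial.X : Polynomial K) • A.map Polynomial.C + B.map Polynomial.C).det

theorem map_pencilDet {S : Type*} [CommRing S] (f : K →+* S) (A B : Matrix n n K) :
    (pencilDet A B).map f = pencilDet (A.map f) (B.map f) := by
  rw [pencilDet, ← Polynomial.coe_mapRingHom, RingHom.map_det, pencilDet]
  congr 1
  ext i k : 1
  simp

theorem pencilDet_mul_mul (G A B H : Matrix n n K) :
    pencilDet (G * A * H) (G * B * H) =
      Polynomial.C (G.det * H.det) * pencilDet A B := by
  have h : (Polynomial.X : Polynomial K) • (G * A * H).map Polynomial.C +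
      (G * B * H).map Polynomial.C = G.map Polynomial.C *
        ((Polynomial.X : Polynomial K) • A.map Polynomial.C + B.map Polynomial.C) *
          H.map Polynomial.C := by
    rw [Matrix.map_mul, Matrix.map_mul, Matrix.map_mul, Matrix.map_mul, mul_add, add_mul,
      Matrix.mul_smul, Matrix.smul_mul]
  have hC : ∀ S : Matrix n n K, (S.map Polynomial.C).det = Polynomial.C S.det := fun S =>
    (RingHom.map_det Polynomial.C S).symm
  rw [pencilDet, h, Matrix.det_mul, Matrix.det_mul, hC, hC, Polynomial.C_mul, pencilDet]
  ring

/-- A common gauge of both matrices leaves the pencil through its determinant alone, a scalar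
independent of the pencil parameter. -/
theorem Varies.coeff_pencilDet {A B L R : Matrix n n K} (hA : Varies φ A L R)
    (hB : Varies φ B L R) (p : ℕ) :
    HasLogDeriv φ ((pencilDet A B).coeff p) (L.trace + R.trace) := by
  have h1 := map_pencilDet φ A B
  have h2 : (pencilDet A B).map (inlHom K K) = pencilDet (A.map inl) (B.map inl) :=
    map_pencilDet (inlHom K K) A B
  rw [hA, hB, pencilDet_mul_mul, ← h2, det_gauge, det_gauge, one_add_inr_mul] at h1
  have := congrArg (fun q => q.coeff p) h1
  simp only [Polynomial.coeff_map, Polynomial.coeff_C_mul] at this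
  exact this

end Gauge

/-! ### Brackets with one fixed entry as gauge variations -/

section Slices

variable {N j : ℕ} {R : Type*} [CommRing R]

/-- The matrix with column `r` equal to `f` and zero otherwise. -/
def colMat (r : Fin N) (f : Fin N → R) : Matrix (Fin N) (Fin N) R :=
  Matrix.of fun i p => if p = r then f i else 0

theorem colMat_mul_apply (r : Fin N) (f : Fin N → R) (X : Matrix (Fin N) (Fin N) R)
    (i a : Fin N) : (colMat r f * X) i a = f i * X r a := by
  simp [colMat, Matrix.mul_apply]

theorem mul_colMat_transpose_apply (b : Fin N) (g : Fin N → R) (X : Matrix (Fin N) (Fin N) R)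
    (i a : Fin N) : (X * (colMat b g)ᵀ) i a = X i b * g a := by
  simp [colMat, Matrix.mul_apply]

/-- The connection of the Hamiltonian vector field of the entry `(r, b)` of a matrix `y` in the
pair `k`. -/
def pairConn (y : Matrix (Fin N) (Fin N) R) (k : ℕ) (r b : Fin N) (m : ℕ) :
    Matrix (Fin N) (Fin N) R :=
  if m = k + 1 then colMat r fun i => -(rho R r i * y i b)
  else if m = k then colMat b fun i => rho R i b * y r i else 0

/-- The connection of the Hamiltonian vector field of the entry `(r, b)` of `𝔸`. -/
def headConn (y : Matrix (Fin N) (Fin N) R) (r b : Fin N) (m : ℕ) : Matrix (Fin N) (Fin N) R :=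
  if m = 0 then (colMat r fun i => -(rho R r i * y i b)) + colMat b fun i => -(rho R b i * y r i)
  else 0

theorem pairConn_succ (y : Matrix (Fin N) (Fin N) R) {k m : ℕ} (h : m = k + 1) (r b : Fin N) :
    pairConn y k r b m = colMat r fun i => -(rho R r i * y i b) := if_pos h

theorem pairConn_self (y : Matrix (Fin N) (Fin N) R) {k m : ℕ} (h : m = k) (r b : Fin N) :
    pairConn y k r b m = colMat b fun i => rho R i b * y r i := by
  rw [pairConn, if_neg (by omega), if_pos h]

theorem pairConn_of_ne (y : Matrix (Fin N) (Fin N) R) {k m : ℕ} (h : m ≠ k) (h' : m ≠ k + 1)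
    (r b : Fin N) : pairConn y k r b m = 0 := by
  rw [pairConn, if_neg h', if_neg h]

theorem headConn_zero (y : Matrix (Fin N) (Fin N) R) (r b : Fin N) :
    headConn y r b 0 =
      (colMat r fun i => -(rho R r i * y i b)) + colMat b fun i => -(rho R b i * y r i) :=
  if_pos rfl

theorem headConn_of_ne (y : Matrix (Fin N) (Fin N) R) {m : ℕ} (h : m ≠ 0) (r b : Fin N) :
    headConn y r b m = 0 := if_neg h

theorem bracketPair_slice (X Y : Matrix (Fin N) (Fin N) R) (r b i a : Fin N) :
    bracketPair X Y (i, r) (a, b) =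
      (colMat r (fun i => rho R i r * Y i b) * X +
        X * (colMat b fun a => -(rho R b a * Y r a))ᵀ) i a := by
  rw [bracketPair_apply, Matrix.add_apply, colMat_mul_apply, mul_colMat_transpose_apply]
  ring

theorem neg_flip12_bracketPair_slice (X Y : Matrix (Fin N) (Fin N) R) (k : ℕ) (r b i a : Fin N) :
    (-flip12 (bracketPair Y X)) (i, r) (a, b) =
      (pairConn Y k r b (k + 1) * X + X * (pairConn Y k r b k)ᵀ) i a := by
  rw [Matrix.neg_apply, flip12_apply, bracketPair_apply, Matrix.add_apply,
    pairConn_succ _ rfl, pairConn_self _ rfl, colMat_mul_apply, mul_colMat_transpose_apply]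
  ring

/-- The difference of the two sides involves only `r₁₂ + r₂₁ = 2P`, and `P` commutes with `X ⊗ X`.
-/
theorem neg_flip12_bracketPair_self (X : Matrix (Fin N) (Fin N) R) :
    -flip12 (bracketPair X X) = bracketPair X X := by
  ext ⟨i, k⟩ ⟨a, b⟩
  rw [Matrix.neg_apply, flip12_apply, bracketPair_apply, bracketPair_apply]
  linear_combination X k a * X i b * (rho_add_rho (R := R) b a - rho_add_rho (R := R) i k)

theorem chainBracket_slice (x : Slot j → Matrix (Fin N) (Fin N) R) (k n : Fin j) (c d : Bool)
    (h : n = k → d = false ∨ c = true) (r b i a : Fin N) :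
    chainBracket x (some (n, d)) (some (k, c)) (i, r) (a, b) =
      (pairConn (x (some (k, c))) k r b (n + 1) * x (some (n, d)) +
        x (some (n, d)) * (pairConn (x (some (k, c))) k r b n)ᵀ) i a := by
  by_cases hnk : n = k
  · subst hnk
    rw [← neg_flip12_bracketPair_slice, chainBracket, if_pos rfl]
    rcases h rfl with rfl | rfl
    · cases c
      · rw [if_neg (by simp), neg_flip12_bracketPair_self]
      · simp
    · cases d
      · simp
      · rw [if_neg (by simp), neg_flip12_bracketPair_self]
  · have hnk' : (n : ℕ) ≠ k := fun e => hnk (Fin.ext e)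
    rw [chainBracket, if_neg hnk]
    by_cases h1 : (n : ℕ) = k + 1
    · rw [if_pos h1, pairConn_of_ne _ (by omega) (by omega), pairConn_succ _ h1,
        bracketNext_apply, Matrix.add_apply, zero_mul, mul_colMat_transpose_apply,
        Matrix.zero_apply]
      ring
    · rw [if_neg h1]
      by_cases h2 : (k : ℕ) = n + 1
      · rw [if_pos h2, pairConn_self _ h2.symm, pairConn_of_ne _ hnk' h1, Matrix.neg_apply,
          flip12_apply, bracketNext_apply, Matrix.add_apply, colMat_mul_apply,
          Matrix.transpose_zero, mul_zero, Matrix.zero_apply]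
        ring
      · rw [if_neg h2, pairConn_of_ne _ hnk' h1, pairConn_of_ne _ (by omega) (by omega)]
        simp

/-- The complementary form, which excludes only the bracket of `B` with `C`. Thus `B` can always be
varied by the previous form and `C` always by this one, while for each fixed Hamiltonian one of the
two forms serves both. -/
theorem chainBracket_slice_same (x : Slot j → Matrix (Fin N) (Fin N) R) (k : Fin j) (c d : Bool)
    (h : d = true ∨ c = false) (r b i a : Fin N) :
    chainBracket x (some (k, d)) (some (k, c)) (i, r) (a, b) =
      (colMat r (fun i => rho R i r * x (some (k, c)) i b) * x (some (k, d)) +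
        x (some (k, d)) * (colMat b fun a => -(rho R b a * x (some (k, c)) r a))ᵀ) i a := by
  rw [← bracketPair_slice, chainBracket, if_pos rfl, if_neg]
  rintro ⟨rfl, rfl⟩
  simp at h

theorem chainBracket_none_slice (x : Slot j → Matrix (Fin N) (Fin N) R) (k : Fin j) (c : Bool)
    (r b i a : Fin N) :
    chainBracket x none (some (k, c)) (i, r) (a, b) =
      (pairConn (x (some (k, c))) k r b 0 * x none +
        x none * (pairConn (x (some (k, c))) k r b 0)ᵀ) i a := by
  rw [chainBracket]
  by_cases h : (k : ℕ) = 0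
  · rw [if_pos h, pairConn_self _ h.symm, Matrix.neg_apply, flip12_apply, bracketXA_apply,
      Matrix.add_apply, colMat_mul_apply, mul_colMat_transpose_apply]
    ring
  · rw [if_neg h, pairConn_of_ne _ (Ne.symm h) (by omega)]
    simp

theorem chainBracket_slice_none (x : Slot j → Matrix (Fin N) (Fin N) R) (n : Fin j) (d : Bool)
    (r b i a : Fin N) :
    chainBracket x (some (n, d)) none (i, r) (a, b) =
      (headConn (x none) r b (n + 1) * x (some (n, d)) +
        x (some (n, d)) * (headConn (x none) r b n)ᵀ) i a := by
  rw [chainBracket, headConn_of_ne _ (Nat.succ_ne_zero _)]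
  by_cases h : (n : ℕ) = 0
  · rw [if_pos h, h, headConn_zero, bracketXA_apply, Matrix.add_apply, Matrix.transpose_add, mul_add,
      zero_mul, Matrix.add_apply, mul_colMat_transpose_apply, mul_colMat_transpose_apply,
      Matrix.zero_apply]
    ring
  · rw [if_neg h, headConn_of_ne _ h]
    simp

/-- The left gauge here is the link `0` that also acts on the right of the first pair, so that it
cancels inside `S`. It arises from the congruence form by moving twice a rank one term across `𝔸`.
-/
theorem chainBracket_none_none_slice (x : Slot j → Matrix (Fin N) (Fin N) R) (r b i a : Fin N) :
    chainBracket x none none (i, r) (a, b) =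
      (headConn (x none) r b 0 * x none + x none *
        (colMat r (fun i => rho R i r * x none i b) +
          colMat b fun i => rho R i b * x none r i)ᵀ) i a := by
  rw [chainBracket, headConn_zero, bracketAA_apply, Matrix.add_apply, add_mul,
    Matrix.transpose_add, mul_add, Matrix.add_apply, Matrix.add_apply, colMat_mul_apply,
    colMat_mul_apply, mul_colMat_transpose_apply, mul_colMat_transpose_apply]
  linear_combination x none i b * x none r a * (rho_add_rho (R := R) i r - rho_add_rho (R := R) b a)

/-- The congruence form, with right gauge the transpose of the left one; it is the one needed for
`𝔸` and `𝔸ᵀ` simultaneously. -/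
theorem chainBracket_none_none_slice' (x : Slot j → Matrix (Fin N) (Fin N) R) (r b i a : Fin N) :
    chainBracket x none none (i, r) (a, b) =
      ((colMat r (fun i => rho R i r * x none i b) + colMat b fun i => -(rho R b i * x none r i)) *
        x none + x none * (colMat r (fun i => rho R i r * x none i b) +
          colMat b fun i => -(rho R b i * x none r i))ᵀ) i a := by
  rw [chainBracket, bracketAA_apply, Matrix.add_apply, add_mul,
    Matrix.transpose_add, mul_add, Matrix.add_apply, Matrix.add_apply, colMat_mul_apply,
    colMat_mul_apply, mul_colMat_transpose_apply, mul_colMat_transpose_apply]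
  ring

end Slices

/-! ### The Casimirs `Y` and `Z` -/

section HamiltonianVariations

variable {N j : ℕ}

theorem varies_hamJet {v : Coord N j} {s : Slot j} {L R : Matrix (Fin N) (Fin N) (RatFun N j)}
    (h : ∀ i a, chainBracket (genericChain N j) s v.1 (i, v.2.1) (a, v.2.2) =
      (L * genericChain N j s + genericChain N j s * R) i a) :
    Varies (hamJet v) (genericChain N j s) L R := by
  rw [varies_iff (fst_hamJet v)]
  intro i a
  rw [← h, hamJet_genericChain]
  simp

theorem exists_varies_matA (v : Coord N j) :
    ∃ G, Varies (hamJet v) (matA N j) G Gᵀ := by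
  obtain ⟨_ | ⟨k, c⟩, r, b⟩ := v
  · exact ⟨_, varies_hamJet (chainBracket_none_none_slice' _ r b)⟩
  · exact ⟨_, varies_hamJet (chainBracket_none_slice _ k c r b)⟩

/-- An entry of `B` calls for the form `chainBracket_slice_same`, an entry of `C` for
`chainBracket_slice`; in either case both matrices of the pair get the same gauges. -/
theorem exists_varies_matB_matC (v : Coord N j) (n : Fin j) :
    ∃ L R, Varies (hamJet v) (matB N j n) L R ∧ Varies (hamJet v) (matC N j n) L R := by
  obtain ⟨_ | ⟨k, c⟩, r, b⟩ := v
  · exact ⟨_, _, varies_hamJet (chainBracket_slice_none _ n _ r b),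
      varies_hamJet (chainBracket_slice_none _ n _ r b)⟩
  · by_cases h : n = k ∧ c = false
    · obtain ⟨rfl, rfl⟩ := h
      exact ⟨_, _, varies_hamJet (chainBracket_slice_same _ n _ _ (by simp) r b),
        varies_hamJet (chainBracket_slice_same _ n _ _ (by simp) r b)⟩
    · have h' : n = k → c = true := by
        intro e
        cases c
        · exact absurd ⟨e, rfl⟩ h
        · rfl
      exact ⟨_, _, varies_hamJet (chainBracket_slice _ k n _ _ (fun e => Or.inr (h' e)) r b),
        varies_hamJet (chainBracket_slice _ k n _ _ (fun e => Or.inr (h' e)) r b)⟩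

/-- The coefficients of `det (X A + Aᵀ) / det A`, halved in the middle. -/
noncomputable def casimirY (N j : ℕ) (p : Fin (N / 2)) : RatFun N j :=
  (pencilDet (matA N j) (matA N j)ᵀ).coeff (p + 1) / (matA N j).det *
    (if 2 * ((p : ℕ) + 1) = N then 2⁻¹ else 1)

/-- The coefficients of `det (B + X C) / det B`. -/
noncomputable def casimirZ (N j : ℕ) (k : Fin j) (p : Fin N) : RatFun N j :=
  (pencilDet (matC N j k) (matB N j k)).coeff (p + 1) / (matB N j k).det

theorem isCasimir_of_hasLogDeriv {f : RatFun N j} (h : ∀ v, HasLogDeriv (hamJet v) f 0) :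
    IsCasimir f :=
  isCasimir_of_snd_hamJet fun v => (h v).snd_eq_zero

/-- The congruence form is stable under transposition, so every coefficient of the pencil of `𝔸` and
`𝔸ᵀ` has the logarithmic derivative of `det 𝔸`. -/
theorem isCasimir_casimirY (p : Fin (N / 2)) : IsCasimir (casimirY N j p) := by
  refine isCasimir_of_hasLogDeriv fun v => ?_
  obtain ⟨G, hG⟩ := exists_varies_matA v
  have hG' := hG.transpose
  rw [Matrix.transpose_transpose] at hG'
  have h1 := (hG.coeff_pencilDet hG' (p + 1)).div hG.det
  rw [sub_self] at h1
  have h2 : HasLogDeriv (hamJet v) (if 2 * ((p : ℕ) + 1) = N then 2⁻¹ else 1 : RatFun N j) 0 := by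
    split_ifs
    · have h3 : HasLogDeriv (hamJet v) (2 : RatFun N j) 0 := by
        rw [HasLogDeriv, map_ofNat, TrivSqZeroExt.inr_zero, add_zero, one_mul]
        exact (map_ofNat (TrivSqZeroExt.inlHom (RatFun N j) (RatFun N j)) 2).symm
      have h4 := h3.inv
      rwa [neg_zero] at h4
    · exact HasLogDeriv.one
  have h3 := h1.mul h2
  rwa [add_zero] at h3

theorem isCasimir_casimirZ (k : Fin j) (p : Fin N) : IsCasimir (casimirZ N j k p) := by
  refine isCasimir_of_hasLogDeriv fun v => ?_
  obtain ⟨L, R, hB, hC⟩ := exists_varies_matB_matC v k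
  have h1 := (hC.coeff_pencilDet hB (p + 1)).div hB.det
  rwa [sub_self] at h1

end HamiltonianVariations

/-! ### Corner minors under triangular gauges -/

section Minors

variable {N : ℕ} {K : Type*} [CommRing K] {φ : K →+* DualNumber K}

/-- The sum of the first `q` diagonal entries. -/
def headTrace (q : ℕ) (L : Matrix (Fin N) (Fin N) K) : K :=
  ∑ i : Fin N, if (i : ℕ) < q then L i i else 0

/-- The sum of the last `q` diagonal entries. -/
def tailTrace (q : ℕ) (R : Matrix (Fin N) (Fin N) K) : K :=
  ∑ i : Fin N, if N - q ≤ (i : ℕ) then R i i else 0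

/-- Lower triangular matrices. -/
def IsLower (L : Matrix (Fin N) (Fin N) K) : Prop := ∀ i k, i < k → L i k = 0

theorem sum_castLE (q : ℕ) (hq : q ≤ N) (F : Fin N → K) :
    ∑ i : Fin q, F ⟨i, by omega⟩ = ∑ i : Fin N, if (i : ℕ) < q then F i else 0 := by
  rw [← Finset.sum_filter]
  refine Finset.sum_bij (fun i _ => (⟨i, by omega⟩ : Fin N)) ?_ ?_ ?_ ?_
  · intro a _; simp
  · intro a _ b _ h; simpa [Fin.ext_iff] using h
  · intro b hb; exact ⟨⟨b, by simpa using hb⟩, Finset.mem_univ _, rfl⟩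
  · intro a _; rfl

theorem sum_natAdd (q : ℕ) (hq : q ≤ N) (F : Fin N → K) :
    ∑ i : Fin q, F ⟨N - q + i, by omega⟩ = ∑ i : Fin N, if N - q ≤ (i : ℕ) then F i else 0 := by
  rw [← Finset.sum_filter]
  refine Finset.sum_bij (fun i _ => (⟨N - q + i, by omega⟩ : Fin N)) ?_ ?_ ?_ ?_
  · intro a _; simp; omega
  · intro a _ b _ h; simpa [Fin.ext_iff] using h
  · intro b hb
    have hb' : N - q ≤ (b : ℕ) := by simpa using hb
    exact ⟨⟨b - (N - q), by omega⟩, Finset.mem_univ _, Fin.ext (by simp; omega)⟩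
  · intro a _; rfl

/-- A lower triangular left gauge preserves the span of the first `q` rows, and a lower triangular
right gauge that of the last `q` columns. Only the diagonal blocks remain, and they contribute their
traces. -/
theorem Varies.upperRightMinor {M L R : Matrix (Fin N) (Fin N) K} (h : Varies φ M L R)
    (hL : IsLower L) (hR : IsLower R) (q : ℕ) (hq : q ≤ N) :
    HasLogDeriv φ (upperRightMinor M q hq) (headTrace q L + tailTrace q R) := by
  have h1 := (h.submatrix (f := fun i : Fin q => (⟨i, by omega⟩ : Fin N))
    (g := fun i : Fin q => (⟨N - q + i, by omega⟩ : Fin N))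
    (fun a b e => by simpa [Fin.ext_iff] using e) (fun a b e => by simpa [Fin.ext_iff] using e)
    (fun i k hk => hL _ _ (by
      by_contra hc
      exact hk ⟨⟨k, by have := i.2; rw [Fin.lt_def] at hc; simp at hc; omega⟩, rfl⟩))
    (fun i k hk => hR _ _ (by
      by_contra hc
      rw [Fin.lt_def] at hc
      simp only [not_lt] at hc
      exact hk ⟨⟨k - (N - q), by omega⟩, Fin.ext (by simp; omega)⟩))).det
  rw [headTrace, tailTrace, ← sum_castLE q hq fun i => L i i, ← sum_natAdd q hq fun i => R i i]
  exact h1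

/-- Now the first `q` columns have to be preserved, which requires an upper triangular right gauge.
-/
theorem Varies.upperLeftMinor {M L R : Matrix (Fin N) (Fin N) K} (h : Varies φ M L R)
    (hL : IsLower L) (hR : IsLower Rᵀ) (q : ℕ) (hq : q ≤ N) :
    HasLogDeriv φ (upperLeftMinor M q hq) (headTrace q L + headTrace q R) := by
  have hlt : ∀ (i : Fin q) (k : Fin N), k ∉ Set.range (fun i : Fin q => (⟨i, by omega⟩ : Fin N)) →
      (⟨i, by omega⟩ : Fin N) < k := by
    intro i k hk
    by_contra hc
    exact hk ⟨⟨k, by have := i.2; rw [Fin.lt_def] at hc; simp at hc; omega⟩, rfl⟩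
  have h1 := (h.submatrix (f := fun i : Fin q => (⟨i, by omega⟩ : Fin N))
    (g := fun i : Fin q => (⟨i, by omega⟩ : Fin N))
    (fun a b e => by simpa [Fin.ext_iff] using e) (fun a b e => by simpa [Fin.ext_iff] using e)
    (fun i k hk => hL _ _ (hlt i k hk)) (fun i k hk => hR _ _ (hlt i k hk))).det
  rw [headTrace, headTrace, ← sum_castLE q hq fun i => L i i, ← sum_castLE q hq fun i => R i i]
  exact h1

theorem headTrace_add (q : ℕ) (L M : Matrix (Fin N) (Fin N) K) :
    headTrace q (L + M) = headTrace q L + headTrace q M := by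
  simp only [headTrace, ← Finset.sum_add_distrib, Matrix.add_apply]
  exact Finset.sum_congr rfl fun i _ => by split_ifs <;> simp

theorem tailTrace_add (q : ℕ) (L M : Matrix (Fin N) (Fin N) K) :
    tailTrace q (L + M) = tailTrace q L + tailTrace q M := by
  simp only [tailTrace, ← Finset.sum_add_distrib, Matrix.add_apply]
  exact Finset.sum_congr rfl fun i _ => by split_ifs <;> simp

theorem headTrace_neg (q : ℕ) (L : Matrix (Fin N) (Fin N) K) :
    headTrace q (-L) = -headTrace q L := by
  simp only [headTrace, ← Finset.sum_neg_distrib, Matrix.neg_apply]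
  exact Finset.sum_congr rfl fun i _ => by split_ifs <;> simp

theorem tailTrace_transpose (q : ℕ) (L : Matrix (Fin N) (Fin N) K) :
    tailTrace q Lᵀ = tailTrace q L := rfl

theorem headTrace_zero (q : ℕ) : headTrace q (0 : Matrix (Fin N) (Fin N) K) = 0 := by
  simp [headTrace]

theorem tailTrace_zero (q : ℕ) : tailTrace q (0 : Matrix (Fin N) (Fin N) K) = 0 := by
  simp [tailTrace]

theorem headTrace_colMat (q : ℕ) (r : Fin N) (f : Fin N → K) :
    headTrace q (colMat r f) = if (r : ℕ) < q then f r else 0 := by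
  rw [headTrace, Finset.sum_eq_single r]
  · simp [colMat]
  · intro b _ hb; simp [colMat, hb]
  · simp

theorem tailTrace_colMat (q : ℕ) (r : Fin N) (f : Fin N → K) :
    tailTrace q (colMat r f) = if N - q ≤ (r : ℕ) then f r else 0 := by
  rw [tailTrace, Finset.sum_eq_single r]
  · simp [colMat]
  · intro b _ hb; simp [colMat, hb]
  · simp

theorem trace_eq_headTrace (L : Matrix (Fin N) (Fin N) K) : L.trace = headTrace N L := by
  simp [headTrace, Matrix.trace]

theorem IsLower.zero : IsLower (0 : Matrix (Fin N) (Fin N) K) := fun _ _ _ => rfl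

theorem IsLower.add {L M : Matrix (Fin N) (Fin N) K} (hL : IsLower L) (hM : IsLower M) :
    IsLower (L + M) := fun i k h => by rw [Matrix.add_apply, hL i k h, hM i k h, add_zero]

theorem IsLower.neg {L : Matrix (Fin N) (Fin N) K} (hL : IsLower L) :
    IsLower (-L) := fun i k h => by rw [Matrix.neg_apply, hL i k h, neg_zero]

theorem isLower_colMat {r : Fin N} {f : Fin N → K} (h : ∀ i < r, f i = 0) :
    IsLower (colMat r f) := by
  intro i k hik
  by_cases hk : k = r
  · subst hk; simp [colMat, h i hik]
  · simp [colMat, hk]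

theorem isLower_colMat_transpose {r : Fin N} {f : Fin N → K} (h : ∀ i, r < i → f i = 0) :
    IsLower (colMat r f)ᵀ := by
  intro i k hik
  by_cases hi : i = r
  · subst hi; simp [colMat, h k hik]
  · simp [colMat, hi]

theorem Varies.mul_prod_ofFn (E : ℕ → Matrix (Fin N) (Fin N) K) (m : ℕ)
    (F : Fin m → Matrix (Fin N) (Fin N) K) {M L : Matrix (Fin N) (Fin N) K}
    (h : Varies φ M L (E 0)) (hF : ∀ k : Fin m, Varies φ (F k) (-E k) (E (k + 1))) :
    Varies φ (M * (List.ofFn F).prod) L (E m) := by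
  induction m with
  | zero => simpa using h
  | succ m ih =>
    rw [List.ofFn_succ', List.concat_eq_append, List.prod_append, List.prod_singleton,
      ← mul_assoc]
    exact (ih (fun k => F k.castSucc) fun k => hF k.castSucc).mul (hF (Fin.last m))

end Minors

/-! ### Sums supported at one position of the chain -/

section Cancellation

theorem sum_fin_ite_eq {K : Type*} [AddCommMonoid K] (j m : ℕ) (s : Finset (Fin j))
    (P : ℕ → Prop) [DecidablePred P] (hs : ∀ n : Fin j, n ∈ s ↔ P n) (c : K) :
    ∑ n ∈ s, (if (n : ℕ) = m then c else 0) = if m < j ∧ P m then c else 0 := by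
  by_cases h : m < j ∧ P m
  · rw [if_pos h, Finset.sum_eq_single ⟨m, h.1⟩]
    · simp
    · intro b _ hb
      exact if_neg fun e => hb (Fin.ext e)
    · intro hm
      exact absurd ((hs ⟨m, h.1⟩).2 h.2) hm
  · rw [if_neg h]
    refine Finset.sum_eq_zero fun n hn => if_neg ?_
    rintro rfl
    exact h ⟨n.2, (hs n).1 hn⟩

end Cancellation

/-! ### Logarithmic derivatives of the minors of `S` and `C` -/

section XCasimirs

variable {N j : ℕ}

/-- The determinant polynomial takes the value `1` at identity matrices. -/
theorem det_genericChain_ne_zero (s : Slot j) : (genericChain N j s).det ≠ 0 := by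
  let P : Matrix (Fin N) (Fin N) (PolyFun N j) := Matrix.of fun i k => MvPolynomial.X (s, i, k)
  have h1 : (genericChain N j s).det = algebraMap (PolyFun N j) (RatFun N j) P.det := by
    rw [RingHom.map_det]; rfl
  rw [h1, Ne, FaithfulSMul.algebraMap_eq_zero_iff]
  intro h2
  have h3 := congrArg (MvPolynomial.eval fun u : Coord N j => if u.2.1 = u.2.2 then (1 : ℂ) else 0) h2
  rw [RingHom.map_det, map_zero] at h3
  have h4 : (MvPolynomial.eval fun u : Coord N j => if u.2.1 = u.2.2 then (1 : ℂ) else 0).mapMatrix P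
      = 1 := by
    ext i k
    simp [P, Matrix.one_apply]
  rw [h4, Matrix.det_one] at h3
  exact one_ne_zero h3

/-- The alternation of inverses and transposes in `S` is what makes the links match: the inverse
turns `(Q (n + 1), (Q n)ᵀ)` into `(-(Q n)ᵀ, -Q (n + 1))`, the transpose turns it into `(Q n, (Q (n +
1))ᵀ)`. Only the two outer gauges survive. -/
theorem varies_matS {v : Coord N j} {Q : ℕ → Matrix (Fin N) (Fin N) (RatFun N j)}
    {M : Matrix (Fin N) (Fin N) (RatFun N j)} (hA : Varies (hamJet v) (matA N j) (Q 0) M)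
    (hB : ∀ n : Fin j, Varies (hamJet v) (matB N j n) (Q (n + 1)) (Q n)ᵀ) :
    Varies (hamJet v) (matS N j) Mᵀ (if Even j then (Q j)ᵀ else -Q j) := by
  refine Varies.mul_prod_ofFn (fun k => if Even k then (Q k)ᵀ else -Q k) j _ ?_ ?_
  · simpa using hA.transpose
  · intro k
    by_cases hk : Even (k : ℕ)
    · have : Varies (hamJet v) (matB N j k)⁻¹ _ _ := (hB k).inv (det_genericChain_ne_zero _).isUnit
      simpa [hk, Nat.even_add_one] using this
    · have := (hB k).transpose
      simpa [hk, Nat.even_add_one] using this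

/-- `y` if `r` is one of the first `q` indices. -/
def headPart {K : Type*} [Zero K] (y : K) (q : ℕ) (r : Fin N) : K := if (r : ℕ) < q then y else 0

/-- `y` if `r` is one of the last `q` indices. -/
def tailPart {K : Type*} [Zero K] (y : K) (q : ℕ) (r : Fin N) : K :=
  if N - q ≤ (r : ℕ) then y else 0

theorem tailPart_eq {K : Type*} [AddCommGroup K] (y : K) {q : ℕ} (r : Fin N) :
    tailPart y q r = y - headPart y (N - q) r := by
  unfold headPart tailPart
  split_ifs <;> first | omega | simp

theorem headPart_neg {K : Type*} [AddCommGroup K] (y : K) (q : ℕ) (r : Fin N) :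
    (if (r : ℕ) < q then -y else 0) = -headPart y q r := by
  unfold headPart; split_ifs <;> simp

theorem tailPart_neg {K : Type*} [AddCommGroup K] (y : K) (q : ℕ) (r : Fin N) :
    (if N - q ≤ (r : ℕ) then -y else 0) = -tailPart y q r := by
  unfold tailPart; split_ifs <;> simp

section Head

variable (r b : Fin N)

local notation "jetA" => hamJet ((none, r, b) : Coord N j)
local notation "yA" => genericChain N j none r b

theorem headTrace_headConn_zero (y : Matrix (Fin N) (Fin N) (RatFun N j)) (q : ℕ) :
    headTrace q (headConn y r b 0) = -headPart (y r b) q r - headPart (y r b) q b := by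
  rw [headConn_zero, headTrace_add, headTrace_colMat, headTrace_colMat, rho_self, rho_self,
    one_mul, headPart_neg, headPart_neg, sub_eq_add_neg]

theorem tailTrace_headConn_zero (y : Matrix (Fin N) (Fin N) (RatFun N j)) (q : ℕ) :
    tailTrace q (headConn y r b 0) = -tailPart (y r b) q r - tailPart (y r b) q b := by
  rw [headConn_zero, tailTrace_add, tailTrace_colMat, tailTrace_colMat, rho_self, rho_self,
    one_mul, tailPart_neg, tailPart_neg, sub_eq_add_neg]

theorem isLower_headConn_transpose (y : Matrix (Fin N) (Fin N) (RatFun N j)) (m : ℕ) :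
    IsLower (headConn y r b m)ᵀ := by
  by_cases h : m = 0
  · subst h
    rw [headConn_zero, Matrix.transpose_add]
    exact (isLower_colMat_transpose fun i hi => by rw [rho_of_gt hi, zero_mul, neg_zero]).add
      (isLower_colMat_transpose fun i hi => by rw [rho_of_gt hi, zero_mul, neg_zero])
  · rw [headConn_of_ne _ h]
    exact IsLower.zero

theorem logDeriv_matC_head (n : Fin j) (q : ℕ) (hq : q ≤ N) :
    HasLogDeriv jetA (upperRightMinor (matC N j n) q hq)
      (if (n : ℕ) = 0 then -tailPart yA q r - tailPart yA q b else 0) := by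
  have h : Varies jetA (matC N j n) _ _ :=
    varies_hamJet (chainBracket_slice_none (genericChain N j) n true r b)
  rw [headConn_of_ne _ (Nat.succ_ne_zero _)] at h
  have h1 := h.upperRightMinor IsLower.zero (isLower_headConn_transpose r b _ _) q hq
  rw [headTrace_zero, zero_add, tailTrace_transpose] at h1
  by_cases hn : (n : ℕ) = 0
  · rwa [if_pos hn, ← tailTrace_headConn_zero, ← hn]
  · rw [if_neg hn]
    rwa [headConn_of_ne _ hn, tailTrace_zero] at h1

theorem logDeriv_det_head (n : Fin j) (d : Bool) :
    HasLogDeriv jetA (genericChain N j (some (n, d))).det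
      (if (n : ℕ) = 0 then -(2 * yA) else 0) := by
  have h := (varies_hamJet (v := (none, r, b))
    (chainBracket_slice_none (genericChain N j) n d r b)).det
  rw [headConn_of_ne _ (Nat.succ_ne_zero _), Matrix.trace_zero, zero_add, Matrix.trace_transpose,
    trace_eq_headTrace] at h
  by_cases hn : (n : ℕ) = 0
  · rw [hn, headTrace_headConn_zero] at h
    rw [if_pos hn]
    convert h using 1
    simp [headPart]
    ring
  · rw [if_neg hn]
    rwa [headConn_of_ne _ hn, headTrace_zero] at h

theorem logDeriv_det_matA_head : HasLogDeriv jetA (matA N j).det 0 := by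
  have h := (varies_hamJet (v := (none, r, b))
    (chainBracket_none_none_slice' (genericChain N j) r b)).det
  rw [Matrix.trace_transpose, trace_eq_headTrace, headTrace_add, headTrace_colMat,
    headTrace_colMat, rho_self, rho_self, one_mul, if_pos r.2, if_pos b.2, add_neg_cancel,
    add_zero] at h
  exact h

theorem varies_matS_head : Varies jetA (matS N j)
    (colMat r (fun i => rho _ i r * genericChain N j none i b) +
      colMat b fun i => rho _ i b * genericChain N j none r i)
    (if Even j then (headConn (genericChain N j none) r b j)ᵀ
      else -headConn (genericChain N j none) r b j) := by
  have hA : Varies jetA (matA N j) _ _ :=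
    varies_hamJet (chainBracket_none_none_slice (genericChain N j) r b)
  have := varies_matS hA fun n => varies_hamJet (v := (none, r, b))
    (chainBracket_slice_none (genericChain N j) n false r b)
  rwa [Matrix.transpose_transpose] at this

theorem isLower_matS_head : IsLower (colMat r (fun i => rho _ i r * genericChain N j none i b) +
      colMat b fun i => rho _ i b * genericChain N j none r i) :=
  (isLower_colMat fun i hi => by rw [rho_of_gt hi, zero_mul]).add
    (isLower_colMat fun i hi => by rw [rho_of_gt hi, zero_mul])

theorem headTrace_matS_head (q : ℕ) :
    headTrace q (colMat r (fun i => rho _ i r * genericChain N j none i b) +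
      colMat b fun i => rho _ i b * genericChain N j none r i) =
      headPart yA q r + headPart yA q b := by
  rw [headTrace_add, headTrace_colMat, headTrace_colMat, rho_self, rho_self, one_mul]
  rfl

/-- For `j = 0` the matrix `S` is just `𝔸ᵀ`, whose right gauge is the link `0` itself; this accounts
for the extra term. -/
theorem logDeriv_matS_head_even (hj : Even j) (q : ℕ) (hq : q ≤ N) :
    HasLogDeriv jetA (upperRightMinor (matS N j) q hq) (headPart yA q r + headPart yA q b +
      if j = 0 then -tailPart yA q r - tailPart yA q b else 0) := by
  have h := varies_matS_head (j := j) r b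
  rw [if_pos hj] at h
  have h1 := h.upperRightMinor (isLower_matS_head r b) (isLower_headConn_transpose r b _ _) q hq
  rw [headTrace_matS_head, tailTrace_transpose] at h1
  by_cases hn : j = 0
  · subst hn
    rwa [tailTrace_headConn_zero] at h1
  · rw [headConn_of_ne _ hn, tailTrace_zero] at h1
    rwa [if_neg hn]

theorem logDeriv_matS_head_odd (hj : Odd j) (q : ℕ) (hq : q ≤ N) :
    HasLogDeriv jetA (upperLeftMinor (matS N j) q hq) (headPart yA q r + headPart yA q b) := by
  have h := varies_matS_head (j := j) r b
  rw [if_neg (Nat.not_even_iff_odd.2 hj), headConn_of_ne _ hj.pos.ne', neg_zero] at h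
  have h1 := h.upperLeftMinor (isLower_matS_head r b) IsLower.zero q hq
  rwa [headTrace_matS_head, headTrace_zero, add_zero] at h1

end Head

section Pair

variable (k : Fin j) (c : Bool) (r b : Fin N)

local notation "jetP" => hamJet ((some (k, c), r, b) : Coord N j)
local notation "yP" => genericChain N j (some (k, c)) r b

theorem headTrace_pairConn (y : Matrix (Fin N) (Fin N) (RatFun N j)) (q m : ℕ) :
    headTrace q (pairConn y k r b m) = (if m = k then headPart (y r b) q b else 0) -
      if m = k + 1 then headPart (y r b) q r else 0 := by
  by_cases h : m = k
  · rw [pairConn_self _ h, headTrace_colMat, rho_self, one_mul, if_pos h,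
      if_neg (show ¬ m = (k : ℕ) + 1 by omega), sub_zero]
    rfl
  · by_cases h' : m = k + 1
    · rw [pairConn_succ _ h', headTrace_colMat, rho_self, one_mul, if_neg h, if_pos h',
        headPart_neg, zero_sub]
    · rw [pairConn_of_ne _ h h', headTrace_zero, if_neg h, if_neg h', sub_zero]

theorem tailTrace_pairConn (y : Matrix (Fin N) (Fin N) (RatFun N j)) (q m : ℕ) :
    tailTrace q (pairConn y k r b m) = (if m = k then tailPart (y r b) q b else 0) -
      if m = k + 1 then tailPart (y r b) q r else 0 := by
  by_cases h : m = k
  · rw [pairConn_self _ h, tailTrace_colMat, rho_self, one_mul, if_pos h,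
      if_neg (show ¬ m = (k : ℕ) + 1 by omega), sub_zero]
    rfl
  · by_cases h' : m = k + 1
    · rw [pairConn_succ _ h', tailTrace_colMat, rho_self, one_mul, if_neg h, if_pos h',
        tailPart_neg, zero_sub]
    · rw [pairConn_of_ne _ h h', tailTrace_zero, if_neg h, if_neg h', sub_zero]

theorem isLower_pairConn_self (y : Matrix (Fin N) (Fin N) (RatFun N j)) {m : ℕ}
    (hm : m ≠ k + 1) : IsLower (pairConn y k r b m) := by
  by_cases h : m = k
  · rw [pairConn_self _ h]
    exact isLower_colMat fun i hi => by rw [rho_of_gt hi, zero_mul]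
  · rw [pairConn_of_ne _ h hm]
    exact IsLower.zero

theorem isLower_pairConn_transpose (y : Matrix (Fin N) (Fin N) (RatFun N j)) {m : ℕ}
    (hm : m ≠ k) : IsLower (pairConn y k r b m)ᵀ := by
  by_cases h : m = k + 1
  · rw [pairConn_succ _ h]
    exact isLower_colMat_transpose fun i hi => by rw [rho_of_gt hi, zero_mul, neg_zero]
  · rw [pairConn_of_ne _ hm h]
    exact IsLower.zero

theorem logDeriv_matC_pair (n : Fin j) (q : ℕ) (hq : q ≤ N) :
    HasLogDeriv jetP (upperRightMinor (matC N j n) q hq)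
      ((if (n : ℕ) = k then headPart yP q r - tailPart yP q b else 0) +
        (if (n : ℕ) + 1 = k then headPart yP q b else 0) -
        if (n : ℕ) = k + 1 then tailPart yP q r else 0) := by
  by_cases hn : n = k
  · subst hn
    -- At its own position the link form would have gauges of the wrong triangularity, so the other
    -- form of the bracket is used.
    have h : Varies (hamJet ((some (n, c), r, b) : Coord N j)) (matC N j n) _ _ :=
      varies_hamJet (chainBracket_slice_same (genericChain N j) n c true (by simp) r b)
    have h1 := h.upperRightMinor (isLower_colMat fun i hi => by rw [rho_of_gt hi, zero_mul])
      (isLower_colMat_transpose fun i hi => by rw [rho_of_gt hi, zero_mul, neg_zero]) q hq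
    rw [tailTrace_transpose, headTrace_colMat, tailTrace_colMat, rho_self, rho_self, one_mul,
      tailPart_neg, ← sub_eq_add_neg] at h1
    rw [if_pos rfl, if_neg (by omega), if_neg (by omega), add_zero, sub_zero]
    exact h1
  · have hn' : (n : ℕ) ≠ k := fun e => hn (Fin.ext e)
    have h : Varies jetP (matC N j n) _ _ :=
      varies_hamJet (chainBracket_slice (genericChain N j) k n c true (fun e => absurd e hn) r b)
    have h1 := h.upperRightMinor (isLower_pairConn_self k r b _ (by omega))
      (isLower_pairConn_transpose k r b _ hn') q hq
    rw [tailTrace_transpose, headTrace_pairConn, tailTrace_pairConn,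
      if_neg (show ¬ (n : ℕ) + 1 = k + 1 by omega), if_neg hn', sub_zero, zero_sub,
      ← sub_eq_add_neg] at h1
    rwa [if_neg hn', zero_add]

theorem headPart_full (y : RatFun N j) (r : Fin N) : headPart y N r = y := if_pos r.2

theorem logDeriv_det_pair (n : Fin j) (d : Bool) :
    HasLogDeriv jetP (genericChain N j (some (n, d))).det
      ((if (n : ℕ) + 1 = k then yP else 0) - if (n : ℕ) = k + 1 then yP else 0) := by
  by_cases hn : n = k
  · subst hn
    rw [if_neg (by omega), if_neg (by omega), sub_zero]
    by_cases hd : d = true ∨ c = false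
    · have h := (varies_hamJet (v := (some (n, c), r, b))
        (chainBracket_slice_same (genericChain N j) n c d hd r b)).det
      rwa [Matrix.trace_transpose, trace_eq_headTrace, trace_eq_headTrace, headTrace_colMat,
        headTrace_colMat, rho_self, rho_self, one_mul, if_pos r.2, if_pos b.2,
        add_neg_cancel] at h
    · have h := (varies_hamJet (v := (some (n, c), r, b))
        (chainBracket_slice (genericChain N j) n n c d
          (fun _ => Or.inl (by simpa using fun e => hd (Or.inl e))) r b)).det
      rwa [Matrix.trace_transpose, trace_eq_headTrace, trace_eq_headTrace, headTrace_pairConn,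
        headTrace_pairConn, if_neg (by omega), if_pos rfl, if_pos rfl, if_neg (by omega),
        headPart_full, headPart_full, zero_sub, sub_zero, neg_add_cancel] at h
  · have hn' : (n : ℕ) ≠ k := fun e => hn (Fin.ext e)
    have h := (varies_hamJet (v := (some (k, c), r, b))
        (chainBracket_slice (genericChain N j) k n c d (fun e => absurd e hn) r b)).det
    rwa [Matrix.trace_transpose, trace_eq_headTrace, trace_eq_headTrace, headTrace_pairConn,
      headTrace_pairConn, if_neg (show ¬ (n : ℕ) + 1 = k + 1 by omega), if_neg hn', sub_zero,
      zero_sub, ← sub_eq_add_neg, headPart_full, headPart_full] at h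

theorem logDeriv_det_matA_pair :
    HasLogDeriv jetP (matA N j).det (if 0 = (k : ℕ) then 2 * yP else 0) := by
  have h := (varies_hamJet (v := (some (k, c), r, b))
    (chainBracket_none_slice (genericChain N j) k c r b)).det
  rw [Matrix.trace_transpose, trace_eq_headTrace, headTrace_pairConn, headPart_full,
    if_neg (show ¬ 0 = (k : ℕ) + 1 by omega), sub_zero] at h
  have h2 : (if 0 = (k : ℕ) then 2 * yP else 0) =
      (if 0 = (k : ℕ) then yP else 0) + if 0 = (k : ℕ) then yP else 0 := by
    split_ifs
    · ring
    · ring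
  rwa [h2]

/-- `S` contains only `B`'s, for which the link form holds at every position. The non-triangular
inner links cancel, and the outer links `0` and `j` have the triangularity required by the minors,
since `k < j`. -/
theorem varies_matS_pair : Varies jetP (matS N j) (pairConn (genericChain N j (some (k, c))) k r b 0)
    (if Even j then (pairConn (genericChain N j (some (k, c))) k r b j)ᵀ
      else -pairConn (genericChain N j (some (k, c))) k r b j) := by
  have hA : Varies jetP (matA N j) _ _ :=
    varies_hamJet (chainBracket_none_slice (genericChain N j) k c r b)
  have := varies_matS hA fun n => varies_hamJet (v := (some (k, c), r, b))
    (chainBracket_slice (genericChain N j) k n c false (fun _ => Or.inl rfl) r b)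
  rwa [Matrix.transpose_transpose] at this

theorem logDeriv_matS_pair_even (hj : Even j) (q : ℕ) (hq : q ≤ N) :
    HasLogDeriv jetP (upperRightMinor (matS N j) q hq) ((if 0 = (k : ℕ) then headPart yP q b else 0)
      - if j = k + 1 then tailPart yP q r else 0) := by
  have h := varies_matS_pair k c r b
  rw [if_pos hj] at h
  have h1 := h.upperRightMinor (isLower_pairConn_self k r b _ (by omega))
    (isLower_pairConn_transpose k r b _ (by omega)) q hq
  rwa [tailTrace_transpose, headTrace_pairConn, tailTrace_pairConn,
    if_neg (show ¬ 0 = (k : ℕ) + 1 by omega), if_neg (show ¬ j = (k : ℕ) by omega), sub_zero,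
    zero_sub, ← sub_eq_add_neg] at h1

theorem logDeriv_matS_pair_odd (hj : Odd j) (q : ℕ) (hq : q ≤ N) :
    HasLogDeriv jetP (upperLeftMinor (matS N j) q hq) ((if 0 = (k : ℕ) then headPart yP q b else 0)
      + if j = k + 1 then headPart yP q r else 0) := by
  have h := varies_matS_pair k c r b
  rw [if_neg (Nat.not_even_iff_odd.2 hj)] at h
  have h1 := h.upperLeftMinor (isLower_pairConn_self k r b _ (by omega))
    (by rw [Matrix.transpose_neg]; exact (isLower_pairConn_transpose k r b _ (by omega)).neg) q hq
  rwa [headTrace_neg, headTrace_pairConn, headTrace_pairConn,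
    if_neg (show ¬ 0 = (k : ℕ) + 1 by omega), if_neg (show ¬ j = (k : ℕ) by omega), sub_zero,
    zero_sub, neg_neg] at h1

end Pair

end XCasimirs

/-! ### The Casimirs `X` -/

section XCasimirs

variable {N j : ℕ}

theorem sum_fin_ite_succ_eq {K : Type*} [AddCommMonoid K] {j m : ℕ} (hm : m ≤ j)
    (s : Finset (Fin j)) (P : ℕ → Prop) [DecidablePred P] (hs : ∀ n : Fin j, n ∈ s ↔ P n)
    (c : K) :
    ∑ n ∈ s, (if (n : ℕ) + 1 = m then c else 0) = if 0 < m ∧ P (m - 1) then c else 0 := by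
  rcases m with _ | m
  · simp
  · have := sum_fin_ite_eq j m s P hs c
    simpa [show m < j by omega] using this

theorem sum_pair_logDeriv {K : Type*} [AddCommGroup K] (k : Fin j) (s : Finset (Fin j))
    (P : ℕ → Prop) [DecidablePred P] (hs : ∀ n : Fin j, n ∈ s ↔ P n) (a b c : K) :
    ∑ n ∈ s, ((if (n : ℕ) = k then a else 0) + (if (n : ℕ) + 1 = k then b else 0) -
        if (n : ℕ) = k + 1 then c else 0) =
      (if P k then a else 0) + (if 0 < (k : ℕ) ∧ P (k - 1) then b else 0) -
        if (k : ℕ) + 1 < j ∧ P (k + 1) then c else 0 := by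
  rw [Finset.sum_sub_distrib, Finset.sum_add_distrib, sum_fin_ite_eq _ _ _ _ hs,
    sum_fin_ite_eq _ _ _ _ hs, sum_fin_ite_succ_eq k.2.le _ _ hs]
  simp

theorem HasLogDeriv.of_eq {K : Type*} [CommRing K] {φ : K →+* DualNumber K} {f δ η : K}
    (h : HasLogDeriv φ f δ) (e : δ = η) : HasLogDeriv φ f η := e ▸ h

/-- Neighbouring factors complete each other, so the result depends only on the row and the column
of the varied entry and not on its position in the chain; the four cases in the pair part say which
neighbours are absent at the ends. -/
theorem logDeriv_even (hj : Even j) (v : Coord N j) (q : ℕ) (hq : q ≤ N) :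
    HasLogDeriv (hamJet v)
      (upperRightMinor (matS N j) q hq * ∏ k : Fin j, upperRightMinor (matC N j k) q hq)
      (headPart (genericChain N j v.1 v.2.1 v.2.2) q v.2.1 -
          tailPart (genericChain N j v.1 v.2.1 v.2.2) q v.2.1 +
        (headPart (genericChain N j v.1 v.2.1 v.2.2) q v.2.2 -
          tailPart (genericChain N j v.1 v.2.1 v.2.2) q v.2.2)) := by
  obtain ⟨_ | ⟨k, c⟩, r, b⟩ := v
  · have h := (logDeriv_matS_head_even r b hj q hq).mul
      (HasLogDeriv.prod (s := Finset.univ) fun n _ => logDeriv_matC_head (j := j) r b n q hq)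
    rw [sum_fin_ite_eq j 0 Finset.univ (fun _ => True) (by simp)] at h
    convert h using 1
    by_cases h0 : j = 0
    · rw [if_pos h0, if_neg (by omega)]; ring
    · rw [if_neg h0, if_pos ⟨by omega, trivial⟩]; ring
  · have h := (logDeriv_matS_pair_even k c r b hj q hq).mul
      (HasLogDeriv.prod (s := Finset.univ) fun n _ => logDeriv_matC_pair k c r b n q hq)
    rw [sum_pair_logDeriv k Finset.univ (fun _ => True) (by simp)] at h
    convert h using 1
    simp only [and_true, if_true]
    by_cases h0 : 0 = (k : ℕ) <;> by_cases h1 : j = (k : ℕ) + 1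
    · rw [if_pos h0, if_pos h1, if_neg (by omega), if_neg (by omega)]; ring
    · rw [if_pos h0, if_neg h1, if_neg (by omega), if_pos (by omega)]; ring
    · rw [if_neg h0, if_pos h1, if_pos (by omega), if_neg (by omega)]; ring
    · rw [if_neg h0, if_neg h1, if_pos (by omega), if_pos (by omega)]; ring

/-- As the last `q` indices are the complement of the first `N - q`, the difference of head and tail
parts is unchanged under `q ↦ N - q`, so numerator and denominator have equal logarithmic
derivatives. -/
theorem isCasimir_casimirXEven (hj : Even j) (p : ℕ) (hp : p ≤ N) :
    IsCasimir (casimirXEven N j p hp) := by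
  refine isCasimir_of_hasLogDeriv fun v => ?_
  have h := (logDeriv_even hj v p hp).div (logDeriv_even hj v (N - p) (N.sub_le p))
  refine h.of_eq ?_
  rw [tailPart_eq, tailPart_eq, tailPart_eq, tailPart_eq, Nat.sub_sub_self hp]
  ring

theorem mem_evenPairs (n : Fin j) : n ∈ evenPairs j ↔ Odd (n : ℕ) := by simp [evenPairs]

theorem mem_oddPairs (n : Fin j) : n ∈ oddPairs j ↔ Even (n : ℕ) := by simp [oddPairs]

theorem headPart_add_tailPart {y : RatFun N j} {q : ℕ} (hq : q ≤ N) (r : Fin N) :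
    headPart y q r + tailPart y (N - q) r = y := by
  rw [tailPart_eq, Nat.sub_sub_self hq]; ring

/-- Reduces the Casimir property to one linear identity; the two determinants of a pair share `δ`,
whence the factors `2`. -/
theorem logDeriv_odd {φ : RatFun N j →+* DualNumber (RatFun N j)} {p : ℕ} (hp : p ≤ N)
    {σ : ℕ → RatFun N j} {γ : ℕ → Fin j → RatFun N j} {δ : Fin j → RatFun N j} {α : RatFun N j}
    (hS : ∀ q (hq : q ≤ N), HasLogDeriv φ (upperLeftMinor (matS N j) q hq) (σ q))
    (hC : ∀ q (hq : q ≤ N) n, HasLogDeriv φ (upperRightMinor (matC N j n) q hq) (γ q n))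
    (hdet : ∀ n d, HasLogDeriv φ (genericChain N j (some (n, d))).det (δ n))
    (hA : HasLogDeriv φ (matA N j).det α)
    (h : σ p + σ (N - p) + (∑ n ∈ evenPairs j, γ p n + ∑ n ∈ evenPairs j, γ (N - p) n) -
        (∑ n ∈ oddPairs j, γ p n + ∑ n ∈ oddPairs j, γ (N - p) n) +
        (2 * ∑ n ∈ oddPairs j, δ n - (α + 2 * ∑ n ∈ evenPairs j, δ n)) = 0) :
    HasLogDeriv φ (casimirXOdd N j p hp) 0 := by
  have hp' := N.sub_le p
  have hcc : ∀ n, HasLogDeriv φ (upperRightMinor (matC N j n) p hp *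
      upperRightMinor (matC N j n) (N - p) hp') (γ p n + γ (N - p) n) :=
    fun n => (hC p hp n).mul (hC _ hp' n)
  have hdd : ∀ n, HasLogDeriv φ ((matB N j n).det * (matC N j n).det) (δ n + δ n) :=
    fun n => (hdet n false).mul (hdet n true)
  have := ((((hS p hp).mul (hS _ hp')).mul (HasLogDeriv.prod (s := evenPairs j)
    fun n _ => hcc n)).div (HasLogDeriv.prod (s := oddPairs j) fun n _ => hcc n)).mul
    ((HasLogDeriv.prod (s := oddPairs j) fun n _ => hdd n).div
      (hA.mul (HasLogDeriv.prod (s := evenPairs j) fun n _ => hdd n)))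
  refine this.of_eq ?_
  rw [← h]
  simp only [Finset.sum_add_distrib]
  ring

/-- Multiplying the minors of sizes `p` and `N - p` lets each head part meet its complementary tail
part, leaving multiples of the full entry that no longer depend on `p`. The determinant factor is
there to compensate exactly these. -/
theorem isCasimir_casimirXOdd (hj : Odd j) (p : ℕ) (hp : p ≤ N) :
    IsCasimir (casimirXOdd N j p hp) := by
  refine isCasimir_of_hasLogDeriv fun v => ?_
  have hp' := N.sub_le p
  obtain ⟨_ | ⟨k, c⟩, r, b⟩ := v
  · refine logDeriv_odd hp (fun q hq => logDeriv_matS_head_odd r b hj q hq)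
      (fun q hq n => logDeriv_matC_head r b n q hq) (fun n d => logDeriv_det_head r b n d)
      (logDeriv_det_matA_head r b) ?_
    simp only [sum_fin_ite_eq _ _ _ _ mem_evenPairs, sum_fin_ite_eq _ _ _ _ mem_oddPairs]
    have h0 : ¬ (0 < j ∧ Odd 0) := by simp
    have h1 : 0 < j ∧ Even 0 := ⟨hj.pos, by simp⟩
    simp only [if_neg h0, if_pos h1]
    have e1 := headPart_add_tailPart (y := genericChain N j none r b) hp r
    have e2 := headPart_add_tailPart (y := genericChain N j none r b) hp b
    have e3 := headPart_add_tailPart (y := genericChain N j none r b) hp' r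
    have e4 := headPart_add_tailPart (y := genericChain N j none r b) hp' b
    rw [Nat.sub_sub_self hp] at e3 e4
    linear_combination e1 + e2 + e3 + e4
  · refine logDeriv_odd hp (fun q hq => logDeriv_matS_pair_odd k c r b hj q hq)
      (fun q hq n => logDeriv_matC_pair k c r b n q hq) (fun n d => logDeriv_det_pair k c r b n d)
      (logDeriv_det_matA_pair k c r b) ?_
    -- A vanishing diagonal term is inserted to bring the sum into the shape of `sum_pair_logDeriv`.
    have hd : ∀ s : Finset (Fin j), ∀ y : RatFun N j,
        ∑ n ∈ s, ((if (n : ℕ) + 1 = k then y else 0) - if (n : ℕ) = k + 1 then y else 0) =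
        ∑ n ∈ s, ((if (n : ℕ) = k then 0 else 0) + (if (n : ℕ) + 1 = k then y else 0) -
          if (n : ℕ) = k + 1 then y else 0) := by
      intro s y
      simp
    simp only [hd, sum_pair_logDeriv k _ _ mem_evenPairs, sum_pair_logDeriv k _ _ mem_oddPairs]
    have e1 := headPart_add_tailPart (y := genericChain N j (some (k, c)) r b) hp r
    have e2 := headPart_add_tailPart (y := genericChain N j (some (k, c)) r b) hp b
    have e3 := headPart_add_tailPart (y := genericChain N j (some (k, c)) r b) hp' r
    have e4 := headPart_add_tailPart (y := genericChain N j (some (k, c)) r b) hp' b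
    rw [Nat.sub_sub_self hp] at e3 e4
    rw [Nat.odd_iff] at hj
    simp only [Nat.odd_iff, Nat.even_iff]
    -- As `j` is odd, a pair with odd index `k` has neighbours on both sides; only even `k` can sit
    -- at an end of the chain.
    rcases Nat.mod_two_eq_zero_or_one (k : ℕ) with hk | hk
    · have c2 : ¬ (k : ℕ) % 2 = 1 := by omega
      have c3 : ¬ (0 < (k : ℕ) ∧ ((k : ℕ) - 1) % 2 = 0) := by omega
      have c4 : ¬ ((k : ℕ) + 1 < j ∧ ((k : ℕ) + 1) % 2 = 0) := by omega
      by_cases h0 : 0 = (k : ℕ) <;> by_cases h1 : j = (k : ℕ) + 1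
      · have c5 : ¬ (0 < (k : ℕ) ∧ ((k : ℕ) - 1) % 2 = 1) := by omega
        have c6 : ¬ ((k : ℕ) + 1 < j ∧ ((k : ℕ) + 1) % 2 = 1) := by omega
        simp only [if_pos hk, if_neg c2, if_neg c3, if_neg c4, if_neg c5, if_neg c6, if_pos h0,
          if_pos h1]
        linear_combination e2 + e4
      · have c5 : ¬ (0 < (k : ℕ) ∧ ((k : ℕ) - 1) % 2 = 1) := by omega
        have c6 : (k : ℕ) + 1 < j ∧ ((k : ℕ) + 1) % 2 = 1 := by omega
        simp only [if_pos hk, if_neg c2, if_neg c3, if_neg c4, if_neg c5, if_pos c6, if_pos h0,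
          if_neg h1]
        linear_combination e2 + e4 - e1 - e3
      · have c5 : 0 < (k : ℕ) ∧ ((k : ℕ) - 1) % 2 = 1 := by omega
        have c6 : ¬ ((k : ℕ) + 1 < j ∧ ((k : ℕ) + 1) % 2 = 1) := by omega
        simp only [if_pos hk, if_neg c2, if_neg c3, if_neg c4, if_pos c5, if_neg c6, if_neg h0,
          if_pos h1]
        linear_combination e2 + e4
      · have c5 : 0 < (k : ℕ) ∧ ((k : ℕ) - 1) % 2 = 1 := by omega
        have c6 : (k : ℕ) + 1 < j ∧ ((k : ℕ) + 1) % 2 = 1 := by omega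
        simp only [if_pos hk, if_neg c2, if_neg c3, if_neg c4, if_pos c5, if_pos c6, if_neg h0,
          if_neg h1]
        linear_combination e2 + e4 - e1 - e3
    · have c2 : ¬ (k : ℕ) % 2 = 0 := by omega
      have c3 : ¬ (0 < (k : ℕ) ∧ ((k : ℕ) - 1) % 2 = 1) := by omega
      have c4 : ¬ ((k : ℕ) + 1 < j ∧ ((k : ℕ) + 1) % 2 = 1) := by omega
      have c5 : 0 < (k : ℕ) ∧ ((k : ℕ) - 1) % 2 = 0 := by omega
      have c6 : (k : ℕ) + 1 < j ∧ ((k : ℕ) + 1) % 2 = 0 := by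
        have := k.2
        omega
      have h0 : ¬ 0 = (k : ℕ) := by omega
      have h1 : ¬ j = (k : ℕ) + 1 := by omega
      simp only [if_pos hk, if_neg c2, if_neg c3, if_neg c4, if_pos c5, if_pos c6, if_neg h0,
          if_neg h1]
      linear_combination e1 + e3 - e2 - e4

end XCasimirs

/-! ### The defining expansions of `Y` and `Z` -/

section Expansions

variable {N : ℕ} {K : Type*} [CommRing K]

theorem sum_range_odd_fold {M : Type*} [AddCommMonoid M] (n : ℕ) (f : ℕ → M) :
    ∑ m ∈ Finset.range (2 * n + 2), f m = ∑ m ∈ Finset.range (n + 1), (f m + f (2 * n + 1 - m)) := by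
  rw [show 2 * n + 2 = (n + 1) + (n + 1) by ring, Finset.sum_range_add, Finset.sum_add_distrib,
    ← Finset.sum_range_reflect (fun x => f (n + 1 + x))]
  congr 1
  refine Finset.sum_congr rfl fun m hm => ?_
  rw [Finset.mem_range] at hm
  congr 1
  omega

theorem sum_range_even_fold {M : Type*} [AddCommMonoid M] (n : ℕ) (f : ℕ → M) :
    ∑ m ∈ Finset.range (2 * n + 1), f m =
      ∑ m ∈ Finset.range n, (f m + f (2 * n - m)) + f n := by
  rw [show 2 * n + 1 = (n + 1) + n by ring, Finset.sum_range_add, Finset.sum_add_distrib,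
    ← Finset.sum_range_reflect (fun x => f (n + 1 + x)), Finset.sum_range_succ, add_right_comm]
  congr 2
  refine Finset.sum_congr rfl fun m hm => ?_
  rw [Finset.mem_range] at hm
  congr 1
  omega

theorem natDegree_pencilDet_le (A B : Matrix (Fin N) (Fin N) K) :
    (pencilDet A B).natDegree ≤ N := by
  exact (Polynomial.natDegree_det_X_add_C_le A B).trans (by simp)

theorem coeff_zero_pencilDet (A B : Matrix (Fin N) (Fin N) K) :
    (pencilDet A B).coeff 0 = B.det := by
  exact Polynomial.coeff_det_X_add_C_zero A B

theorem coeff_card_pencilDet (A B : Matrix (Fin N) (Fin N) K) :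
    (pencilDet A B).coeff N = A.det := by
  have := Polynomial.coeff_det_X_add_C_card A B
  rwa [Fintype.card_fin] at this

-- Extracting `λ⁻¹` from every row gives `det (λ A + λ⁻¹ B) = λ^{-N} det (λ² A + B)`.
open LaurentPolynomial in
theorem laurent_pencilDet (A B : Matrix (Fin N) (Fin N) K) :
    ((T 1 : LaurentPolynomial K) • A.map C + (T (-1) : LaurentPolynomial K) • B.map C).det =
      ∑ m ∈ Finset.range (N + 1), C ((pencilDet A B).coeff m) * T (2 * (m : ℤ) - N) := by
  have h1 : (T 1 : LaurentPolynomial K) • A.map C + (T (-1) : LaurentPolynomial K) • B.map C =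
      (T (-1) : LaurentPolynomial K) • ((T 2 : LaurentPolynomial K) • A.map C + B.map C) := by
    rw [smul_add, smul_smul, ← T_add]
    norm_num
  have h2 : ((T 2 : LaurentPolynomial K) • A.map C + B.map C).det =
      Polynomial.eval₂ C (T 2) (pencilDet A B) := by
    rw [pencilDet, ← Polynomial.coe_eval₂RingHom, RingHom.map_det]
    congr 1
    ext i k : 1
    simp
  rw [h1, Matrix.det_smul, h2, Fintype.card_fin,
    Polynomial.eval₂_eq_sum_range' C (Nat.lt_succ_of_le (natDegree_pencilDet_le A B)),
    Finset.mul_sum]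
  refine Finset.sum_congr rfl fun m _ => ?_
  rw [T_pow, T_pow, mul_left_comm, ← T_add]
  congr 2
  ring

open LaurentPolynomial in
theorem coeff_laurent_sum (c : ℕ → K) (a : ℕ → ℤ) (s : Finset ℕ)
    (ha : Set.InjOn a s) {p : ℕ} (hp : p ∈ s) :
    (∑ m ∈ s, C (c m) * T (a m) : LaurentPolynomial K).coeff (a p) = c p := by
  classical
  simp only [← single_eq_C_mul_T, AddMonoidAlgebra.coeff_sum, AddMonoidAlgebra.coeff_single,
    Finsupp.coe_finsetSum, Finset.sum_apply, Finsupp.single_apply]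
  rw [Finset.sum_eq_single p]
  · simp
  · intro b hb hbp
    exact if_neg fun e => hbp (ha hb hp e)
  · exact fun h => absurd hp h

-- Transposing the matrix `λ A + λ⁻¹ Aᵀ` exchanges `λ` and `λ⁻¹` without changing the determinant.
open LaurentPolynomial in
theorem coeff_pencilDet_transpose (A : Matrix (Fin N) (Fin N) K) {p : ℕ} (hp : p ≤ N) :
    (pencilDet A Aᵀ).coeff (N - p) = (pencilDet A Aᵀ).coeff p := by
  have h1 := laurent_pencilDet A Aᵀ
  have h2 : invert ((T 1 : LaurentPolynomial K) • A.map C +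
      (T (-1) : LaurentPolynomial K) • Aᵀ.map C).det =
      ((T 1 : LaurentPolynomial K) • A.map C + (T (-1) : LaurentPolynomial K) • Aᵀ.map C).det := by
    rw [AlgEquiv.map_det, ← Matrix.det_transpose]
    congr 1
    ext i k : 1
    simp [add_comm]
  have h3 := congrArg (fun f => f.coeff (2 * (p : ℤ) - N)) h2
  simp only [h1, map_sum, map_mul, invert_C, invert_T] at h3
  rw [coeff_laurent_sum _ (fun m : ℕ => 2 * (m : ℤ) - N) _ (fun a _ b _ h => by simp at h; omega)
    (by simp; omega)] at h3
  rw [← h3, show 2 * (p : ℤ) - N = (fun m : ℕ => -(2 * (m : ℤ) - N)) (N - p) by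
    simp [Nat.cast_sub hp]; ring]
  exact (coeff_laurent_sum _ (fun m : ℕ => -(2 * (m : ℤ) - N)) _
    (fun a _ b _ h => by simp at h; omega) (by simp)).symm

variable {j : ℕ}

theorem isZExpansion_casimirZ : IsZExpansion N j (casimirZ N j) := by
  intro k
  have h0 : (matB N j k).det ≠ 0 := det_genericChain_ne_zero _
  have h1 : ((matB N j k).map Polynomial.C +
      (Polynomial.X : Polynomial (RatFun N j)) • (matC N j k).map Polynomial.C).det =
      pencilDet (matC N j k) (matB N j k) := by rw [add_comm]; rfl
  rw [h1, Polynomial.as_sum_range_C_mul_X_pow' _ (Nat.lt_succ_of_le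
    (natDegree_pencilDet_le (matC N j k) (matB N j k))), Finset.sum_range_succ',
    coeff_zero_pencilDet, mul_add, pow_zero, mul_one, ← Polynomial.C_mul, inv_mul_cancel₀ h0,
    Polynomial.C_1, add_comm, Finset.mul_sum, Finset.sum_range]
  congr 1
  refine Finset.sum_congr rfl fun p _ => ?_
  rw [casimirZ, div_eq_inv_mul, Polynomial.C_mul]
  ring

-- Pairing the terms `m` and `N - m` produces the required sums of two powers. For even `N` the
-- middle term has no partner while the expansion counts it twice, which explains the factor `2⁻¹`
-- in `casimirY`.
open LaurentPolynomial in
theorem isYExpansion_casimirY (hN : 1 ≤ N) : IsYExpansion N j (casimirY N j) := by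
  have h0 : (matA N j).det ≠ 0 := det_genericChain_ne_zero _
  have h1 := laurent_pencilDet (matA N j) (matA N j)ᵀ
  rw [IsYExpansion]
  refine (congrArg (fun z => C (matA N j).det⁻¹ * z) h1).trans ?_
  set d : ℕ → RatFun N j := fun m => (pencilDet (matA N j) (matA N j)ᵀ).coeff m / (matA N j).det
    with hd
  have hd0 : d 0 = 1 := by
    rw [hd]; simp only; rw [coeff_zero_pencilDet, Matrix.det_transpose, div_self h0]
  have hdN : d N = 1 := by
    rw [hd]; simp only; rw [coeff_card_pencilDet, div_self h0]
  have hdp : ∀ p ≤ N, d (N - p) = d p := fun p hp => by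
    rw [hd]; simp only; rw [coeff_pencilDet_transpose _ hp]
  set f : ℕ → LaurentPolynomial (RatFun N j) := fun m => C (d m) * T (2 * (m : ℤ) - N) with hf
  have h2 : C (matA N j).det⁻¹ * ∑ m ∈ Finset.range (N + 1),
      C ((pencilDet (matA N j) (matA N j)ᵀ).coeff m) * T (2 * (m : ℤ) - N) =
      ∑ m ∈ Finset.range (N + 1), f m := by
    rw [Finset.mul_sum]
    refine Finset.sum_congr rfl fun m _ => ?_
    rw [hf]
    simp only
    rw [hd]
    simp only
    rw [div_eq_inv_mul, map_mul, mul_assoc]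
  rw [h2]
  have hf0 : f 0 + f N = T (N : ℤ) + T (-(N : ℤ)) := by
    rw [hf]
    simp only [hd0, hdN, map_one, one_mul]
    rw [add_comm]
    congr 2
    · ring
    · simp
  have hfp : ∀ p, p ≤ N → f p + f (N - p) =
      (T ((N : ℤ) - 2 * p) + T (2 * p - (N : ℤ))) * C (d p) := by
    intro p hp
    rw [hf]
    simp only [hdp p hp]
    rw [Nat.cast_sub hp, add_mul, mul_comm, add_comm, mul_comm (C (d p))]
    congr 3
    ring
  rw [← hf0]
  have hY : ∀ p : Fin (N / 2), casimirY N j p =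
      d (p + 1) * (if 2 * ((p : ℕ) + 1) = N then 2⁻¹ else 1) := fun p => rfl
  rcases Nat.even_or_odd' N with ⟨n, hn | hn⟩
  -- Here `1 ≤ N` matters: for `N = 0` the two outer powers coincide and the expansion would read `1
  -- = 2`.
  · obtain ⟨m, rfl⟩ : ∃ m, n = m + 1 := ⟨n - 1, by omega⟩
    have hr : N + 1 = 2 * (m + 1) + 1 := by omega
    have hN2 : N / 2 = m + 1 := by omega
    rw [hr, sum_range_even_fold, Finset.sum_range_succ', ← hn, Nat.sub_zero, add_right_comm,
      add_comm]
    congr 1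
    have h3 : ∀ p : Fin (N / 2), (T ((N : ℤ) - 2 * ((p : ℕ) + 1)) +
        T (2 * ((p : ℕ) + 1) - (N : ℤ))) * C (casimirY N j p) =
        (fun p : ℕ => if p = m then f (m + 1) else f (p + 1) + f (N - (p + 1))) p := by
      intro p
      have hp := p.2
      rw [hY]
      simp only
      by_cases hpm : (p : ℕ) = m
      · rw [if_pos hpm, if_pos (by omega)]
        have h4 := hfp (m + 1) (by omega)
        rw [show N - (m + 1) = m + 1 by omega] at h4
        have h5 : (C (2⁻¹ : RatFun N j) : LaurentPolynomial (RatFun N j)) * 2 = 1 := by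
          rw [← map_ofNat C 2, ← map_mul, inv_mul_cancel₀ two_ne_zero, map_one]
        rw [hpm, map_mul, ← mul_assoc, ← Nat.cast_succ, ← h4]
        linear_combination f (m + 1) * h5
      · rw [if_neg hpm, if_neg (by omega), mul_one, hfp _ (by omega)]
        push_cast
        rfl
    rw [Finset.sum_congr rfl fun p _ => h3 p, ← Finset.sum_range
      (fun p : ℕ => if p = m then f (m + 1) else f (p + 1) + f (N - (p + 1))), hN2,
      Finset.sum_range_succ, if_pos rfl]
    congr 1
    refine Finset.sum_congr rfl fun p hp => ?_
    rw [if_neg (by rw [Finset.mem_range] at hp; omega)]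
  · have hr : N + 1 = 2 * n + 2 := by omega
    have hN2 : N / 2 = n := by omega
    rw [hr, sum_range_odd_fold, Finset.sum_range_succ', ← hn, Nat.sub_zero, add_comm]
    congr 1
    have h3 : ∀ p : Fin (N / 2), (T ((N : ℤ) - 2 * ((p : ℕ) + 1)) +
        T (2 * ((p : ℕ) + 1) - (N : ℤ))) * C (casimirY N j p) =
        (fun p : ℕ => f (p + 1) + f (N - (p + 1))) p := by
      intro p
      have hp := p.2
      rw [hY, if_neg (by omega), mul_one]
      simp only
      rw [hfp _ (by omega)]
      push_cast
      rfl
    rw [Finset.sum_congr rfl fun p _ => h3 p, ← Finset.sum_range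
      (fun p : ℕ => f (p + 1) + f (N - (p + 1))), hN2]

end Expansions

/-! ### The Poisson tensor at antidiagonal matrices -/

section Antidiagonal

variable {N : ℕ} {R : Type*} [CommRing R]

/-- The antidiagonal matrix with entry `u i` in row `i`. -/
def antiMat (u : Fin N → R) : Matrix (Fin N) (Fin N) R :=
  Matrix.of fun i a => if a = i.rev then u i else 0

theorem antiMat_apply (u : Fin N → R) (i a : Fin N) :
    antiMat u i a = if a = i.rev then u i else 0 := rfl

theorem antiMat_apply_rev (u : Fin N → R) (l k : Fin N) :
    antiMat u l k.rev = if l = k then u k else 0 := by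
  rw [antiMat_apply]
  by_cases h : l = k
  · subst h; simp
  · rw [if_neg h, if_neg]
    rw [Fin.rev_inj]
    exact fun e => h e.symm

theorem antiMat_map {S : Type*} [CommRing S] (f : R →+* S) (u : Fin N → R) :
    (antiMat u).map f = antiMat fun i => f (u i) := by
  ext i a
  simp [antiMat_apply, apply_ite f]

theorem sum_sum_mul_single (F V : Fin N → Fin N → R) (l₀ m₀ : Fin N) (c : R)
    (h : ∀ l m, F l m = if l = l₀ then (if m = m₀ then c else 0) else 0) :
    ∑ l, ∑ m, F l m * V l m = c * V l₀ m₀ := by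
  simp [h]

variable (x y : Fin N → R) (V : Fin N → Fin N → R) (i k : Fin N)

/-- In this and the following sums the row `(i, k.rev)` meets a covector `V` only in the entries
`(k, i.rev)` and `(i.rev, k)`. This sparsity makes the kernel computable. -/
theorem sum_bracketPair_antiMat :
    ∑ l, ∑ m, bracketPair (antiMat x) (antiMat y) (i, l) (k.rev, m) * V l m =
      (rho R i k * x k * y i - rho R k i * x i * y k) * V k i.rev := by
  refine sum_sum_mul_single _ _ _ _ _ fun l m => ?_
  rw [bracketPair_apply, antiMat_apply_rev, antiMat_apply_rev, antiMat_apply, antiMat_apply]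
  by_cases hl : l = k <;> by_cases hm : m = i.rev
  · subst hl hm; simp [rho_rev]
  all_goals simp [hl, hm]

theorem sum_neg_flip12_bracketPair_antiMat :
    ∑ l, ∑ m, (-flip12 (bracketPair (antiMat y) (antiMat x))) (i, l) (k.rev, m) * V l m =
      (rho R i k * x i * y k - rho R k i * x k * y i) * V k i.rev := by
  refine sum_sum_mul_single _ _ _ _ _ fun l m => ?_
  rw [Matrix.neg_apply, flip12_apply, bracketPair_apply, antiMat_apply_rev, antiMat_apply_rev,
    antiMat_apply, antiMat_apply]
  by_cases hl : l = k <;> by_cases hm : m = i.rev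
  · subst hl hm; simp [rho_rev]; ring
  all_goals simp [hl, hm]

theorem sum_bracketNext_antiMat :
    ∑ l, ∑ m, bracketNext (antiMat x) (antiMat y) (i, l) (k.rev, m) * V l m =
      -(rho R k i * x i * y k.rev) * V i.rev k := by
  refine sum_sum_mul_single _ _ _ _ _ fun l m => ?_
  rw [bracketNext_apply, antiMat_apply, antiMat_apply, Fin.rev_rev]
  by_cases hl : l = i.rev <;> by_cases hm : m = k
  · subst hl hm; simp [rho_rev]
  all_goals simp [hl, hm]

theorem sum_neg_flip12_bracketNext_antiMat :
    ∑ l, ∑ m, (-flip12 (bracketNext (antiMat y) (antiMat x))) (i, l) (k.rev, m) * V l m =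
      (rho R i k * x k * y i.rev) * V i.rev k := by
  refine sum_sum_mul_single _ _ _ _ _ fun l m => ?_
  rw [Matrix.neg_apply, flip12_apply, bracketNext_apply, antiMat_apply_rev,
    ← Fin.rev_rev i, antiMat_apply_rev, Fin.rev_rev]
  by_cases hl : l = i.rev <;> by_cases hm : m = k
  · subst hl hm; simp; ring
  · simp [hl, hm]
  all_goals simp [hl, hm]

theorem sum_bracketXA_antiMat :
    ∑ l, ∑ m, bracketXA (antiMat x) (antiMat y) (i, l) (k.rev, m) * V l m =
      -(rho R k i * x i * (y k.rev * V i.rev k + y k * V k i.rev)) := by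
  have h1 : ∑ l, ∑ m, -(rho R m k.rev * antiMat x i m * antiMat y l k.rev) * V l m =
      -(rho R k i * x i * y k) * V k i.rev := by
    refine sum_sum_mul_single _ _ _ _ _ fun l m => ?_
    rw [antiMat_apply_rev, antiMat_apply]
    by_cases hl : l = k <;> by_cases hm : m = i.rev
    · subst hl hm; simp [rho_rev]
    all_goals simp [hl, hm]
  have h2 := sum_bracketNext_antiMat x y V i k
  calc _ = ∑ l, ∑ m, bracketNext (antiMat x) (antiMat y) (i, l) (k.rev, m) * V l m +
        ∑ l, ∑ m, -(rho R m k.rev * antiMat x i m * antiMat y l k.rev) * V l m := by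
        rw [← Finset.sum_add_distrib]
        refine Finset.sum_congr rfl fun l _ => ?_
        rw [← Finset.sum_add_distrib]
        refine Finset.sum_congr rfl fun m _ => ?_
        rw [bracketXA_apply, bracketNext_apply]; ring
    _ = _ := by rw [h1, h2]; ring

theorem sum_neg_flip12_bracketXA_antiMat :
    ∑ l, ∑ m, (-flip12 (bracketXA (antiMat y) (antiMat x))) (i, l) (k.rev, m) * V l m =
      rho R i k * (x k * y i.rev * V i.rev k + x i * y k * V k i.rev) := by
  have h1 : ∑ l, ∑ m, rho R k.rev m * antiMat y l k.rev * antiMat x i m * V l m =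
      rho R i k * y k * x i * V k i.rev := by
    refine sum_sum_mul_single _ _ _ _ _ fun l m => ?_
    rw [antiMat_apply_rev, antiMat_apply]
    by_cases hl : l = k <;> by_cases hm : m = i.rev
    · subst hl hm; simp [rho_rev]
    all_goals simp [hl, hm]
  have h2 := sum_neg_flip12_bracketNext_antiMat x y V i k
  calc _ = ∑ l, ∑ m, (-flip12 (bracketNext (antiMat y) (antiMat x))) (i, l) (k.rev, m) * V l m +
        ∑ l, ∑ m, rho R k.rev m * antiMat y l k.rev * antiMat x i m * V l m := by
        rw [← Finset.sum_add_distrib]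
        refine Finset.sum_congr rfl fun l _ => ?_
        rw [← Finset.sum_add_distrib]
        refine Finset.sum_congr rfl fun m _ => ?_
        rw [Matrix.neg_apply, Matrix.neg_apply, flip12_apply, flip12_apply, bracketXA_apply,
          bracketNext_apply]; ring
    _ = _ := by rw [h1, h2]; ring

theorem sum_bracketAA_antiMat :
    ∑ l, ∑ m, bracketAA (antiMat x) (i, l) (k.rev, m) * V l m =
      (rho R i k - rho R k i) * x i * x k * V k i.rev +
        (rho R i k * x i * x k.rev - rho R k i * x i.rev * x k) * V i.rev k := by
  have h1 : ∑ l, ∑ m, (rho R k.rev l * antiMat x i l * antiMat x k.rev m -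
      rho R m i * antiMat x l i * antiMat x m k.rev) * V l m =
      (rho R i k * x i * x k.rev - rho R k i * x i.rev * x k) * V i.rev k := by
    refine sum_sum_mul_single _ _ _ _ _ fun l m => ?_
    have e : antiMat x l i = if l = i.rev then x i.rev else 0 := by
      have := antiMat_apply_rev x l i.rev
      rwa [Fin.rev_rev] at this
    rw [antiMat_apply_rev, e, antiMat_apply, antiMat_apply, Fin.rev_rev]
    by_cases hl : l = i.rev <;> by_cases hm : m = k
    · subst hl hm; simp [rho_rev]
    all_goals simp [hl, hm]
  have h2 := sum_bracketPair_antiMat x x V i k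
  calc _ = ∑ l, ∑ m, bracketPair (antiMat x) (antiMat x) (i, l) (k.rev, m) * V l m +
        ∑ l, ∑ m, (rho R k.rev l * antiMat x i l * antiMat x k.rev m -
          rho R m i * antiMat x l i * antiMat x m k.rev) * V l m := by
        rw [← Finset.sum_add_distrib]
        refine Finset.sum_congr rfl fun l _ => ?_
        rw [← Finset.sum_add_distrib]
        refine Finset.sum_congr rfl fun m _ => ?_
        rw [bracketAA_apply, bracketPair_apply]; ring
    _ = _ := by rw [h1, h2]; ring

end Antidiagonal

/-! ### The kernel equations at the base point -/

section BasePoint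

variable {N j : ℕ}

/-- The antidiagonal entries of the base point. -/
noncomputable def baseEntry (N j : ℕ) : Slot j → Fin N → ℂ
  | none, i => 2 ^ (i : ℕ)
  | some (_, false), _ => 1
  | some (_, true), i => (i : ℕ) + 1

/-- A chain of antidiagonal matrices at which the Poisson tensor has maximal rank. -/
noncomputable def basePoint (N j : ℕ) : Slot j → Matrix (Fin N) (Fin N) ℂ :=
  fun s => antiMat (baseEntry N j s)

theorem baseEntry_ne_zero (s : Slot j) (i : Fin N) : baseEntry N j s i ≠ 0 := by
  rcases s with _ | ⟨k, _ | _⟩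
  · simp [baseEntry]
  · simp [baseEntry]
  · exact Nat.cast_add_one_ne_zero _

/-- The antidiagonal entries of `B` and `C` at the base point. -/
noncomputable def wt (d : Bool) (i : Fin N) : ℂ := if d then (i : ℕ) + 1 else 1

theorem baseEntry_some (n : Fin j) (d : Bool) : baseEntry N j (some (n, d)) = wt d := by
  ext i
  cases d <;> simp [baseEntry, wt]

/-- Only nearest neighbours interact; `C j = 0` is the boundary condition beyond the last pair. -/
theorem sum_tridiagonal {R : Type*} [AddCommGroup R] (n : Fin j) (A : R) (B C : ℕ → R)
    (hC : C j = 0) :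
    ∑ m : Fin j, (if n = m then A else if (n : ℕ) = m + 1 then B m
      else if (m : ℕ) = n + 1 then C m else 0) =
      A + (if (n : ℕ) = 0 then 0 else B (n - 1)) + C (n + 1) := by
  have h : ∀ m : Fin j, (if n = m then A else if (n : ℕ) = m + 1 then B m
      else if (m : ℕ) = n + 1 then C m else 0) =
      (if (m : ℕ) = n then A else 0) + (if (m : ℕ) + 1 = n then B (n - 1) else 0) +
        if (m : ℕ) = n + 1 then C (n + 1) else 0 := by
    intro m
    by_cases h1 : n = m
    · subst h1; simp
    · have h1' : (m : ℕ) ≠ n := fun e => h1 (Fin.ext e.symm)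
      rw [if_neg h1, if_neg h1', zero_add]
      by_cases h2 : (n : ℕ) = m + 1
      · rw [if_pos h2, if_pos h2.symm, if_neg (by omega), add_zero, h2, Nat.add_sub_cancel]
      · rw [if_neg h2, if_neg (Ne.symm h2), zero_add]
        by_cases h3 : (m : ℕ) = n + 1
        · rw [if_pos h3, if_pos h3, h3]
        · rw [if_neg h3, if_neg h3]
  rw [Finset.sum_congr rfl fun m _ => h m, Finset.sum_add_distrib, Finset.sum_add_distrib,
    sum_fin_ite_eq j _ Finset.univ (fun _ => True) (by simp),
    sum_fin_ite_eq j _ Finset.univ (fun _ => True) (by simp),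
    sum_fin_ite_succ_eq n.2.le Finset.univ (fun _ => True) (by simp), if_pos ⟨n.2, trivial⟩]
  congr 1
  · congr 1
    by_cases h0 : (n : ℕ) = 0
    · rw [if_pos h0, if_neg (by omega)]
    · rw [if_neg h0, if_pos ⟨by omega, trivial⟩]
  · by_cases h1 : (n : ℕ) + 1 < j
    · rw [if_pos ⟨h1, trivial⟩]
    · rw [if_neg (by simp; omega), show (n : ℕ) + 1 = j by omega, hC]

/-- The part of `f` at the matrix `d` of the pair `n`, zero beyond the last pair. -/
def pairPart (f : Coord N j → ℂ) (n : ℕ) (d : Bool) (l m : Fin N) : ℂ :=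
  if h : n < j then f (some (⟨n, h⟩, d), l, m) else 0

theorem pairPart_fin (f : Coord N j → ℂ) (n : Fin j) (d : Bool) (l m : Fin N) :
    pairPart f n d l m = f (some (n, d), l, m) := dif_pos n.2

theorem pairPart_of_le (f : Coord N j → ℂ) {n : ℕ} (hn : j ≤ n) (d : Bool) (l m : Fin N) :
    pairPart f n d l m = 0 := dif_neg (by omega)

/-- The coefficient of the block of the matrices `d`, `e` of one pair. -/
noncomputable def pairCoef (d e : Bool) (i k : Fin N) : ℂ :=
  if d = false ∧ e = true then rho ℂ i k * wt d i * wt e k - rho ℂ k i * wt d k * wt e i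
  else rho ℂ i k * wt d k * wt e i - rho ℂ k i * wt d i * wt e k

theorem sum_row_pair_pair (f : Coord N j → ℂ) (n m : Fin j) (d e : Bool) (i k : Fin N) :
    ∑ l, ∑ q, chainBracket (basePoint N j) (some (n, d)) (some (m, e)) (i, l) (k.rev, q) *
        f (some (m, e), l, q) =
      if n = m then pairCoef d e i k * pairPart f n e k i.rev
      else if (n : ℕ) = m + 1 then
        -(rho ℂ k i * wt d i * wt e k.rev) * pairPart f m e i.rev k
      else if (m : ℕ) = n + 1 then
        rho ℂ i k * wt d k * wt e i.rev * pairPart f m e i.rev k else 0 := by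
  simp only [chainBracket, basePoint, baseEntry_some]
  by_cases h1 : n = m
  · subst h1
    simp only [if_true, pairCoef, pairPart_fin]
    by_cases h2 : d = false ∧ e = true
    · simp only [if_pos h2]
      exact sum_neg_flip12_bracketPair_antiMat _ _ (fun l q => f (some (n, e), l, q)) i k
    · simp only [if_neg h2]
      exact sum_bracketPair_antiMat _ _ (fun l q => f (some (n, e), l, q)) i k
  · simp only [if_neg h1, pairPart_fin]
    by_cases h2 : (n : ℕ) = m + 1
    · simp only [if_pos h2]
      exact sum_bracketNext_antiMat _ _ (fun l q => f (some (m, e), l, q)) i k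
    · simp only [if_neg h2]
      by_cases h3 : (m : ℕ) = n + 1
      · simp only [if_pos h3]
        exact sum_neg_flip12_bracketNext_antiMat _ _ (fun l q => f (some (m, e), l, q)) i k
      · simp [if_neg h3]

theorem mulVec_poissonTensor (x : Slot j → Matrix (Fin N) (Fin N) ℂ) (f : Coord N j → ℂ)
    (s : Slot j) (i a : Fin N) :
    ((poissonTensor x).mulVec f) (s, i, a) =
      ∑ l, ∑ q, chainBracket x s none (i, l) (a, q) * f (none, l, q) +
        ∑ e, ∑ n : Fin j, ∑ l, ∑ q,
          chainBracket x s (some (n, e)) (i, l) (a, q) * f (some (n, e), l, q) := by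
  rw [Matrix.mulVec, dotProduct, Fintype.sum_prod_type, Fintype.sum_option, Fintype.sum_prod_type,
    Fintype.sum_prod_type, Finset.sum_comm (s := (Finset.univ : Finset Bool))]
  simp only [Fintype.sum_prod_type]
  rfl

/-- The contribution of the neighbour on the left. -/
noncomputable def leftPart (f : Coord N j → ℂ) (n : ℕ) (i k : Fin N) : ℂ :=
  if n = 0 then 2 ^ (k.rev : ℕ) * f (none, i.rev, k) + 2 ^ (k : ℕ) * f (none, k, i.rev)
  else ∑ e, wt e k.rev * pairPart f (n - 1) e i.rev k

/-- The right neighbour is weighted by `rho ℂ i k` and the left one by `rho ℂ k i`, so off the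
antidiagonal (`i ≠ k`) each equation sees a neighbour on one side only. -/
theorem row_pair {f : Coord N j → ℂ} (hf : (poissonTensor (basePoint N j)).mulVec f = 0)
    (n : Fin j) (d : Bool) (i k : Fin N) :
    ∑ e, pairCoef d e i k * pairPart f n e k i.rev +
      rho ℂ i k * wt d k * ∑ e, wt e i.rev * pairPart f (n + 1) e i.rev k -
      rho ℂ k i * wt d i * leftPart f n i k = 0 := by
  have h := congrFun hf (some (n, d), i, k.rev)
  rw [mulVec_poissonTensor] at h
  simp only [sum_row_pair_pair] at h
  have h1 : ∀ e : Bool, ∑ m : Fin j, (if n = m then pairCoef d e i k * pairPart f n e k i.rev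
      else if (n : ℕ) = m + 1 then
        -(rho ℂ k i * wt d i * wt e k.rev) * pairPart f m e i.rev k
      else if (m : ℕ) = n + 1 then
        rho ℂ i k * wt d k * wt e i.rev * pairPart f m e i.rev k else 0) = _ := fun e =>
    sum_tridiagonal n (pairCoef d e i k * pairPart f n e k i.rev)
      (fun m => -(rho ℂ k i * wt d i * wt e k.rev) * pairPart f m e i.rev k)
      (fun m => rho ℂ i k * wt d k * wt e i.rev * pairPart f m e i.rev k)
      (by rw [pairPart_of_le f le_rfl, mul_zero])
  simp only [h1] at h
  simp only [Fintype.sum_bool, Pi.zero_apply] at h ⊢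
  rw [leftPart]
  by_cases h0 : (n : ℕ) = 0
  · have h2 : ∑ l, ∑ q, chainBracket (basePoint N j) (some (n, d)) none (i, l) (k.rev, q) *
        f (none, l, q) = -(rho ℂ k i * wt d i * (2 ^ (k.rev : ℕ) * f (none, i.rev, k) +
          2 ^ (k : ℕ) * f (none, k, i.rev))) := by
      simp only [chainBracket, if_pos h0, basePoint, baseEntry_some]
      exact sum_bracketXA_antiMat _ _ (fun l q => f (none, l, q)) i k
    rw [h2] at h
    simp only [if_pos h0] at h ⊢
    linear_combination h
  · have h2 : ∑ l, ∑ q, chainBracket (basePoint N j) (some (n, d)) none (i, l) (k.rev, q) *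
        f (none, l, q) = 0 := by
      simp [chainBracket, if_neg h0]
    rw [h2] at h
    simp only [if_neg h0, Fintype.sum_bool] at h ⊢
    linear_combination h

theorem row_head {f : Coord N j → ℂ} (hf : (poissonTensor (basePoint N j)).mulVec f = 0)
    (i k : Fin N) :
    (rho ℂ i k - rho ℂ k i) * 2 ^ (i : ℕ) * 2 ^ (k : ℕ) * f (none, k, i.rev) +
      (rho ℂ i k * 2 ^ (i : ℕ) * 2 ^ (k.rev : ℕ) - rho ℂ k i * 2 ^ (i.rev : ℕ) * 2 ^ (k : ℕ)) *
        f (none, i.rev, k) +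
      rho ℂ i k * (2 ^ (k : ℕ) * ∑ e, wt e i.rev * pairPart f 0 e i.rev k +
        2 ^ (i : ℕ) * ∑ e, wt e k * pairPart f 0 e k i.rev) = 0 := by
  have h := congrFun hf (none, i, k.rev)
  rw [mulVec_poissonTensor] at h
  have h1 : ∑ l, ∑ q, chainBracket (basePoint N j) none none (i, l) (k.rev, q) *
      f (none, l, q) = _ := sum_bracketAA_antiMat _ (fun l q => f (none, l, q)) i k
  have h2 : ∀ e : Bool, ∑ n : Fin j, ∑ l, ∑ q,
      chainBracket (basePoint N j) none (some (n, e)) (i, l) (k.rev, q) *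
        f (some (n, e), l, q) = rho ℂ i k * (2 ^ (k : ℕ) * wt e i.rev * pairPart f 0 e i.rev k +
          2 ^ (i : ℕ) * wt e k * pairPart f 0 e k i.rev) := by
    intro e
    by_cases hj : 0 < j
    · rw [Finset.sum_eq_single ⟨0, hj⟩]
      · have h3 : ∀ l m, pairPart f 0 e l m = f (some (⟨0, hj⟩, e), l, m) :=
          pairPart_fin f ⟨0, hj⟩ e
        simp only [chainBracket, if_true, h3, basePoint, baseEntry_some]
        exact sum_neg_flip12_bracketXA_antiMat _ _ (fun l q => f (some (⟨0, hj⟩, e), l, q)) i k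
      · intro n _ hn
        have : (n : ℕ) ≠ 0 := fun e => hn (Fin.ext e)
        simp [chainBracket, if_neg this]
      · simp
    · obtain rfl : j = 0 := by omega
      simp [pairPart_of_le f le_rfl]
  rw [h1] at h
  simp only [h2, Fintype.sum_bool, Pi.zero_apply] at h ⊢
  simp only [baseEntry] at h
  linear_combination h

end BasePoint

/-! ### Solving for the kernel of the Poisson tensor -/

section Kernel

variable {N j : ℕ} {f : Coord N j → ℂ}

theorem sub_ne_zero_of_val_lt {i k : Fin N} (h : k < i) : ((i : ℕ) : ℂ) - ((k : ℕ) : ℂ) ≠ 0 :=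
  sub_ne_zero.2 fun e => (Fin.lt_def.1 h).ne' (Nat.cast_injective e)

/-- For `k < i` the left neighbour drops out, so the entries are eliminated from the last pair
backwards; the induction is on the distance `p` to the right end. -/
theorem pairPart_low (hf : (poissonTensor (basePoint N j)).mulVec f = 0) (n : ℕ) :
    ∀ (d : Bool) {i k : Fin N}, k < i → pairPart f n d k i.rev = 0 := by
  suffices H : ∀ p n, j ≤ n + p → ∀ (d : Bool) {i k : Fin N}, k < i →
      pairPart f n d k i.rev = 0 from H j n (by omega)
  intro p
  induction p with
  | zero => exact fun n hn d i k _ => pairPart_of_le f hn d _ _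
  | succ p ih =>
    intro n hn d i k hik
    by_cases hj : j ≤ n
    · exact pairPart_of_le f hj d _ _
    have h0 := fun e => row_pair hf ⟨n, by omega⟩ e i k
    have hS : ∀ e, pairPart f (n + 1) e i.rev k = 0 := fun e => by
      have := ih (n + 1) (by omega) e (i := k.rev) (k := i.rev) (Fin.rev_lt_rev.2 hik)
      rwa [Fin.rev_rev] at this
    simp only [hS, rho_of_lt hik, rho_of_gt hik, pairCoef, Fintype.sum_bool, wt] at h0
    have hF := h0 false
    have hT := h0 true
    simp only [if_true, Bool.false_eq_true, and_true, and_false, if_false,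
      Bool.true_eq_false] at hF hT
    have hk : ((k : ℕ) : ℂ) + 1 ≠ 0 := Nat.cast_add_one_ne_zero _
    have hT' : pairPart f n false k i.rev + ((i : ℕ) + 1) * pairPart f n true k i.rev = 0 := by
      refine mul_left_cancel₀ (mul_ne_zero two_ne_zero hk) ?_
      linear_combination hT
    have hF' : pairPart f n false k i.rev + ((k : ℕ) + 1) * pairPart f n true k i.rev = 0 := by
      linear_combination hF / 2
    -- The rows of `B` and `C` give a system of two equations with determinant `i - k`, owing to the
    -- entries `1` and `i + 1` of the base point.
    have hy : pairPart f n true k i.rev = 0 := by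
      refine mul_left_cancel₀ (sub_ne_zero_of_val_lt hik) ?_
      linear_combination hT' - hF'
    cases d
    · rw [hy, mul_zero, add_zero] at hF'; exact hF'
    · exact hy

/-- The reason for the powers of two in `𝔸`: the ratios of opposite antidiagonal entries become
pairwise distinct. -/
theorem two_pow_mul_two_pow_ne {a b c d : ℕ} (h : a + b ≠ c + d) :
    (2 : ℂ) ^ a * 2 ^ b - 2 ^ c * 2 ^ d ≠ 0 := by
  rw [← pow_add, ← pow_add, sub_ne_zero]
  intro e
  refine h (Nat.pow_right_injective le_rfl ?_)
  exact_mod_cast e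

/-- Once the first pair contributes nothing, the rows for `(i, k)` and `(k.rev, i.rev)` involve the
same two entries of `𝔸`, with nonzero determinant. -/
theorem head_low (hf : (poissonTensor (basePoint N j)).mulVec f = 0) {i k : Fin N} (hik : k < i) :
    f (none, k, i.rev) = 0 := by
  have key : ∀ {i k : Fin N}, k < i →
      2 ^ (k : ℕ) * f (none, k, i.rev) + 2 ^ (k.rev : ℕ) * f (none, i.rev, k) = 0 := by
    intro i k hik
    have h := row_head hf i k
    have h1 : ∀ e, pairPart f 0 e k i.rev = 0 := fun e => pairPart_low hf 0 e hik
    have h2 : ∀ e, pairPart f 0 e i.rev k = 0 := fun e => by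
      have := pairPart_low hf 0 e (i := k.rev) (k := i.rev) (Fin.rev_lt_rev.2 hik)
      rwa [Fin.rev_rev] at this
    simp only [h1, h2, rho_of_lt hik, rho_of_gt hik, mul_zero, Finset.sum_const_zero,
      add_zero] at h
    refine mul_left_cancel₀ (mul_ne_zero two_ne_zero (pow_ne_zero (i : ℕ) two_ne_zero)) ?_
    linear_combination h
  have h1 := key hik
  have h2 := key (Fin.rev_lt_rev.2 hik)
  rw [Fin.rev_rev, Fin.rev_rev] at h2
  have hne : (k : ℕ) + i.rev ≠ k.rev + i := by
    simp only [Fin.val_rev]; have := Fin.lt_def.1 hik; omega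
  refine mul_left_cancel₀ (two_pow_mul_two_pow_ne hne) ?_
  linear_combination 2 ^ (i.rev : ℕ) * h1 - 2 ^ (k.rev : ℕ) * h2

/-- For `i < k` the weight of the first pair is zero, so the same system closes without any
information about the pairs. -/
theorem head_high (hf : (poissonTensor (basePoint N j)).mulVec f = 0) {i k : Fin N}
    (hik : i < k) : f (none, k, i.rev) = 0 := by
  have key : ∀ {i k : Fin N}, i < k →
      2 ^ (i : ℕ) * f (none, k, i.rev) + 2 ^ (i.rev : ℕ) * f (none, i.rev, k) = 0 := by
    intro i k hik
    have h := row_head hf i k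
    simp only [rho_of_lt hik, rho_of_gt hik, zero_mul, add_zero] at h
    refine mul_left_cancel₀ (mul_ne_zero two_ne_zero (pow_ne_zero (k : ℕ) two_ne_zero)) ?_
    linear_combination -h
  have h1 := key hik
  have h2 := key (Fin.rev_lt_rev.2 hik)
  rw [Fin.rev_rev] at h2
  have hne : (i : ℕ) + k.rev ≠ i.rev + k := by
    simp only [Fin.val_rev]; have := Fin.lt_def.1 hik; omega
  refine mul_left_cancel₀ (two_pow_mul_two_pow_ne hne) ?_
  linear_combination 2 ^ (k.rev : ℕ) * h1 - 2 ^ (i.rev : ℕ) * h2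

/-- For `i < k` the right neighbour drops out, and elimination runs forwards from `𝔸`. -/
theorem pairPart_high (hf : (poissonTensor (basePoint N j)).mulVec f = 0) (n : ℕ) :
    ∀ (d : Bool) {i k : Fin N}, i < k → pairPart f n d k i.rev = 0 := by
  have step : ∀ n, (∀ {i k : Fin N}, i < k → leftPart f n i k = 0) →
      ∀ (d : Bool) {i k : Fin N}, i < k → pairPart f n d k i.rev = 0 := by
    intro n hL d i k hik
    by_cases hj : j ≤ n
    · exact pairPart_of_le f hj d _ _
    have h0 := fun e => row_pair hf ⟨n, by omega⟩ e i k
    simp only [hL hik, rho_of_lt hik, rho_of_gt hik, pairCoef, Fintype.sum_bool, wt] at h0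
    have hF := h0 false
    have hT := h0 true
    simp only [if_true, Bool.false_eq_true, and_true, and_false, if_false,
      Bool.true_eq_false] at hF hT
    have hi : ((i : ℕ) : ℂ) + 1 ≠ 0 := Nat.cast_add_one_ne_zero _
    have hT' : pairPart f n false k i.rev + ((k : ℕ) + 1) * pairPart f n true k i.rev = 0 := by
      refine mul_left_cancel₀ (mul_ne_zero two_ne_zero hi) ?_
      linear_combination -hT
    have hF' : pairPart f n false k i.rev + ((i : ℕ) + 1) * pairPart f n true k i.rev = 0 := by
      linear_combination -hF / 2
    have hy : pairPart f n true k i.rev = 0 := by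
      refine mul_left_cancel₀ (sub_ne_zero_of_val_lt hik) ?_
      linear_combination hT' - hF'
    cases d
    · rw [hy, mul_zero, add_zero] at hF'; exact hF'
    · exact hy
  induction n with
  | zero =>
    refine step 0 fun {i k} hik => ?_
    have h := head_high hf (Fin.rev_lt_rev.2 hik)
    rw [Fin.rev_rev] at h
    rw [leftPart, if_pos rfl, head_high hf hik, h]
    ring
  | succ n ih =>
    refine step (n + 1) fun {i k} hik => ?_
    rw [leftPart, if_neg n.succ_ne_zero, Nat.add_sub_cancel]
    refine Finset.sum_eq_zero fun e _ => ?_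
    have h := ih e (Fin.rev_lt_rev.2 hik)
    rw [Fin.rev_rev] at h
    rw [h, mul_zero]

theorem eq_zero_of_antidiagonal (hf : (poissonTensor (basePoint N j)).mulVec f = 0)
    (h0 : ∀ s i, f (s, i, i.rev) = 0) : f = 0 := by
  ext ⟨s, k, m⟩
  obtain ⟨i, rfl⟩ : ∃ i, m = Fin.rev i := ⟨m.rev, (Fin.rev_rev m).symm⟩
  rcases lt_trichotomy k i with h | rfl | h
  · rcases s with _ | ⟨n, d⟩
    · exact head_low hf h
    · rw [← pairPart_fin f]; exact pairPart_low hf n d h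
  · exact h0 s k
  · rcases s with _ | ⟨n, d⟩
    · exact head_high hf h
    · rw [← pairPart_fin f]; exact pairPart_high hf n d h

/-- The combination of antidiagonal entries of the pair `n` that is controlled by the kernel
equations. -/
noncomputable def antiSum (f : Coord N j → ℂ) (n : ℕ) (i : Fin N) : ℂ :=
  ∑ e, wt e i * pairPart f n e i i.rev

theorem antiSum_of_le {n : ℕ} (hn : j ≤ n) (i : Fin N) : antiSum f n i = 0 :=
  Finset.sum_eq_zero fun e _ => by rw [pairPart_of_le f hn, mul_zero]

/-- On the antidiagonal the self-interaction of `𝔸` cancels, and its row constrains only the first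
pair. -/
theorem antiSum_zero_add (hf : (poissonTensor (basePoint N j)).mulVec f = 0) (i : Fin N) :
    antiSum f 0 i.rev + antiSum f 0 i = 0 := by
  have h := row_head hf i i
  refine mul_left_cancel₀ (pow_ne_zero (i : ℕ) (two_ne_zero (α := ℂ))) ?_
  rw [rho_self] at h
  rw [antiSum, antiSum, Fin.rev_rev]
  linear_combination h

theorem antiSum_succ (hf : (poissonTensor (basePoint N j)).mulVec f = 0) {n : ℕ} (hn : n < j)
    (i : Fin N) : antiSum f (n + 1) i.rev = leftPart f n i i := by
  have h := row_pair hf ⟨n, hn⟩ false i i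
  have hz : ∀ e, pairCoef false e i i = 0 := fun e => by
    cases e <;> simp [pairCoef, rho_self]
  simp only [hz, zero_mul, Finset.sum_const_zero, rho_self, zero_add, one_mul] at h
  rw [antiSum, Fin.rev_rev]
  simp only [wt, Bool.false_eq_true, if_false] at h ⊢
  linear_combination h

theorem antiSum_one (hf : (poissonTensor (basePoint N j)).mulVec f = 0) (hj : 0 < j)
    (i : Fin N) : antiSum f 1 i.rev =
      2 ^ (i.rev : ℕ) * f (none, i.rev, i) + 2 ^ (i : ℕ) * f (none, i, i.rev) := by
  rw [antiSum_succ hf hj, leftPart, if_pos rfl]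

/-- On the antidiagonal the interaction within a pair vanishes, so the row of a pair merely equates
the sums of its two neighbours. Hence the sums depend only on the parity of the position, and they
vanish at position `j`. -/
theorem antiSum_add_two (hf : (poissonTensor (basePoint N j)).mulVec f = 0) {n : ℕ}
    (hn : n + 1 < j) (i : Fin N) : antiSum f (n + 2) i = antiSum f n i := by
  have h := antiSum_succ hf hn i.rev
  rw [Fin.rev_rev, leftPart, if_neg n.succ_ne_zero, Nat.add_sub_cancel] at h
  rw [h, antiSum, Fin.rev_rev]

theorem antiSum_eq_of_parity (hf : (poissonTensor (basePoint N j)).mulVec f = 0) (a p : ℕ)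
    (hp : a + 2 * p ≤ j) (i : Fin N) : antiSum f (a + 2 * p) i = antiSum f a i := by
  induction p with
  | zero => rfl
  | succ p ih =>
    rw [show a + 2 * (p + 1) = a + 2 * p + 2 by ring, antiSum_add_two hf (by omega),
      ih (by omega)]

theorem antiSum_eq_zero_of_ends (hf : (poissonTensor (basePoint N j)).mulVec f = 0)
    (h0 : ∀ i, antiSum f 0 i = 0) (h1 : ∀ i, antiSum f 1 i = 0) (n : ℕ) (i : Fin N) :
    antiSum f n i = 0 := by
  by_cases hn : j ≤ n
  · exact antiSum_of_le hn i
  rcases Nat.even_or_odd' n with ⟨p, rfl | rfl⟩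
  · have := antiSum_eq_of_parity hf 0 p (by omega) i
    rw [zero_add, h0] at this
    exact this
  · have := antiSum_eq_of_parity hf 1 p (by omega) i
    rw [h1, add_comm] at this
    exact this

theorem eq_zero_of_antiSum (hf : (poissonTensor (basePoint N j)).mulVec f = 0)
    (hA : ∀ i, f (none, i, i.rev) = 0) (hC : ∀ n i, f (some (n, true), i, i.rev) = 0)
    (hS : ∀ n i, antiSum f n i = 0) : f = 0 := by
  refine eq_zero_of_antidiagonal hf fun s i => ?_
  rcases s with _ | ⟨n, _ | _⟩
  · exact hA i
  · have h := hS n i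
    simp only [antiSum, Fintype.sum_bool, pairPart_fin, hC] at h
    simpa [wt] using h
  · exact hC n i

/-- Sums at even positions agree with the vanishing one at `j`; those at odd positions come from
`𝔸`. So the antidiagonals of `𝔸` and of the `C`'s determine everything. -/
theorem eq_zero_of_even (hj : Even j) (hf : (poissonTensor (basePoint N j)).mulVec f = 0)
    (hA : ∀ i, f (none, i, i.rev) = 0) (hC : ∀ n i, f (some (n, true), i, i.rev) = 0) :
    f = 0 := by
  refine eq_zero_of_antiSum hf hA hC (antiSum_eq_zero_of_ends hf (fun i => ?_) fun i => ?_)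
  · obtain ⟨p, rfl⟩ := hj
    rw [← antiSum_eq_of_parity hf 0 p (by omega) i, antiSum_of_le (by omega)]
  · by_cases h0 : 0 < j
    · have h := antiSum_one hf h0 i.rev
      have h' := hA i.rev
      rw [Fin.rev_rev] at h h'
      rw [h, hA, h', mul_zero, mul_zero, add_zero]
    · exact antiSum_of_le (by omega) i

theorem eq_zero_of_add_rev {g : Fin N → ℂ} (h : ∀ i, g i.rev + g i = 0)
    (h0 : ∀ i : Fin N, (i : ℕ) < N / 2 → g i = 0) (i : Fin N) : g i = 0 := by
  have hi := h i
  by_cases h1 : (i : ℕ) < N / 2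
  · exact h0 i h1
  by_cases h2 : (i.rev : ℕ) < N / 2
  · rw [h0 _ h2, zero_add] at hi; exact hi
  have h3 : i.rev = i := by
    ext
    have := i.2
    simp only [Fin.val_rev] at h2 ⊢
    omega
  rw [h3] at hi
  linear_combination hi / 2

/-- Now the sums at odd positions vanish, which makes the weighted antidiagonal of `𝔸` odd under
reversal, and the row of `𝔸` makes the sum at position `0` odd as well. Hence half of `𝔸`, half of
the first `B` and all the `C`'s suffice. -/
theorem eq_zero_of_odd (hj : Odd j) (hf : (poissonTensor (basePoint N j)).mulVec f = 0)
    (hA : ∀ i : Fin N, (i : ℕ) < N / 2 → f (none, i, i.rev) = 0)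
    (hB : ∀ i : Fin N, (i : ℕ) < N / 2 → f (some (⟨0, hj.pos⟩, false), i, i.rev) = 0)
    (hC : ∀ n i, f (some (n, true), i, i.rev) = 0) : f = 0 := by
  have h1 : ∀ i, antiSum f 1 i = 0 := fun i => by
    obtain ⟨p, rfl⟩ := hj
    rw [← antiSum_eq_of_parity hf 1 p (by omega) i, antiSum_of_le (by omega)]
  have hA' : ∀ i, f (none, i, i.rev) = 0 := fun i => by
    have h := eq_zero_of_add_rev (g := fun i => 2 ^ (i : ℕ) * f (none, i, i.rev))
      (fun i => by rw [Fin.rev_rev, ← antiSum_one hf hj.pos, h1])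
      (fun i hi => by rw [hA i hi, mul_zero]) i
    exact (mul_eq_zero.1 h).resolve_left (pow_ne_zero _ two_ne_zero)
  refine eq_zero_of_antiSum hf hA' hC (antiSum_eq_zero_of_ends hf ?_ h1)
  refine eq_zero_of_add_rev (antiSum_zero_add hf) fun i hi => ?_
  have h2 : ∀ d, pairPart f 0 d i i.rev = f (some (⟨0, hj.pos⟩, d), i, i.rev) := fun d =>
    pairPart_fin f ⟨0, hj.pos⟩ d _ _
  simp only [antiSum, Fintype.sum_bool, h2, hC, hB i hi, mul_zero, add_zero]

end Kernel

/-! ### Lower bound for the leaf through the base point -/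

section BaseLeaf

variable {N j : ℕ}

theorem card_coord (N j : ℕ) : Fintype.card (Coord N j) = N ^ 2 * (2 * j + 1) := by
  simp only [Fintype.card_prod, Fintype.card_option, Fintype.card_fin, Fintype.card_bool]
  ring

/-- If vectors in the kernel of the Poisson tensor are determined by few coordinates, then the leaf
is large. -/
theorem le_leafDim_add_card {κ : Type*} [Fintype κ] (x : Slot j → Matrix (Fin N) (Fin N) ℂ)
    (c : κ → Coord N j)
    (h : ∀ f : Coord N j → ℂ, (poissonTensor x).mulVec f = 0 → (∀ k, f (c k) = 0) → f = 0) :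
    N ^ 2 * (2 * j + 1) ≤ leafDim x + Fintype.card κ := by
  have h1 := LinearMap.finrank_range_add_finrank_ker (poissonTensor x).mulVecLin
  rw [Module.finrank_fintype_fun_eq_card, card_coord] at h1
  have h2 : Module.finrank ℂ (LinearMap.ker (poissonTensor x).mulVecLin) ≤ Fintype.card κ := by
    rw [← Module.finrank_fintype_fun_eq_card (R := ℂ) (η := κ)]
    refine LinearMap.finrank_le_finrank_of_injective
      (f := (LinearMap.funLeft ℂ ℂ c).comp (Submodule.subtype _)) ?_
    rw [← LinearMap.ker_eq_bot, LinearMap.ker_eq_bot']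
    rintro ⟨f, hf⟩ h0
    ext1
    exact h f hf fun k => congrFun h0 k
  rw [leafDim, hamiltonianSpace]
  omega

/-- The coordinates that determine the kernel of the Poisson tensor at the base point, for an even
number of pairs. -/
def evenCoord (N j : ℕ) : Fin N ⊕ (Fin j × Fin N) → Coord N j
  | .inl i => (none, i, i.rev)
  | .inr (n, i) => (some (n, true), i, i.rev)

/-- The coordinates that determine the kernel of the Poisson tensor at the base point, for an odd
number of pairs. -/
def oddCoord (N j : ℕ) (hj : 0 < j) :
    Fin (N / 2) ⊕ (Fin j × Fin N) ⊕ Fin (N / 2) → Coord N j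
  | .inl i => (none, ⟨i, by omega⟩, Fin.rev ⟨i, by omega⟩)
  | .inr (.inl (n, i)) => (some (n, true), i, i.rev)
  | .inr (.inr i) => (some (⟨0, hj⟩, false), ⟨i, by omega⟩, Fin.rev ⟨i, by omega⟩)

theorem le_leafDim_basePoint_of_even (hj : Even j) :
    N ^ 2 * (2 * j + 1) ≤ leafDim (basePoint N j) + N * (j + 1) := by
  have h := le_leafDim_add_card (basePoint N j) (evenCoord N j) fun f hf h0 =>
    eq_zero_of_even hj hf (fun i => h0 (.inl i)) fun n i => h0 (.inr (n, i))
  simp only [Fintype.card_sum, Fintype.card_prod, Fintype.card_fin] at h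
  linarith

theorem le_leafDim_basePoint_of_odd (hj : Odd j) :
    N ^ 2 * (2 * j + 1) ≤ leafDim (basePoint N j) + (2 * (N / 2) + N * j) := by
  have h := le_leafDim_add_card (basePoint N j) (oddCoord N j hj.pos) fun f hf h0 =>
    eq_zero_of_odd hj hf (fun i hi => h0 (.inl ⟨i, hi⟩))
      (fun i hi => h0 (.inr (.inr ⟨i, hi⟩))) fun n i => h0 (.inr (.inl (n, i)))
  simp only [Fintype.card_sum, Fintype.card_prod, Fintype.card_fin] at h
  linarith

end BaseLeaf

/-! ### Jets of rational functions regular at a point -/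

section LocalJets

open TrivSqZeroExt MvPolynomial

variable {k σ : Type*} [Field k] (x : σ → k)

/-- The polynomials that do not vanish at `x`. -/
noncomputable def regularDenoms : Submonoid (MvPolynomial σ k) :=
  (nonZeroDivisors k).comap (eval x)

theorem mem_regularDenoms {p : MvPolynomial σ k} : p ∈ regularDenoms x ↔ eval x p ≠ 0 := by
  simp [regularDenoms]

theorem regularDenoms_le : regularDenoms x ≤ nonZeroDivisors (MvPolynomial σ k) := by
  intro p hp
  rw [mem_nonZeroDivisors_iff_ne_zero]
  rintro rfl
  exact (mem_regularDenoms x).1 hp (map_zero _)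

/-- The rational functions that are regular at `x`. -/
noncomputable abbrev localRing :
    Subalgebra (MvPolynomial σ k) (FractionRing (MvPolynomial σ k)) :=
  Localization.subalgebra.ofField _ (regularDenoms x) (regularDenoms_le x)

/-- The value at `x` of a regular function. -/
noncomputable def evalAt : localRing x →+* k :=
  IsLocalization.lift (M := regularDenoms x) (g := eval x) fun p =>
    isUnit_iff_ne_zero.2 ((mem_regularDenoms x).1 p.2)

theorem evalAt_algebraMap (p : MvPolynomial σ k) :
    evalAt x (algebraMap _ (localRing x) p) = eval x p := by
  simp [evalAt]

theorem coe_algebraMap_localRing (p : MvPolynomial σ k) :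
    ((algebraMap (MvPolynomial σ k) (localRing x) p : localRing x) :
      FractionRing (MvPolynomial σ k)) = algebraMap _ _ p := rfl

/-- Locality of the ring: a numerator with nonzero value is itself an admissible denominator. -/
theorem isUnit_of_evalAt_ne_zero {g : localRing x} (h : evalAt x g ≠ 0) : IsUnit g := by
  obtain ⟨⟨p, q⟩, hg⟩ := IsLocalization.surj (regularDenoms x) g
  have hp : p ∈ regularDenoms x := by
    rw [mem_regularDenoms, ← evalAt_algebraMap, ← hg, map_mul, evalAt_algebraMap]
    exact mul_ne_zero h ((mem_regularDenoms x).1 q.2)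
  have := IsLocalization.map_units (localRing x) (⟨p, hp⟩ : regularDenoms x)
  rw [← hg] at this
  exact isUnit_of_mul_isUnit_left this

/-- The first order jet at `x` of a regular function, in the direction `v`. -/
noncomputable def jetAt (v : σ → k) : localRing x →+* DualNumber k :=
  jet (regularDenoms x) (evalAt x) v

@[simp] theorem fst_jetAt (v : σ → k) (g : localRing x) : fst (jetAt x v g) = evalAt x g := by
  simp [jetAt]

/-- The rational function `f` is regular at `x`, with first order jet `z` in the direction `v`. -/
def HasJet (v : σ → k) (f : FractionRing (MvPolynomial σ k)) (z : DualNumber k) : Prop :=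
  ∃ g : localRing x, (g : FractionRing (MvPolynomial σ k)) = f ∧ jetAt x v g = z

variable {x} {v : σ → k} {f f' : FractionRing (MvPolynomial σ k)} {z z' : DualNumber k}

theorem HasJet.one : HasJet x v 1 1 := ⟨1, rfl, map_one _⟩

theorem HasJet.of_eq (h : HasJet x v f z) (e : z = z') : HasJet x v f z' := e ▸ h

theorem HasJet.mul (h : HasJet x v f z) (h' : HasJet x v f' z') :
    HasJet x v (f * f') (z * z') := by
  obtain ⟨g, rfl, rfl⟩ := h
  obtain ⟨g', rfl, rfl⟩ := h'
  exact ⟨g * g', rfl, map_mul _ _ _⟩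

theorem HasJet.inv (h : HasJet x v f z) (hz : z * z' = 1) : HasJet x v f⁻¹ z' := by
  obtain ⟨g, rfl, rfl⟩ := h
  have h1 : IsUnit g := by
    refine isUnit_of_evalAt_ne_zero x fun e => ?_
    have := congrArg fst hz
    rw [TrivSqZeroExt.fst_mul, fst_jetAt, e, zero_mul] at this
    simp at this
  obtain ⟨u, rfl⟩ := h1
  have h2 : ((u : localRing x) : FractionRing (MvPolynomial σ k)) * ((u⁻¹ : (localRing x)ˣ) :
      localRing x) = 1 := by
    rw [← Subalgebra.coe_mul, Units.mul_inv, Subalgebra.coe_one]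
  have h3 : jetAt x v (u : localRing x) * jetAt x v ((u⁻¹ : (localRing x)ˣ) : localRing x) = 1 := by
    rw [← map_mul, Units.mul_inv, map_one]
  refine ⟨((u⁻¹ : (localRing x)ˣ) : localRing x), eq_inv_of_mul_eq_one_right h2, ?_⟩
  exact (IsUnit.of_mul_eq_one _ hz).mul_left_cancel (h3.trans hz.symm)

theorem HasJet.div (h : HasJet x v f (z * z')) (h' : HasJet x v f' z) (hz : fst z ≠ 0) :
    HasJet x v (f / f') z' := by
  have h1 := TrivSqZeroExt.mul_inv_cancel hz
  have h2 := h.mul (h'.inv h1)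
  rw [div_eq_mul_inv]
  refine h2.of_eq ?_
  rw [mul_right_comm, h1, one_mul]

theorem hasJet_X (u : σ) :
    HasJet x v (algebraMap (MvPolynomial σ k) (FractionRing (MvPolynomial σ k)) (X u))
      (inl (x u) + inr (v u)) := by
  refine ⟨algebraMap (MvPolynomial σ k) (localRing x) (X u), coe_algebraMap_localRing x _, ?_⟩
  rw [jetAt, jet_algebraMap, jetPoly_X, RingHom.comp_apply, evalAt_algebraMap, eval_X]

theorem HasJet.natCast (n : ℕ) : HasJet x v (n : FractionRing (MvPolynomial σ k)) (inl (n : k)) := by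
  refine ⟨(n : localRing x), by simp, ?_⟩
  rw [map_natCast]
  exact (map_natCast (inlHom k k) n).symm

variable {n m : Type*}

/-- All entries of `M` are regular at `x`, with first order jets the entries of `Z`. -/
def MatJet (x v : σ → k) (M : Matrix n m (FractionRing (MvPolynomial σ k)))
    (Z : Matrix n m (DualNumber k)) : Prop :=
  ∀ i a, HasJet x v (M i a) (Z i a)

variable {M M' : Matrix n n (FractionRing (MvPolynomial σ k))} {Z Z' : Matrix n n (DualNumber k)}

theorem MatJet.exists_lift (h : MatJet x v M Z) : ∃ G : Matrix n n (localRing x),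
    G.map (localRing x).val = M ∧ G.map (jetAt x v) = Z := by
  choose G h1 h2 using h
  exact ⟨Matrix.of G, Matrix.ext h1, Matrix.ext h2⟩

theorem matJet_map (G : Matrix n n (localRing x)) :
    MatJet x v (G.map (localRing x).val) (G.map (jetAt x v)) := fun i a => ⟨G i a, rfl, rfl⟩

theorem MatJet.transpose (h : MatJet x v M Z) : MatJet x v Mᵀ Zᵀ := fun i a => h a i

variable [Fintype n]

theorem MatJet.mul (h : MatJet x v M Z) (h' : MatJet x v M' Z') :
    MatJet x v (M * M') (Z * Z') := by
  obtain ⟨G, rfl, rfl⟩ := h.exists_lift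
  obtain ⟨G', rfl, rfl⟩ := h'.exists_lift
  rw [← Matrix.map_mul, ← Matrix.map_mul]
  exact matJet_map _

variable [DecidableEq n]

theorem MatJet.det (h : MatJet x v M Z) : HasJet x v M.det Z.det := by
  obtain ⟨G, rfl, rfl⟩ := h.exists_lift
  exact ⟨G.det, AlgHom.map_det (localRing x).val G, RingHom.map_det (jetAt x v) G⟩

theorem MatJet.coeff_pencilDet (h : MatJet x v M Z) (h' : MatJet x v M' Z') (p : ℕ) :
    HasJet x v ((pencilDet M M').coeff p) ((pencilDet Z Z').coeff p) := by
  obtain ⟨G, rfl, rfl⟩ := h.exists_lift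
  obtain ⟨G', rfl, rfl⟩ := h'.exists_lift
  refine ⟨(pencilDet G G').coeff p, ?_, ?_⟩
  · have := map_pencilDet (localRing x).val.toRingHom G G'
    exact (Polynomial.coeff_map _ _).symm.trans (congrArg (fun q => q.coeff p) this)
  · rw [← map_pencilDet, Polynomial.coeff_map]

omit [Fintype n] in
theorem MatJet.one : MatJet x v (1 : Matrix n n (FractionRing (MvPolynomial σ k))) 1 := by
  have := matJet_map (v := v) (1 : Matrix n n (localRing x))
  rwa [Matrix.map_one _ (map_zero _) (map_one _), Matrix.map_one _ (map_zero _) (map_one _)] at this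

theorem MatJet.inv (h : MatJet x v M Z) (hZ : Z * Z' = 1) : MatJet x v M⁻¹ Z' := by
  have hdet : Z.det * Z'.det = 1 := by rw [← Matrix.det_mul, hZ, Matrix.det_one]
  obtain ⟨G, rfl, rfl⟩ := h.exists_lift
  have h1 : IsUnit G.det := by
    refine isUnit_of_evalAt_ne_zero x fun e => ?_
    have := congrArg fst hdet
    rw [TrivSqZeroExt.fst_mul, ← RingHom.mapMatrix_apply, ← RingHom.map_det, fst_jetAt, e,
      zero_mul] at this
    simp at this
  have h2 : G.map (localRing x).val * G⁻¹.map (localRing x).val = 1 := by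
    rw [← Matrix.map_mul, Matrix.mul_nonsing_inv _ h1, Matrix.map_one _ (map_zero _) (map_one _)]
  have h3 : G⁻¹.map (jetAt x v) * G.map (jetAt x v) = 1 := by
    rw [← Matrix.map_mul, Matrix.nonsing_inv_mul _ h1, Matrix.map_one _ (map_zero _) (map_one _)]
  rw [Matrix.inv_eq_right_inv h2, ← left_inv_eq_right_inv h3 hZ]
  exact matJet_map _

theorem MatJet.prod_ofFn {l : ℕ} {E : Fin l → Matrix n n (FractionRing (MvPolynomial σ k))}
    {F : Fin l → Matrix n n (DualNumber k)} (h : ∀ i, MatJet x v (E i) (F i)) :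
    MatJet x v (List.ofFn E).prod (List.ofFn F).prod := by
  induction l with
  | zero => simpa using MatJet.one
  | succ l ih =>
    rw [List.ofFn_succ, List.ofFn_succ, List.prod_cons, List.prod_cons]
    exact (h 0).mul (ih fun i => h i.succ)

end LocalJets

/-! ### From first order separation at a point to generic independence of gradients -/

section Gradients

open TrivSqZeroExt MvPolynomial

variable {k σ ι κ : Type*} [Field k] [Fintype σ] [DecidableEq σ] [Fintype ι] [DecidableEq ι]
  [Fintype κ] {x : σ → k}

omit [Fintype ι] [DecidableEq ι] [Fintype κ] in
theorem pd_coe (u : σ) (g : localRing x) :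
    pd (nonZeroDivisors (MvPolynomial σ k)) u (g : FractionRing (MvPolynomial σ k)) =
      ((pd (regularDenoms x) u g : localRing x) : FractionRing (MvPolynomial σ k)) :=
  map_pd (regularDenoms x) (nonZeroDivisors (MvPolynomial σ k)) (localRing x).val.toRingHom
    (fun p => coe_algebraMap_localRing x p) u g

/-- If the regular functions `f` separate the directions along the coordinates `c` to first order,
and there are as many functions as coordinates, then the gradients of the functions `f` are the
rows of a matrix with a right inverse. -/
theorem exists_gradient_mul_eq_one (c : κ → σ) (hc : Function.Injective c)
    (hcard : Fintype.card κ = Fintype.card ι) (f : ι → FractionRing (MvPolynomial σ k))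
    (hf : ∀ m, f m ∈ localRing x)
    (H : ∀ v : σ → k, (∀ u, u ∉ Set.range c → v u = 0) →
      (∀ m z, HasJet x v (f m) z → snd z = 0) → v = 0) :
    ∃ P : Matrix σ ι (FractionRing (MvPolynomial σ k)),
      (Matrix.of fun m u => pd (nonZeroDivisors (MvPolynomial σ k)) u (f m)) * P = 1 := by
  classical
  set g : ι → localRing x := fun m => ⟨f m, hf m⟩ with hg
  set G : Matrix ι σ (localRing x) := Matrix.of fun m u => pd (regularDenoms x) u (g m) with hG
  -- The differential of the functions at `x`, restricted to the directions of the chosen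
  -- coordinates; the separation hypothesis says that it is injective.
  set D : (κ → k) →ₗ[k] (ι → k) :=
    (G.map (evalAt x) * Matrix.of fun u l => if c l = u then (1 : k) else 0).mulVecLin with hD
  have hDinj : Function.Injective D := by
    rw [← LinearMap.ker_eq_bot, LinearMap.ker_eq_bot']
    intro t ht
    set v : σ → k := (Matrix.of fun u l => if c l = u then (1 : k) else 0).mulVec t with hv
    have hvc : ∀ l, v (c l) = t l := fun l => by
      simp [hv, Matrix.mulVec, dotProduct, hc.eq_iff]
    have hv0 : v = 0 := by
      refine H v (fun u hu => ?_) ?_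
      · simp only [hv, Matrix.mulVec, dotProduct, Matrix.of_apply]
        refine Finset.sum_eq_zero fun l _ => ?_
        rw [if_neg fun e => hu ⟨l, e⟩, zero_mul]
      · rintro m z ⟨g', hg', rfl⟩
        obtain rfl : g' = g m := Subtype.ext hg'
        have h1 := congrFun ht m
        rw [hD, Matrix.mulVecLin_apply, ← Matrix.mulVec_mulVec] at h1
        rw [jetAt, snd_jet]
        simp only [Matrix.mulVec, dotProduct, Matrix.map_apply, hG, Matrix.of_apply,
          Pi.zero_apply] at h1 hv ⊢
        rw [← h1]
        exact Finset.sum_congr rfl fun u _ => mul_comm _ _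
    ext l
    rw [← hvc, hv0]
    rfl
  -- Equal cardinalities turn injectivity into surjectivity, and preimages of the unit vectors form
  -- a right inverse of the gradient matrix at `x`.
  have hDsurj : Function.Surjective D := by
    refine (LinearMap.injective_iff_surjective_of_finrank_eq_finrank ?_).1 hDinj
    rw [Module.finrank_fintype_fun_eq_card, Module.finrank_fintype_fun_eq_card, hcard]
  choose t ht using fun l : ι => hDsurj (Pi.single l 1)
  set Q : Matrix σ ι k :=
    (Matrix.of fun u l => if c l = u then (1 : k) else 0) * Matrix.of fun l m => t m l with hQ
  have hGQ : G.map (evalAt x) * Q = 1 := by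
    rw [hQ, ← Matrix.mul_assoc]
    ext m l
    have := congrFun (ht l) m
    rw [hD, Matrix.mulVecLin_apply, Pi.single_apply] at this
    rw [Matrix.one_apply, ← this]
    rfl
  set Q' : Matrix σ ι (localRing x) :=
    Q.map fun a => algebraMap (MvPolynomial σ k) (localRing x) (C a) with hQ'
  -- With the right inverse at `x` extended by constants, the product has value `1` at `x`, hence is
  -- invertible over the local ring.
  have hdet : IsUnit (G * Q').det := by
    refine isUnit_of_evalAt_ne_zero x ?_
    have h1 : Q'.map (evalAt x) = Q := by
      ext u l
      simp only [hQ', Matrix.map_apply, evalAt_algebraMap, eval_C]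
    rw [RingHom.map_det, RingHom.mapMatrix_apply, Matrix.map_mul, h1, hGQ, Matrix.det_one]
    exact one_ne_zero
  refine ⟨(Q' * (G * Q')⁻¹).map (localRing x).val, ?_⟩
  have h2 : (Matrix.of fun m u => pd (nonZeroDivisors (MvPolynomial σ k)) u (f m)) =
      G.map (localRing x).val := by
    ext m u
    exact pd_coe u (g m)
  rw [h2, ← Matrix.map_mul, ← Matrix.mul_assoc, Matrix.mul_nonsing_inv _ hdet,
    Matrix.map_one _ (map_zero _) (map_one _)]

end Gradients

/-! ### Logarithmic derivatives of dual numbers -/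

section LogJets

open TrivSqZeroExt

variable {k : Type*} [Field k]

/-- The dual number `z` is a unit with logarithmic derivative `δ`. -/
def IsDlog (z : DualNumber k) (δ : k) : Prop := fst z ≠ 0 ∧ snd z = δ * fst z

theorem isDlog_one : IsDlog (1 : DualNumber k) 0 := by simp [IsDlog]

theorem IsDlog.mul {z w : DualNumber k} {δ η : k} (hz : IsDlog z δ) (hw : IsDlog w η) :
    IsDlog (z * w) (δ + η) := by
  refine ⟨by rw [TrivSqZeroExt.fst_mul]; exact mul_ne_zero hz.1 hw.1, ?_⟩
  rw [DualNumber.snd_mul, TrivSqZeroExt.fst_mul, hz.2, hw.2]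
  ring

theorem IsDlog.inv {z : DualNumber k} {δ : k} (hz : IsDlog z δ) : IsDlog z⁻¹ (-δ) := by
  refine ⟨by rw [fst_inv]; exact inv_ne_zero hz.1, ?_⟩
  have h := hz.1
  rw [snd_inv, fst_inv, hz.2]
  simp only [smul_eq_mul, MulOpposite.smul_eq_mul_unop, MulOpposite.unop_op]
  field_simp

theorem IsDlog.prod {ι : Type*} {s : Finset ι} {z : ι → DualNumber k} {δ : ι → k}
    (h : ∀ i ∈ s, IsDlog (z i) (δ i)) : IsDlog (∏ i ∈ s, z i) (∑ i ∈ s, δ i) := by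
  classical
  induction s using Finset.induction_on with
  | empty => simpa using isDlog_one
  | insert a s ha ih =>
    rw [Finset.prod_insert ha, Finset.sum_insert ha]
    exact (h a (Finset.mem_insert_self a s)).mul
      (ih fun i hi => h i (Finset.mem_insert_of_mem hi))

theorem isDlog_inl {a : k} (ha : a ≠ 0) : IsDlog (inl a : DualNumber k) 0 := by
  simp [IsDlog, ha]

theorem isDlog_inl_add_inr {a : k} (ha : a ≠ 0) (b : k) :
    IsDlog (inl a + inr b : DualNumber k) (b / a) := by
  simp [IsDlog, ha]

theorem IsDlog.mul_inv_cancel {z : DualNumber k} {δ : k} (hz : IsDlog z δ) : z * z⁻¹ = 1 :=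
  TrivSqZeroExt.mul_inv_cancel hz.1

/-- If the coefficients of `∏ (1 + X yᵢ)` are constant to first order and the values of the `yᵢ`
are distinct, then the `yᵢ` are constant to first order. -/
theorem snd_eq_zero_of_snd_coeff_prod {ι : Type*} [Fintype ι] {y : ι → DualNumber k}
    (hinj : Function.Injective fun i => fst (y i)) (h0 : ∀ i, fst (y i) ≠ 0)
    (h : ∀ p, snd ((∏ i, (1 + Polynomial.X * Polynomial.C (y i))).coeff p) = 0) (i : ι) :
    snd (y i) = 0 := by
  classical
  -- At the constant point `-1 / yᵢ` only the factor `i` vanishes, so the derivative there is `snd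
  -- (y i)` times a nonzero quantity.
  have h1 : snd ((∏ i, (1 + Polynomial.X * Polynomial.C (y i))).eval
      (inl (-(fst (y i))⁻¹))) = 0 := by
    rw [Polynomial.eval_eq_sum_range, snd_sum]
    refine Finset.sum_eq_zero fun p _ => ?_
    rw [inl_pow, DualNumber.snd_mul, h, snd_inl]
    simp
  rw [Polynomial.eval_prod, ← Finset.mul_prod_erase _ _ (Finset.mem_univ i),
    DualNumber.snd_mul] at h1
  have h2 : fst (∏ l ∈ Finset.univ.erase i, (1 + Polynomial.X * Polynomial.C (y l) :
      Polynomial (DualNumber k)).eval (inl (-(fst (y i))⁻¹))) ≠ 0 := by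
    have h3 := map_prod (fstHom k k k) (fun l => (1 + Polynomial.X * Polynomial.C (y l) :
      Polynomial (DualNumber k)).eval (inl (-(fst (y i))⁻¹))) (Finset.univ.erase i)
    rw [fstHom_apply] at h3
    rw [h3, Finset.prod_ne_zero_iff]
    intro l hl
    have hne : fst (y l) ≠ fst (y i) := fun e => (Finset.mem_erase.1 hl).1 (hinj e)
    simp only [Polynomial.eval_add, Polynomial.eval_one, Polynomial.eval_mul, Polynomial.eval_X,
      Polynomial.eval_C, fstHom_apply, fst_add, fst_one, TrivSqZeroExt.fst_mul, fst_inl]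
    intro e
    apply hne
    have := h0 i
    field_simp at e
    linear_combination -e
  have h4 : (1 + Polynomial.X * Polynomial.C (y i) :
      Polynomial (DualNumber k)).eval (inl (-(fst (y i))⁻¹)) = inr (-(fst (y i))⁻¹ * snd (y i)) := by
    refine TrivSqZeroExt.ext ?_ ?_ <;> simp [h0 i, mul_comm]
  rw [h4, fst_inr, zero_mul, zero_add, snd_inr] at h1
  have h5 := (mul_eq_zero.1 h1).resolve_right h2
  exact (mul_eq_zero.1 h5).resolve_left (neg_ne_zero.2 (inv_ne_zero (h0 i)))

end LogJets

/-! ### Determinants, minors and pencils of antidiagonal matrices -/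

section AntidiagonalDet

variable {N : ℕ} {R : Type*} [CommRing R]

theorem antiMat_mul_antiMat (u w : Fin N → R) :
    antiMat u * antiMat w = Matrix.diagonal fun i => u i * w i.rev := by
  ext i a
  rw [Matrix.mul_apply, Matrix.diagonal_apply, Finset.sum_eq_single i.rev]
  · rw [antiMat_apply, antiMat_apply, if_pos rfl, Fin.rev_rev]
    by_cases h : i = a
    · rw [if_pos h, if_pos h.symm]
    · rw [if_neg h, if_neg (Ne.symm h), mul_zero]
  · intro l _ hl
    rw [antiMat_apply, if_neg hl, zero_mul]
  · simp

theorem antiMat_transpose (u : Fin N → R) : (antiMat u)ᵀ = antiMat fun i => u i.rev := by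
  ext i a
  rw [Matrix.transpose_apply, antiMat_apply, antiMat_apply]
  by_cases h : i = a.rev
  · subst h; simp
  · rw [if_neg h, if_neg]
    rintro rfl
    exact h (Fin.rev_rev i).symm

theorem antiMat_eq_diagonal_mul (u : Fin N → R) :
    antiMat u = Matrix.diagonal u * antiMat fun _ => 1 := by
  ext i a
  rw [Matrix.diagonal_mul, antiMat_apply, antiMat_apply, mul_ite, mul_one, mul_zero]

/-- The sign of the reversal permutation is kept as a constant determinant and never evaluated; it
suffices that the matrix is its own inverse. -/
theorem det_antiMat (u : Fin N → R) :
    (antiMat u).det = (∏ i, u i) * (antiMat fun _ : Fin N => (1 : R)).det := by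
  rw [antiMat_eq_diagonal_mul, Matrix.det_mul, Matrix.det_diagonal]

theorem antiMat_one_mul_self :
    (antiMat fun _ : Fin N => (1 : R)) * (antiMat fun _ : Fin N => (1 : R)) = 1 := by
  rw [antiMat_mul_antiMat]; simp

theorem upperRightMinor_antiMat (u : Fin N → R) (q : ℕ) (hq : q ≤ N) :
    upperRightMinor (antiMat u) q hq =
      (antiMat fun i : Fin q => u ⟨i, i.2.trans_le hq⟩).det := by
  rw [upperRightMinor]
  congr 1
  ext i a
  rw [Matrix.submatrix_apply, antiMat_apply, antiMat_apply]
  congr 1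
  rw [Fin.ext_iff, Fin.ext_iff, Fin.val_rev, Fin.val_rev, eq_iff_iff]
  have := i.2
  have := a.2
  simp only
  omega

theorem upperLeftMinor_diagonal (d : Fin N → R) (q : ℕ) (hq : q ≤ N) :
    upperLeftMinor (Matrix.diagonal d) q hq = ∏ i : Fin q, d ⟨i, i.2.trans_le hq⟩ := by
  rw [upperLeftMinor, Matrix.submatrix_diagonal, Matrix.det_diagonal]
  · rfl
  · intro a b h
    simpa [Fin.ext_iff] using h

theorem pencilDet_antiMat (b y : Fin N → R) :
    pencilDet (antiMat fun i => b i * y i) (antiMat b) =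
      Polynomial.C (antiMat b).det *
        ∏ i, (1 + Polynomial.X * Polynomial.C (y i)) := by
  have h1 : (Polynomial.X : Polynomial R) • (antiMat fun i => b i * y i).map Polynomial.C +
      (antiMat b).map Polynomial.C = antiMat fun i =>
        Polynomial.C (b i) * (1 + Polynomial.X * Polynomial.C (y i)) := by
    rw [antiMat_map, antiMat_map]
    ext i a : 1
    simp only [Matrix.add_apply, Matrix.smul_apply, antiMat_apply, smul_eq_mul]
    split_ifs
    · rw [Polynomial.C_mul]; ring
    · ring
  have h2 : (antiMat fun _ : Fin N => (1 : Polynomial R)).det =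
      Polynomial.C (antiMat fun _ : Fin N => (1 : R)).det := by
    rw [RingHom.map_det, RingHom.mapMatrix_apply, antiMat_map, Polynomial.C_1]
  rw [pencilDet, h1, det_antiMat, h2, Finset.prod_mul_distrib, det_antiMat b, Polynomial.C_mul,
    map_prod]
  ring

open TrivSqZeroExt in
theorem IsDlog.det_antiMat {k : Type*} [Field k] {u : Fin N → DualNumber k} {δ : Fin N → k}
    (h : ∀ i, IsDlog (u i) (δ i)) : IsDlog (antiMat u).det (∑ i, δ i) := by
  have h1 : IsDlog (antiMat fun _ : Fin N => (1 : DualNumber k)).det 0 := by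
    have h2 : (antiMat fun _ : Fin N => (1 : DualNumber k)).det =
        inl (antiMat fun _ : Fin N => (1 : k)).det := by
      change _ = inlHom k k _
      rw [RingHom.map_det, RingHom.mapMatrix_apply, antiMat_map, map_one]
    rw [h2]
    refine isDlog_inl fun e => ?_
    have := congrArg Matrix.det (antiMat_one_mul_self (N := N) (R := k))
    rw [Matrix.det_mul, e, mul_zero, Matrix.det_one] at this
    exact zero_ne_one this
  have h3 := (IsDlog.prod (s := Finset.univ) fun i _ => h i).mul h1
  rwa [add_zero, ← PoissonChain.det_antiMat] at h3

end AntidiagonalDet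

/-! ### Jets of the Casimirs at the base point -/

section BaseJets

open TrivSqZeroExt

variable {N j : ℕ}

/-- The coordinates of the base point. -/
noncomputable def baseCoord (N j : ℕ) (u : Coord N j) : ℂ := basePoint N j u.1 u.2.1 u.2.2

/-- Directions along the antidiagonal entries. -/
def IsAntidiagonal (v : Coord N j → ℂ) : Prop := ∀ s i a, a ≠ Fin.rev i → v (s, i, a) = 0

/-- The antidiagonal entries of the jets of the matrices of a chain at the base point. -/
noncomputable def jetEntry (v : Coord N j → ℂ) (s : Slot j) (i : Fin N) : DualNumber ℂ :=
  inl (baseEntry N j s i) + inr (v (s, i, i.rev))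

/-- The logarithmic derivatives of the antidiagonal entries at the base point. -/
noncomputable def entryDlog (v : Coord N j → ℂ) (s : Slot j) (i : Fin N) : ℂ :=
  v (s, i, i.rev) / baseEntry N j s i

variable {v : Coord N j → ℂ}

theorem isDlog_jetEntry (s : Slot j) (i : Fin N) :
    IsDlog (jetEntry v s i) (entryDlog v s i) :=
  isDlog_inl_add_inr (baseEntry_ne_zero s i) _

theorem fst_jetEntry (s : Slot j) (i : Fin N) : fst (jetEntry v s i) = baseEntry N j s i := by
  simp [jetEntry]

theorem matJet_genericChain (hv : IsAntidiagonal v) (s : Slot j) :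
    MatJet (baseCoord N j) v (genericChain N j s) (antiMat (jetEntry v s)) := by
  intro i a
  refine (hasJet_X (x := baseCoord N j) (v := v) (s, i, a)).of_eq ?_
  rw [baseCoord, basePoint, antiMat_apply, antiMat_apply]
  by_cases h : a = i.rev
  · rw [if_pos h, if_pos h, h]; rfl
  · rw [if_neg h, if_neg h, hv s i a h, inl_zero, inr_zero, add_zero]

/-- At the base point `f` is regular and nonzero, with logarithmic derivative `δ` along `v`. -/
def HasDlog (v : Coord N j → ℂ) (f : RatFun N j) (δ : ℂ) : Prop :=
  ∃ z, HasJet (baseCoord N j) v f z ∧ IsDlog z δ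

theorem HasDlog.mul {f g : RatFun N j} {δ η : ℂ} (hf : HasDlog v f δ) (hg : HasDlog v g η) :
    HasDlog v (f * g) (δ + η) := by
  obtain ⟨z, h1, h2⟩ := hf
  obtain ⟨w, h3, h4⟩ := hg
  exact ⟨_, h1.mul h3, h2.mul h4⟩

theorem HasDlog.div {f g : RatFun N j} {δ η : ℂ} (hf : HasDlog v f δ) (hg : HasDlog v g η) :
    HasDlog v (f / g) (δ - η) := by
  obtain ⟨z, h1, h2⟩ := hf
  obtain ⟨w, h3, h4⟩ := hg
  rw [div_eq_mul_inv, sub_eq_add_neg]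
  exact ⟨_, h1.mul (h3.inv h4.mul_inv_cancel), h2.mul h4.inv⟩

theorem HasDlog.prod {ι : Type*} {s : Finset ι} {f : ι → RatFun N j} {δ : ι → ℂ}
    (h : ∀ i ∈ s, HasDlog v (f i) (δ i)) : HasDlog v (∏ i ∈ s, f i) (∑ i ∈ s, δ i) := by
  classical
  induction s using Finset.induction_on with
  | empty => exact ⟨1, by simpa using HasJet.one, by simpa using isDlog_one⟩
  | insert a s ha ih =>
    rw [Finset.prod_insert ha, Finset.sum_insert ha]
    exact (h a (Finset.mem_insert_self a s)).mul
      (ih fun i hi => h i (Finset.mem_insert_of_mem hi))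

theorem HasDlog.eq_zero {f : RatFun N j} {δ : ℂ} (h : HasDlog v f δ)
    (h0 : ∀ z, HasJet (baseCoord N j) v f z → snd z = 0) : δ = 0 := by
  obtain ⟨z, h1, h2, h3⟩ := h
  rw [h0 z h1] at h3
  exact (mul_eq_zero.1 h3.symm).resolve_right h2

theorem HasDlog.mem {f : RatFun N j} {δ : ℂ} (h : HasDlog v f δ) :
    f ∈ localRing (baseCoord N j) := by
  obtain ⟨z, ⟨g, rfl, _⟩, _⟩ := h
  exact g.2

/-- The sum of the first `q` values. -/
def headSum (q : ℕ) (F : Fin N → ℂ) : ℂ := ∑ i : Fin N, if (i : ℕ) < q then F i else 0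

theorem headSum_succ (F : Fin N → ℂ) (i : Fin N) : headSum (i + 1) F = headSum i F + F i := by
  have h : F i = ∑ l : Fin N, if l = i then F l else 0 := by simp
  rw [headSum, headSum, h, ← Finset.sum_add_distrib]
  refine Finset.sum_congr rfl fun l _ => ?_
  rcases lt_trichotomy l i with h1 | rfl | h1
  · have := Fin.lt_def.1 h1
    rw [if_pos (by omega), if_pos this, if_neg h1.ne, add_zero]
  · simp
  · have := Fin.lt_def.1 h1
    rw [if_neg (by omega), if_neg (by omega), if_neg h1.ne', add_zero]

theorem hasDlog_det (hv : IsAntidiagonal v) (s : Slot j) :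
    HasDlog v (genericChain N j s).det (∑ i, entryDlog v s i) :=
  ⟨_, (matJet_genericChain hv s).det, IsDlog.det_antiMat fun i => isDlog_jetEntry s i⟩

theorem hasDlog_upperRightMinor {M : Matrix (Fin N) (Fin N) (RatFun N j)}
    {u : Fin N → DualNumber ℂ} {δ : Fin N → ℂ} (hM : MatJet (baseCoord N j) v M (antiMat u))
    (hu : ∀ i, IsDlog (u i) (δ i)) (q : ℕ) (hq : q ≤ N) :
    HasDlog v (upperRightMinor M q hq) (headSum q δ) := by
  refine ⟨upperRightMinor (antiMat u) q hq, ?_, ?_⟩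
  · exact MatJet.det fun i a => hM _ _
  · rw [upperRightMinor_antiMat, headSum, ← sum_castLE q hq]
    exact IsDlog.det_antiMat fun i => hu _

theorem hasDlog_upperLeftMinor {M : Matrix (Fin N) (Fin N) (RatFun N j)}
    {u : Fin N → DualNumber ℂ} {δ : Fin N → ℂ}
    (hM : MatJet (baseCoord N j) v M (Matrix.diagonal u))
    (hu : ∀ i, IsDlog (u i) (δ i)) (q : ℕ) (hq : q ≤ N) :
    HasDlog v (upperLeftMinor M q hq) (headSum q δ) := by
  refine ⟨upperLeftMinor (Matrix.diagonal u) q hq, ?_, ?_⟩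
  · exact MatJet.det fun i a => hM _ _
  · rw [upperLeftMinor_diagonal, headSum, ← sum_castLE q hq]
    exact IsDlog.prod fun i _ => hu _

theorem hasDlog_minor_matC (hv : IsAntidiagonal v) (n : Fin j) (q : ℕ) (hq : q ≤ N) :
    HasDlog v (upperRightMinor (matC N j n) q hq)
      (headSum q (entryDlog v (some (n, true)))) :=
  hasDlog_upperRightMinor (matJet_genericChain hv _) (fun i => isDlog_jetEntry _ i) q hq

theorem hasJet_pencilDet {A B : Matrix (Fin N) (Fin N) (RatFun N j)}
    {b c y : Fin N → DualNumber ℂ} (hA : MatJet (baseCoord N j) v A (antiMat c))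
    (hB : MatJet (baseCoord N j) v B (antiMat b)) (hb : ∀ i, fst (b i) ≠ 0)
    (hy : ∀ i, c i = b i * y i) (p : ℕ) :
    HasJet (baseCoord N j) v ((pencilDet A B).coeff p / B.det)
      ((∏ i, (1 + Polynomial.X * Polynomial.C (y i))).coeff p) := by
  obtain rfl : c = fun i => b i * y i := funext hy
  have h1 := hA.coeff_pencilDet hB p
  rw [pencilDet_antiMat, Polynomial.coeff_C_mul] at h1
  refine h1.div hB.det ?_
  have hb' : ∀ i, IsDlog (b i) (snd (b i) / fst (b i)) := fun i =>
    ⟨hb i, by rw [div_mul_cancel₀ _ (hb i)]⟩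
  exact (IsDlog.det_antiMat hb').1

theorem coeff_prod_eq_zero {R : Type*} [CommRing R] {p : ℕ} (y : Fin N → R) (hp : N < p) :
    (∏ i, (1 + Polynomial.X * Polynomial.C (y i))).coeff p = 0 := by
  refine Polynomial.coeff_eq_zero_of_natDegree_lt (lt_of_le_of_lt ?_ hp)
  refine (Polynomial.natDegree_prod_le _ _).trans ?_
  refine (Finset.sum_le_card_nsmul _ _ 1 fun i _ => ?_).trans (by simp)
  refine Polynomial.natDegree_add_le_of_degree_le (by simp) ?_
  refine Polynomial.natDegree_mul_le.trans ?_
  have := Polynomial.natDegree_X_le (R := R)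
  rw [Polynomial.natDegree_C]
  exact this

theorem coeff_prod_zero {R : Type*} [CommRing R] (y : Fin N → R) :
    (∏ i, (1 + Polynomial.X * Polynomial.C (y i))).coeff 0 = 1 := by
  rw [Polynomial.coeff_zero_eq_eval_zero, Polynomial.eval_prod]
  simp

/-- The ratios of the antidiagonal entries of `C` and `B`. -/
noncomputable def pairRatio (v : Coord N j → ℂ) (n : Fin j) (i : Fin N) : DualNumber ℂ :=
  jetEntry v (some (n, true)) i * (jetEntry v (some (n, false)) i)⁻¹

/-- The ratios of opposite antidiagonal entries of `𝔸`. -/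
noncomputable def headRatio (v : Coord N j → ℂ) (i : Fin N) : DualNumber ℂ :=
  jetEntry v none i * (jetEntry v none i.rev)⁻¹

theorem isDlog_pairRatio (n : Fin j) (i : Fin N) : IsDlog (pairRatio v n i)
    (entryDlog v (some (n, true)) i + -entryDlog v (some (n, false)) i) :=
  (isDlog_jetEntry _ i).mul (isDlog_jetEntry _ i).inv

theorem isDlog_headRatio (i : Fin N) : IsDlog (headRatio v i)
    (entryDlog v none i + -entryDlog v none i.rev) :=
  (isDlog_jetEntry _ i).mul (isDlog_jetEntry _ _).inv

theorem hasJet_casimirZ (hv : IsAntidiagonal v) (n : Fin j) (p : Fin N) :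
    HasJet (baseCoord N j) v (casimirZ N j n p)
      ((∏ i, (1 + Polynomial.X * Polynomial.C (pairRatio v n i))).coeff (p + 1)) := by
  refine hasJet_pencilDet (matJet_genericChain hv _) (matJet_genericChain hv _)
    (fun i => (isDlog_jetEntry _ i).1) (fun i => ?_) _
  rw [pairRatio, mul_left_comm, (isDlog_jetEntry _ i).mul_inv_cancel, mul_one]

theorem matJet_transpose_genericChain (hv : IsAntidiagonal v) (s : Slot j) :
    MatJet (baseCoord N j) v (genericChain N j s)ᵀ (antiMat fun i => jetEntry v s i.rev) := by
  rw [← antiMat_transpose]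
  exact (matJet_genericChain hv s).transpose

theorem hasJet_casimirY (hv : IsAntidiagonal v) (p : Fin (N / 2)) :
    HasJet (baseCoord N j) v (casimirY N j p)
      ((∏ i, (1 + Polynomial.X * Polynomial.C (headRatio v i))).coeff (p + 1) *
        inl (if 2 * ((p : ℕ) + 1) = N then 2⁻¹ else 1)) := by
  refine HasJet.mul ?_ ?_
  · have h := hasJet_pencilDet (y := headRatio v) (matJet_genericChain hv none)
      (matJet_transpose_genericChain hv none) (fun i => (isDlog_jetEntry _ _).1)
      (fun i => by
        rw [headRatio, mul_left_comm, (isDlog_jetEntry _ _).mul_inv_cancel, mul_one]) (p + 1)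
    rwa [Matrix.det_transpose] at h
  · split_ifs
    · have h := HasJet.natCast (x := baseCoord N j) (v := v) 2
      refine h.inv ?_
      rw [← inl_mul]
      norm_num
    · simpa using HasJet.one

/-- The `Z` are the elementary symmetric functions of the ratios of the entries of `C` and `B`;
these ratios have the distinct values `i + 1`, so each of them is stationary. -/
theorem entryDlog_pair_eq (hv : IsAntidiagonal v) (n : Fin j)
    (h : ∀ p z, HasJet (baseCoord N j) v (casimirZ N j n p) z → snd z = 0) (i : Fin N) :
    entryDlog v (some (n, true)) i = entryDlog v (some (n, false)) i := by
  have hfst : ∀ i, fst (pairRatio v n i) = (i : ℕ) + 1 := fun i => by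
    simp [pairRatio, fst_jetEntry, baseEntry]
  have h1 := snd_eq_zero_of_snd_coeff_prod (y := pairRatio v n) (fun a b hab => by
      simp only [hfst] at hab
      exact Fin.ext (Nat.cast_injective (add_right_cancel hab)))
    (fun i => (isDlog_pairRatio n i).1) (fun p => by
      rcases p with _ | p
      · rw [coeff_prod_zero]; simp
      · by_cases hp : p < N
        · exact h ⟨p, hp⟩ _ (hasJet_casimirZ hv n ⟨p, hp⟩)
        · rw [coeff_prod_eq_zero _ (by omega)]; simp) i
  have h2 := (isDlog_pairRatio (v := v) n i).2
  rw [h1] at h2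
  have h3 := (mul_eq_zero.1 h2.symm).resolve_right (isDlog_pairRatio n i).1
  linear_combination h3

/-- Only half of the coefficients occur among the `Y`; the palindromic symmetry supplies the others.
-/
theorem coeff_headRatio_symm {p : ℕ} (hp : p ≤ N) :
    (∏ i, (1 + Polynomial.X * Polynomial.C (headRatio v i))).coeff (N - p) =
      (∏ i, (1 + Polynomial.X * Polynomial.C (headRatio v i))).coeff p := by
  have h := coeff_pencilDet_transpose (antiMat (jetEntry v none)) hp
  have h1 : jetEntry v none = fun i : Fin N => jetEntry v none i.rev * headRatio v i := by
    ext i : 1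
    rw [headRatio, mul_left_comm, (isDlog_jetEntry _ _).mul_inv_cancel, mul_one]
  have h2 : pencilDet (antiMat (jetEntry v none)) (antiMat (jetEntry v none))ᵀ =
      pencilDet (antiMat fun i : Fin N => jetEntry v none i.rev * headRatio v i)
        (antiMat fun i => jetEntry v none i.rev) := by
    rw [antiMat_transpose, ← h1]
  rw [h2, pencilDet_antiMat, Polynomial.coeff_C_mul, Polynomial.coeff_C_mul] at h
  have h3 := IsDlog.det_antiMat fun i : Fin N => isDlog_jetEntry (v := v) none i.rev
  exact (IsUnit.of_mul_eq_one _ h3.mul_inv_cancel).mul_left_cancel h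

/-- The same argument for the ratios of opposite entries of `𝔸`, which are distinct powers of two.
-/
theorem entryDlog_head_eq (hv : IsAntidiagonal v)
    (h : ∀ p z, HasJet (baseCoord N j) v (casimirY N j p) z → snd z = 0) (i : Fin N) :
    entryDlog v none i = entryDlog v none i.rev := by
  have hfst : ∀ i, fst (headRatio v i) = 2 ^ (i : ℕ) * (2 ^ (i.rev : ℕ))⁻¹ := fun i => by
    simp [headRatio, fst_jetEntry, baseEntry]
  have hlow : ∀ p, p ≤ N / 2 →
      snd ((∏ i, (1 + Polynomial.X * Polynomial.C (headRatio v i))).coeff p) = 0 := by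
    intro p hp
    rcases p with _ | p
    · rw [coeff_prod_zero]; simp
    · have h1 := h ⟨p, by omega⟩ _ (hasJet_casimirY hv ⟨p, by omega⟩)
      rw [DualNumber.snd_mul, snd_inl, mul_zero, zero_add, fst_inl] at h1
      refine (mul_eq_zero.1 h1).resolve_right ?_
      split_ifs <;> norm_num
  have h1 := snd_eq_zero_of_snd_coeff_prod (y := headRatio v) (fun a b hab => by
      by_contra hne
      simp only [hfst] at hab
      have h2 : (2 : ℂ) ^ (a : ℕ) * 2 ^ (b.rev : ℕ) - 2 ^ (b : ℕ) * 2 ^ (a.rev : ℕ) = 0 := by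
        have ha : (2 : ℂ) ^ (a.rev : ℕ) ≠ 0 := pow_ne_zero _ two_ne_zero
        have hb : (2 : ℂ) ^ (b.rev : ℕ) ≠ 0 := pow_ne_zero _ two_ne_zero
        field_simp at hab
        linear_combination hab
      refine two_pow_mul_two_pow_ne ?_ h2
      have : (a : ℕ) ≠ b := fun e => hne (Fin.ext e)
      simp only [Fin.val_rev]
      omega)
    (fun i => (isDlog_headRatio i).1) (fun p => by
      by_cases hp : p ≤ N / 2
      · exact hlow p hp
      by_cases hp' : p ≤ N
      · rw [← coeff_headRatio_symm hp']
        exact hlow _ (by omega)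
      · rw [coeff_prod_eq_zero _ (by omega)]; simp) i
  have h2 := (isDlog_headRatio (v := v) i).2
  rw [h1] at h2
  have h3 := (mul_eq_zero.1 h2.symm).resolve_right (isDlog_headRatio i).1
  linear_combination h3

end BaseJets

/-! ### The Casimirs separate the chosen directions -/

section Separation

open TrivSqZeroExt

variable {N j : ℕ} {v : Coord N j → ℂ}

theorem val_le_of_half (p : Fin ((N + 1) / 2)) : (p : ℕ) ≤ N := by
  have := p.2
  omega

theorem val_succ_le_of_half (p : Fin (N / 2)) : (p : ℕ) + 1 ≤ N := by
  have := p.2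
  omega

theorem jetEntry_of_eq_zero {n : Fin j} (h : ∀ i, v (some (n, false), i, i.rev) = 0) :
    jetEntry v (some (n, false)) = fun _ => 1 := by
  ext i : 1
  rw [jetEntry, h]
  simp [baseEntry]

/-- The antidiagonal matrix of ones is its own inverse and its own transpose, so both kinds of
factors of `S` have the same jet. -/
theorem matJet_factor_of_eq_zero (hv : IsAntidiagonal v) {n : Fin j}
    (h : ∀ i, v (some (n, false), i, i.rev) = 0) (P : Prop) [Decidable P] :
    MatJet (baseCoord N j) v (if P then (matB N j n)⁻¹ else (matB N j n)ᵀ)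
      (antiMat fun _ => 1) := by
  have h1 := matJet_genericChain hv (some (n, false))
  rw [jetEntry_of_eq_zero h] at h1
  split_ifs
  · exact h1.inv antiMat_one_mul_self
  · have h2 := h1.transpose
    rwa [antiMat_transpose] at h2

theorem prod_ofFn_antiMat_one {R : Type*} [CommRing R] {l : ℕ} (hl : Even l) :
    (List.ofFn fun _ : Fin l => (antiMat fun _ : Fin N => (1 : R))).prod = 1 := by
  obtain ⟨m, rfl⟩ := hl
  rw [List.ofFn_const, List.prod_replicate, ← two_mul, pow_mul, pow_two, antiMat_one_mul_self,
    one_pow]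

theorem matJet_matS_even (hj : Even j) (hv : IsAntidiagonal v)
    (hB : ∀ n i, v (some (n, false), i, i.rev) = 0) :
    MatJet (baseCoord N j) v (matS N j) (antiMat fun i => jetEntry v none i.rev) := by
  have h := (matJet_transpose_genericChain hv none).mul
    (MatJet.prod_ofFn fun n : Fin j => matJet_factor_of_eq_zero hv (hB n) (Even (n : ℕ)))
  rw [prod_ofFn_antiMat_one hj, mul_one] at h
  exact h

/-- An even number of factors remains after the first `B`, and these cancel. The product of two
antidiagonal matrices left over is diagonal, in accordance with the upper left minors used for odd
`j`. -/
theorem matJet_matS_odd {r : ℕ} {v : Coord N (2 * r + 1) → ℂ} (hv : IsAntidiagonal v)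
    (hB : ∀ n : Fin (2 * r + 1), n ≠ 0 → ∀ i, v (some (n, false), i, i.rev) = 0) :
    MatJet (baseCoord N (2 * r + 1)) v (matS N (2 * r + 1))
      (Matrix.diagonal fun i => jetEntry v none i.rev * (jetEntry v (some (0, false)) i)⁻¹) := by
  have h0 : MatJet (baseCoord N (2 * r + 1)) v (matB N (2 * r + 1) 0)⁻¹
      (antiMat fun i => (jetEntry v (some (0, false)) i.rev)⁻¹) := by
    refine (matJet_genericChain hv (some (0, false))).inv ?_
    rw [antiMat_mul_antiMat, ← Matrix.diagonal_one]
    congr 1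
    ext i : 1
    rw [Fin.rev_rev, (isDlog_jetEntry _ i).mul_inv_cancel]
  have h := (matJet_transpose_genericChain hv none).mul (h0.mul
    (MatJet.prod_ofFn fun n : Fin (2 * r) => matJet_factor_of_eq_zero hv
      (hB n.succ (Fin.succ_ne_zero n)) (Even ((n.succ : Fin (2 * r + 1)) : ℕ))))
  rw [prod_ofFn_antiMat_one (even_two_mul r), mul_one, antiMat_mul_antiMat] at h
  simp only [Fin.rev_rev] at h
  rw [matS, List.ofFn_succ, List.prod_cons]
  simpa [matA] using h

theorem hasDlog_casimirXEven (hj : Even j) (hv : IsAntidiagonal v)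
    (hB : ∀ n i, v (some (n, false), i, i.rev) = 0) (p : ℕ) (hp : p ≤ N) :
    HasDlog v (casimirXEven N j p hp)
      (headSum p (fun i => entryDlog v none i.rev) +
          ∑ n, headSum p (entryDlog v (some (n, true))) -
        (headSum (N - p) (fun i => entryDlog v none i.rev) +
          ∑ n, headSum (N - p) (entryDlog v (some (n, true))))) := by
  have hS : ∀ q (hq : q ≤ N), HasDlog v (upperRightMinor (matS N j) q hq)
      (headSum q fun i => entryDlog v none i.rev) := fun q hq =>
    hasDlog_upperRightMinor (matJet_matS_even hj hv hB) (fun i => isDlog_jetEntry _ _) q hq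
  exact ((hS p hp).mul (HasDlog.prod fun n _ => hasDlog_minor_matC hv n p hp)).div
    ((hS _ _).mul (HasDlog.prod fun n _ => hasDlog_minor_matC hv n _ _))

theorem headSum_zero (q : ℕ) : headSum q (fun _ : Fin N => 0) = 0 := by simp [headSum]

theorem eq_zero_of_entryDlog (hv : IsAntidiagonal v) (h : ∀ s i, entryDlog v s i = 0) : v = 0 := by
  ext ⟨s, i, a⟩
  by_cases ha : a = i.rev
  · subst ha
    have := h s i
    rw [entryDlog, div_eq_zero_iff] at this
    exact this.resolve_right (baseEntry_ne_zero s i)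
  · exact hv s i a ha

theorem entryDlog_eq_zero {s : Slot j} {i : Fin N} (h : v (s, i, i.rev) = 0) :
    entryDlog v s i = 0 := by rw [entryDlog, h, zero_div]

/-- Symmetry of the partial sums under `p ↦ N - p` makes consecutive differences odd under reversal,
whereas `F` is even. -/
theorem eq_zero_of_symm_headSum {F : Fin N → ℂ} (hF : ∀ i, F i = F i.rev)
    (h : ∀ p, p < (N + 1) / 2 → headSum p F = headSum (N - p) F) (i : Fin N) : F i = 0 := by
  have h' : ∀ p, p ≤ N → headSum p F = headSum (N - p) F := by
    intro p hp
    by_cases h1 : p < (N + 1) / 2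
    · exact h p h1
    by_cases h2 : N - p < (N + 1) / 2
    · have := h _ h2
      rw [Nat.sub_sub_self hp] at this
      exact this.symm
    · congr 1; omega
  have h1 := headSum_succ F i
  have h2 := headSum_succ F i.rev
  rw [h' _ i.2.le, h' _ i.2] at h1
  have hi := i.2
  have e1 : N - (i : ℕ) = i.rev + 1 := by rw [Fin.val_rev]; omega
  have e2 : N - ((i : ℕ) + 1) = i.rev := by rw [Fin.val_rev]
  rw [e1, e2] at h1
  rw [← hF] at h2
  linear_combination (-h1 - h2) / 2

/-- With the `B`'s fixed, `Z` fixes the `C`'s, `Y` makes the variation of `𝔸` symmetric under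
reversal, and `X` then makes it vanish. -/
theorem eq_zero_of_casimirs_even (hj : Even j) (hv : IsAntidiagonal v)
    (hB : ∀ n i, v (some (n, false), i, i.rev) = 0)
    (hY : ∀ p z, HasJet (baseCoord N j) v (casimirY N j p) z → snd z = 0)
    (hZ : ∀ n p z, HasJet (baseCoord N j) v (casimirZ N j n p) z → snd z = 0)
    (hX : ∀ (p : Fin ((N + 1) / 2)) z,
      HasJet (baseCoord N j) v (casimirXEven N j p (val_le_of_half p)) z → snd z = 0) : v = 0 := by
  have hb : ∀ n i, entryDlog v (some (n, false)) i = 0 := fun n i => entryDlog_eq_zero (hB n i)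
  have hc : ∀ n i, entryDlog v (some (n, true)) i = 0 := fun n i => by
    rw [entryDlog_pair_eq hv n (hZ n) i, hb]
  have ha := entryDlog_head_eq hv hY
  have hc' : ∀ n, entryDlog v (some (n, true)) = fun _ : Fin N => 0 := fun n => funext (hc n)
  refine eq_zero_of_entryDlog hv fun s i => ?_
  rcases s with _ | ⟨n, _ | _⟩
  · refine eq_zero_of_symm_headSum ha (fun p hp => ?_) i
    have h := (hasDlog_casimirXEven hj hv hB p (by omega)).eq_zero (hX ⟨p, hp⟩)
    simp only [← ha, hc', headSum_zero, Finset.sum_const_zero, add_zero] at h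
    exact sub_eq_zero.1 h
  · exact hb n i
  · exact hc n i

theorem hasDlog_casimirXOdd {p : ℕ} (hp : p ≤ N) (hv : IsAntidiagonal v) {σ : Fin N → ℂ}
    (hS : ∀ q (hq : q ≤ N), HasDlog v (upperLeftMinor (matS N j) q hq) (headSum q σ)) :
    HasDlog v (casimirXOdd N j p hp)
      (headSum p σ + headSum (N - p) σ +
          ∑ n ∈ evenPairs j, (headSum p (entryDlog v (some (n, true))) +
            headSum (N - p) (entryDlog v (some (n, true)))) -
        ∑ n ∈ oddPairs j, (headSum p (entryDlog v (some (n, true))) +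
            headSum (N - p) (entryDlog v (some (n, true)))) +
        (∑ n ∈ oddPairs j, (∑ i, entryDlog v (some (n, false)) i +
            ∑ i, entryDlog v (some (n, true)) i) -
          (∑ i, entryDlog v none i +
            ∑ n ∈ evenPairs j, (∑ i, entryDlog v (some (n, false)) i +
              ∑ i, entryDlog v (some (n, true)) i)))) := by
  have hC : ∀ n, HasDlog v (upperRightMinor (matC N j n) p hp *
      upperRightMinor (matC N j n) (N - p) (N.sub_le p))
      (headSum p (entryDlog v (some (n, true))) +
        headSum (N - p) (entryDlog v (some (n, true)))) := fun n =>
    (hasDlog_minor_matC hv n _ _).mul (hasDlog_minor_matC hv n _ _)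
  have hdet : ∀ n, HasDlog v ((matB N j n).det * (matC N j n).det)
      (∑ i, entryDlog v (some (n, false)) i + ∑ i, entryDlog v (some (n, true)) i) := fun n =>
    (hasDlog_det hv _).mul (hasDlog_det hv _)
  exact ((((hS _ _).mul (hS _ _)).mul (HasDlog.prod fun n _ => hC n)).div
    (HasDlog.prod fun n _ => hC n)).mul ((HasDlog.prod fun n _ => hdet n).div
      ((hasDlog_det hv none).mul (HasDlog.prod fun n _ => hdet n)))

theorem sum_oddPairs_eq {r : ℕ} {F : Fin (2 * r + 1) → ℂ} (hF : ∀ n, n ≠ 0 → F n = 0) :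
    ∑ n ∈ oddPairs (2 * r + 1), F n = F 0 :=
  Finset.sum_eq_single 0 (fun n _ hn => hF n hn) fun h => absurd ((mem_oddPairs 0).2 (by simp)) h

theorem sum_evenPairs_eq_zero {r : ℕ} {F : Fin (2 * r + 1) → ℂ} (hF : ∀ n, n ≠ 0 → F n = 0) :
    ∑ n ∈ evenPairs (2 * r + 1), F n = 0 :=
  Finset.sum_eq_zero fun n hn => hF n (by
    rintro rfl
    simpa using (mem_evenPairs _).1 hn)

theorem hasDlog_matS_odd {r : ℕ} {v : Coord N (2 * r + 1) → ℂ} (hv : IsAntidiagonal v)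
    (hB : ∀ n : Fin (2 * r + 1), n ≠ 0 → ∀ i, v (some (n, false), i, i.rev) = 0)
    (q : ℕ) (hq : q ≤ N) :
    HasDlog v (upperLeftMinor (matS N (2 * r + 1)) q hq)
      (headSum q fun i => entryDlog v none i.rev + -entryDlog v (some (0, false)) i) :=
  hasDlog_upperLeftMinor (matJet_matS_odd hv hB)
    (fun i => (isDlog_jetEntry _ _).mul (isDlog_jetEntry _ _).inv) q hq

/-- Only the first halves of `𝔸` and of the first `B` are free besides the `C`'s. The symmetry from
`Y` fixes `𝔸`, `Z` ties each `C` to its `B`, and `X` reads off the partial sums of the variation `β`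
of the first `B`. -/
theorem eq_zero_of_casimirs_odd {r : ℕ} {v : Coord N (2 * r + 1) → ℂ} (hv : IsAntidiagonal v)
    (hA : ∀ i : Fin N, N / 2 ≤ (i : ℕ) → v (none, i, i.rev) = 0)
    (hB : ∀ n : Fin (2 * r + 1), n ≠ 0 → ∀ i, v (some (n, false), i, i.rev) = 0)
    (hB0 : ∀ i : Fin N, N / 2 ≤ (i : ℕ) → v (some (0, false), i, i.rev) = 0)
    (hY : ∀ p z, HasJet (baseCoord N (2 * r + 1)) v (casimirY N (2 * r + 1) p) z → snd z = 0)
    (hZ : ∀ n p z, HasJet (baseCoord N (2 * r + 1)) v (casimirZ N (2 * r + 1) n p) z → snd z = 0)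
    (hX : ∀ (p : Fin (N / 2)) z,
      HasJet (baseCoord N (2 * r + 1)) v (casimirXOdd N (2 * r + 1) (p + 1) (val_succ_le_of_half p)) z →
        snd z = 0) : v = 0 := by
  have hc : ∀ n, entryDlog v (some (n, true)) = entryDlog v (some (n, false)) := fun n =>
    funext (entryDlog_pair_eq hv n (hZ n))
  have hb : ∀ n, n ≠ 0 → entryDlog v (some (n, false)) = fun _ : Fin N => 0 := fun n hn =>
    funext fun i => entryDlog_eq_zero (hB n hn i)
  have ha : ∀ i, entryDlog v none i = 0 := fun i => by
    by_cases hi : N / 2 ≤ (i : ℕ)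
    · exact entryDlog_eq_zero (hA i hi)
    · rw [entryDlog_head_eq hv hY]
      exact entryDlog_eq_zero (hA _ (by rw [Fin.val_rev]; omega))
  set β : Fin N → ℂ := entryDlog v (some (0, false)) with hβ
  have hβ0 : ∀ i : Fin N, N / 2 ≤ (i : ℕ) → β i = 0 := fun i hi => entryDlog_eq_zero (hB0 i hi)
  have hneg : ∀ q, headSum q (fun i => -β i) = -headSum q β := fun q => by
    rw [headSum, headSum, ← Finset.sum_neg_distrib]
    exact Finset.sum_congr rfl fun i _ => by split_ifs <;> simp
  have hhigh : ∀ q, N / 2 ≤ q → headSum q β = ∑ i, β i := fun q hq => by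
    refine Finset.sum_congr rfl fun i _ => ?_
    split_ifs with h
    · rfl
    · exact (hβ0 i (by omega)).symm
  have hsum : ∀ p, p ≤ N / 2 → headSum p β = 0 := by
    intro p hp
    rcases p with _ | p
    · simp [headSum]
    · have h := (hasDlog_casimirXOdd (p := p + 1) (by omega) hv
        (hasDlog_matS_odd hv hB)).eq_zero (hX ⟨p, hp⟩)
      have hF1 : ∀ n : Fin (2 * r + 1), n ≠ 0 →
          headSum (p + 1) (entryDlog v (some (n, true))) +
            headSum (N - (p + 1)) (entryDlog v (some (n, true))) = 0 := fun n hn => by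
        rw [hc, hb n hn, headSum_zero, headSum_zero, add_zero]
      have hF2 : ∀ n : Fin (2 * r + 1), n ≠ 0 →
          ∑ i, entryDlog v (some (n, false)) i + ∑ i, entryDlog v (some (n, true)) i = 0 :=
        fun n hn => by
          rw [hc, hb n hn, Finset.sum_const_zero, add_zero]
      rw [sum_oddPairs_eq hF1, sum_evenPairs_eq_zero hF1, sum_oddPairs_eq hF2,
        sum_evenPairs_eq_zero hF2] at h
      simp only [ha, hc, zero_add, Finset.sum_const_zero, ← hβ, hneg] at h
      -- As `β` vanishes on the second half, the minors of size `N - (p + 1)` see the full sum of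
      -- `β`, which the determinants cancel; what remains is `-2` times the partial sum.
      rw [hhigh (N - (p + 1)) (by omega)] at h
      linear_combination -h / 2
  have hβz : ∀ i, β i = 0 := fun i => by
    by_cases hi : N / 2 ≤ (i : ℕ)
    · exact hβ0 i hi
    · have h := headSum_succ β i
      rw [hsum _ (by omega), hsum _ (by omega), zero_add] at h
      exact h.symm
  refine eq_zero_of_entryDlog hv fun s i => ?_
  have hbz : ∀ n : Fin (2 * r + 1), entryDlog v (some (n, false)) i = 0 := fun n => by
    by_cases hn : n = 0
    · subst hn; exact hβz i
    · rw [hb n hn]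
  rcases s with _ | ⟨n, _ | _⟩
  · exact ha i
  · exact hbz n
  · rw [hc]; exact hbz n

end Separation

/-! ### The Jacobian criterion -/

section AlgebraicIndependence

open TrivSqZeroExt MvPolynomial

variable {k σ ι : Type*} [Field k] [Fintype σ] [DecidableEq σ] [Fintype ι]

omit [Fintype σ] in
theorem pd_aeval (F : ι → FractionRing (MvPolynomial σ k)) (u : σ) (p : MvPolynomial ι k) :
    pd (nonZeroDivisors (MvPolynomial σ k)) u (aeval F p) =
      ∑ m, aeval F (pderiv m p) * pd (nonZeroDivisors (MvPolynomial σ k)) u (F m) := by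
  classical
  induction p using MvPolynomial.induction_on with
  | C a =>
    have h : aeval F (C a) =
        algebraMap (MvPolynomial σ k) (FractionRing (MvPolynomial σ k)) (C a) := by
      rw [aeval_C, IsScalarTower.algebraMap_apply k (MvPolynomial σ k)
        (FractionRing (MvPolynomial σ k)), algebraMap_eq]
    rw [h, pd, jet_algebraMap, jetPoly_C]
    simp
  | add p q hp hq =>
    simp only [map_add, add_mul, Finset.sum_add_distrib, ← hp, ← hq]
    simp [pd]
  | mul_X p m hp =>
    have h1 : pd (nonZeroDivisors (MvPolynomial σ k)) u (aeval F (p * X m)) =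
        aeval F p * pd (nonZeroDivisors (MvPolynomial σ k)) u (F m) +
          pd (nonZeroDivisors (MvPolynomial σ k)) u (aeval F p) * F m := by
      rw [map_mul, aeval_X]
      simp only [pd, map_mul, DualNumber.snd_mul, fst_jet, RingHom.id_apply]
    rw [h1, hp, Finset.sum_mul]
    simp only [pderiv_mul, map_add, map_mul, aeval_X, add_mul, Finset.sum_add_distrib]
    rw [add_comm]
    congr 1
    · exact Finset.sum_congr rfl fun l _ => by ring
    · rw [Finset.sum_eq_single m]
      · simp
      · intro l _ hl
        rw [pderiv_X_of_ne (Ne.symm hl), map_zero, mul_zero, zero_mul]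
      · simp

/-- Differentiating a relation `p(F) = 0` and using independence of the gradients shows that all
partial derivatives of `p` are relations too. Descending in the degree they vanish, so in
characteristic zero `p` is constant, hence zero. -/
theorem algebraicIndependent_of_gradient [DecidableEq ι] [CharZero k]
    {F : ι → FractionRing (MvPolynomial σ k)} {P : Matrix σ ι (FractionRing (MvPolynomial σ k))}
    (h : (Matrix.of fun m u => pd (nonZeroDivisors (MvPolynomial σ k)) u (F m)) * P = 1) :
    AlgebraicIndependent k F := by
  rw [algebraicIndependent_iff]
  have hder : ∀ p : MvPolynomial ι k, aeval F p = 0 → ∀ m, aeval F (pderiv m p) = 0 := by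
    intro p hp
    have h1 : Matrix.vecMul (fun m => aeval F (pderiv m p))
        (Matrix.of fun m u => pd (nonZeroDivisors (MvPolynomial σ k)) u (F m)) = 0 := by
      ext u
      have h2 := pd_aeval F u p
      rw [hp] at h2
      rw [Matrix.vecMul, dotProduct, Pi.zero_apply]
      refine h2.symm.trans ?_
      simp [pd]
    have h3 := congrArg (fun y => Matrix.vecMul y P) h1
    simp only [Matrix.vecMul_vecMul, h, Matrix.vecMul_one, Matrix.zero_vecMul] at h3
    exact fun m => congrFun h3 m
  -- The strict bound on the degrees of monomials makes `n = 0` mean `p = 0`, which starts the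
  -- induction.
  suffices H : ∀ (n : ℕ) (p : MvPolynomial ι k), aeval F p = 0 →
      (∀ s, coeff s p ≠ 0 → s.degree < n) → p = 0 by
    intro p hp
    refine H (p.totalDegree + 1) p hp fun s hs => Nat.lt_succ_of_le ?_
    exact le_totalDegree (mem_support_iff.2 hs)
  intro n
  induction n with
  | zero =>
    intro p _ hs
    ext s
    by_contra hne
    exact absurd (hs s hne) (Nat.not_lt_zero _)
  | succ n ih =>
    intro p hp hs
    have h1 : ∀ m, pderiv m p = 0 := fun m => by
      refine ih _ (hder p hp m) fun s hsm => ?_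
      rw [coeff_pderiv] at hsm
      have := hs _ (left_ne_zero_of_mul hsm)
      rw [map_add, Finsupp.degree_single] at this
      omega
    have h2 : p = C (coeff 0 p) := by
      ext s
      rw [coeff_C]
      split_ifs with h0
      · rw [h0]
      · obtain ⟨m, hm⟩ : ∃ m, s m ≠ 0 := by
          by_contra hc
          push Not at hc
          exact h0 (Finsupp.ext fun m => (hc m).symm)
        have h3 := coeff_pderiv (i := m) p (s - Finsupp.single m 1)
        rw [h1, coeff_zero, Finsupp.sub_add_single_one_cancel hm] at h3
        exact (mul_eq_zero.1 h3.symm).resolve_right (Nat.cast_add_one_ne_zero _)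
    rw [h2, aeval_C, map_eq_zero] at hp
    rw [h2, hp, C_0]

end AlgebraicIndependence

/-! ### Generic rank and the upper bound for the leaves -/

section Rank

variable {N j : ℕ}

/-- A rank certificate that survives specialisation: a section of the map onto its range, and a
retraction onto the range written in a basis. -/
theorem exists_mul_mul_eq_one {k m n : Type*} [Field k] [Fintype m] [Fintype n] [DecidableEq m]
    [DecidableEq n] (A : Matrix m n k) :
    ∃ (P : Matrix (Fin A.rank) m k) (Q : Matrix n (Fin A.rank) k), P * A * Q = 1 := by
  set S := LinearMap.range A.mulVecLin
  obtain ⟨g, hg⟩ := LinearMap.exists_leftInverse_of_injective S.subtype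
    (LinearMap.ker_eq_bot.2 S.injective_subtype)
  obtain ⟨h, hh⟩ := LinearMap.exists_rightInverse_of_surjective A.mulVecLin.rangeRestrict
    (LinearMap.range_eq_top.2 A.mulVecLin.surjective_rangeRestrict)
  let e : S ≃ₗ[k] (Fin A.rank → k) := (Module.finBasis k S).equivFun
  refine ⟨LinearMap.toMatrix' (e.toLinearMap ∘ₗ g), LinearMap.toMatrix' (h ∘ₗ e.symm.toLinearMap),
    ?_⟩
  have hA : LinearMap.toMatrix' A.mulVecLin = A := LinearMap.toMatrix'_toLin' A
  refine (congrArg (fun B => LinearMap.toMatrix' (e.toLinearMap ∘ₗ g) * B *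
    LinearMap.toMatrix' (h ∘ₗ e.symm.toLinearMap)) hA).symm.trans ?_
  rw [← LinearMap.toMatrix'_comp, ← LinearMap.toMatrix'_comp, ← LinearMap.toMatrix'_id]
  congr 1
  refine LinearMap.ext fun y => ?_
  have h1 : A.mulVecLin (h (e.symm y)) = S.subtype (e.symm y) :=
    congrArg Subtype.val (LinearMap.congr_fun hh (e.symm y))
  have h2 : g (S.subtype (e.symm y)) = e.symm y := LinearMap.congr_fun hg (e.symm y)
  simp only [LinearMap.comp_apply, LinearEquiv.coe_coe, LinearMap.id_apply]
  rw [h1, h2, LinearEquiv.apply_symm_apply]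

/-- Semicontinuity of the rank: the certificate at `x` gives a polynomial determinant with value `1`
at `x`, which is therefore nonzero as a rational function. -/
theorem leafDim_le_rank (x : Slot j → Matrix (Fin N) (Fin N) ℂ) :
    leafDim x ≤ (poissonTensor (genericChain N j)).rank := by
  obtain ⟨P, Q, hPQ⟩ := exists_mul_mul_eq_one (poissonTensor x)
  set X : Slot j → Matrix (Fin N) (Fin N) (PolyFun N j) :=
    fun s => Matrix.of fun i a => MvPolynomial.X (s, i, a) with hX
  set P' := P.map (MvPolynomial.C : ℂ →+* PolyFun N j)
  set Q' := Q.map (MvPolynomial.C : ℂ →+* PolyFun N j)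
  set ev : PolyFun N j →+* ℂ := MvPolynomial.eval fun u => x u.1 u.2.1 u.2.2 with hev
  set al := algebraMap (PolyFun N j) (RatFun N j)
  have h1 : (P' * poissonTensor X * Q').map ev = 1 := by
    have hP : P'.map ev = P := by ext; simp [P', hev]
    have hQ : Q'.map ev = Q := by ext; simp [Q', hev]
    have hx : (fun s => (X s).map ev) = x := by ext s i a; simp [hX, hev]
    rw [Matrix.map_mul, Matrix.map_mul, ← poissonTensor_map, hP, hQ, hx, hPQ]
  have h2 : (P' * poissonTensor X * Q').map al =
      P'.map al * poissonTensor (genericChain N j) * Q'.map al := by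
    rw [Matrix.map_mul, Matrix.map_mul, ← poissonTensor_map]
    rfl
  have h3 : IsUnit (P'.map al * poissonTensor (genericChain N j) * Q'.map al) := by
    rw [Matrix.isUnit_iff_isUnit_det, isUnit_iff_ne_zero, ← h2, ← RingHom.mapMatrix_apply,
      ← RingHom.map_det]
    intro e
    rw [map_eq_zero_iff al (IsFractionRing.injective _ _)] at e
    have h4 := congrArg Matrix.det h1
    rw [← RingHom.mapMatrix_apply, ← RingHom.map_det, e, map_zero, Matrix.det_one] at h4
    exact zero_ne_one h4
  have h4 := Matrix.rank_of_isUnit _ h3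
  rw [Fintype.card_fin] at h4
  calc leafDim x = (poissonTensor x).rank := rfl
    _ ≤ _ := by
      rw [← h4]
      exact (Matrix.rank_mul_le_left _ _).trans (Matrix.rank_mul_le_right _ _)

theorem partialDeriv_coordinate (u v : Coord N j) :
    partialDeriv u (algebraMap (PolyFun N j) (RatFun N j) (MvPolynomial.X v)) =
      if v = u then 1 else 0 := by
  rw [partialDeriv_eq_pd, pd, jet_algebraMap, jetPoly_X]
  rw [TrivSqZeroExt.snd_add, TrivSqZeroExt.snd_inl, zero_add, TrivSqZeroExt.snd_inr,
    Pi.single_apply]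

theorem IsCasimir.sum_eq_zero {f : RatFun N j} (hf : IsCasimir f) (v : Coord N j) :
    ∑ u, partialDeriv u f * poissonTensor (genericChain N j) u v = 0 := by
  have h := hf (algebraMap (PolyFun N j) (RatFun N j) (MvPolynomial.X v))
  simp only [bracket, partialDeriv_coordinate, mul_ite, mul_one, mul_zero, Finset.sum_ite_eq,
    Finset.mem_univ, if_true] at h
  exact h

/-- Casimir functions with independent gradients bound the dimension of the leaves. -/
theorem leafDim_add_card_le {ι : Type*} [Fintype ι] [DecidableEq ι] {F : ι → RatFun N j}
    {P : Matrix (Coord N j) ι (RatFun N j)}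
    (h : (Matrix.of fun m u => pd (nonZeroDivisors (PolyFun N j)) u (F m)) * P = 1)
    (hF : ∀ m, IsCasimir (F m)) (x : Slot j → Matrix (Fin N) (Fin N) ℂ) :
    leafDim x + Fintype.card ι ≤ N ^ 2 * (2 * j + 1) := by
  have h1 : (Matrix.of fun m u => pd (nonZeroDivisors (PolyFun N j)) u (F m)) *
      poissonTensor (genericChain N j) = 0 := by
    ext m v
    rw [Matrix.mul_apply, Matrix.zero_apply, ← (hF m).sum_eq_zero v]
    simp only [partialDeriv_eq_pd, Matrix.of_apply]
  -- The gradient matrix has full rank because of its right inverse, and its product with the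
  -- generic Poisson tensor is zero.
  have h2 := Matrix.rank_add_rank_le_card_of_mul_eq_zero h1
  have h3 := Matrix.rank_mul_le_left
    (Matrix.of fun m u => pd (nonZeroDivisors (PolyFun N j)) u (F m)) P
  rw [h, Matrix.rank_one] at h3
  rw [card_coord] at h2
  have h4 := leafDim_le_rank x
  omega

theorem basePoint_mem_phaseSpace : basePoint N j ∈ phaseSpace N j := by
  intro s
  rw [Matrix.isUnit_iff_isUnit_det, isUnit_iff_ne_zero, basePoint, det_antiMat]
  refine mul_ne_zero (Finset.prod_ne_zero_iff.2 fun i _ => baseEntry_ne_zero _ i) fun e => ?_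
  have := congrArg Matrix.det (antiMat_one_mul_self (N := N) (R := ℂ))
  rw [Matrix.det_mul, e, mul_zero, Matrix.det_one] at this
  exact zero_ne_one this

theorem isMaxLeafDim_basePoint {c : ℕ}
    (h1 : ∀ x : Slot j → Matrix (Fin N) (Fin N) ℂ, leafDim x + c ≤ N ^ 2 * (2 * j + 1))
    (h2 : N ^ 2 * (2 * j + 1) ≤ leafDim (basePoint N j) + c) :
    IsMaxLeafDim N j (leafDim (basePoint N j)) ∧
      leafDim (basePoint N j) + c = N ^ 2 * (2 * j + 1) := by
  refine ⟨⟨⟨_, basePoint_mem_phaseSpace, rfl⟩, ?_⟩, le_antisymm (h1 _) h2⟩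
  rintro _ ⟨x, -, rfl⟩
  have := h1 x
  omega

end Rank

/-! ### The complete lists of Casimirs -/

section Families

open TrivSqZeroExt

variable {N j : ℕ}

/-- All Casimir functions of the list for an even number of pairs. -/
noncomputable def evenCasimirs (N j : ℕ) :
    Fin (N / 2) ⊕ (Fin j × Fin N) ⊕ Fin ((N + 1) / 2) → RatFun N j :=
  Sum.elim (casimirY N j) (Sum.elim (fun kp : Fin j × Fin N => casimirZ N j kp.1 kp.2)
    (fun p : Fin ((N + 1) / 2) => casimirXEven N j p (val_le_of_half p)))

/-- All Casimir functions of the list for an odd number of pairs. -/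
noncomputable def oddCasimirs (N j : ℕ) :
    Fin (N / 2) ⊕ (Fin j × Fin N) ⊕ Fin (N / 2) → RatFun N j :=
  Sum.elim (casimirY N j) (Sum.elim (fun kp : Fin j × Fin N => casimirZ N j kp.1 kp.2)
    (fun p : Fin (N / 2) => casimirXOdd N j (p + 1) (val_succ_le_of_half p)))

theorem evenCoord_injective : Function.Injective (evenCoord N j) := by
  rintro (i | ⟨n, i⟩) (i' | ⟨n', i'⟩) h <;> simp_all [evenCoord]

theorem oddCoord_injective (hj : 0 < j) : Function.Injective (oddCoord N j hj) := by
  rintro (i | ⟨n, i⟩ | i) (i' | ⟨n', i'⟩ | i') h <;>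
    simp_all [oddCoord, Fin.ext_iff]

theorem isAntidiagonal_of_support {κ : Type*} {c : κ → Coord N j}
    (hc : ∀ l, (c l).2.2 = (c l).2.1.rev) {v : Coord N j → ℂ}
    (hv : ∀ u, u ∉ Set.range c → v u = 0) : IsAntidiagonal v := by
  intro s i a ha
  refine hv _ ?_
  rintro ⟨l, hl⟩
  have := hc l
  rw [hl] at this
  exact ha this

theorem HasJet.mem {f : RatFun N j} {v : Coord N j → ℂ} {z : DualNumber ℂ}
    (h : HasJet (baseCoord N j) v f z) : f ∈ localRing (baseCoord N j) := by
  obtain ⟨g, rfl, _⟩ := h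
  exact g.2

theorem isAntidiagonal_zero : IsAntidiagonal (0 : Coord N j → ℂ) := fun _ _ _ _ => rfl

theorem exists_gradient_even (hj : Even j) :
    ∃ P : Matrix (Coord N j) (Fin (N / 2) ⊕ (Fin j × Fin N) ⊕ Fin ((N + 1) / 2)) (RatFun N j),
      (Matrix.of fun m u => pd (nonZeroDivisors (PolyFun N j)) u (evenCasimirs N j m)) * P = 1 := by
  refine exists_gradient_mul_eq_one (x := baseCoord N j) (evenCoord N j) evenCoord_injective ?_ _
    ?_ ?_
  · simp only [Fintype.card_sum, Fintype.card_prod, Fintype.card_fin]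
    omega
  · rintro (p | ⟨n, p⟩ | p)
    · exact (hasJet_casimirY isAntidiagonal_zero p).mem
    · exact (hasJet_casimirZ isAntidiagonal_zero n p).mem
    · exact (hasDlog_casimirXEven hj isAntidiagonal_zero (fun _ _ => rfl) p _).mem
  · intro v hv hf
    refine eq_zero_of_casimirs_even hj
      (isAntidiagonal_of_support (by rintro (i | ⟨n, i⟩) <;> rfl) hv) (fun n i => hv _ ?_)
      (fun p => hf (.inl p)) (fun n p => hf (.inr (.inl (n, p)))) fun p => hf (.inr (.inr p))
    rintro ⟨i | ⟨n, i⟩, h⟩ <;> simp [evenCoord] at h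

theorem exists_gradient_odd (hj : Odd j) :
    ∃ P : Matrix (Coord N j) (Fin (N / 2) ⊕ (Fin j × Fin N) ⊕ Fin (N / 2)) (RatFun N j),
      (Matrix.of fun m u => pd (nonZeroDivisors (PolyFun N j)) u (oddCasimirs N j m)) * P = 1 := by
  obtain ⟨r, rfl⟩ := hj
  refine exists_gradient_mul_eq_one (x := baseCoord N _) (oddCoord N _ (Nat.succ_pos _))
    (oddCoord_injective _) rfl _ ?_ ?_
  · rintro (p | ⟨n, p⟩ | p)
    · exact (hasJet_casimirY isAntidiagonal_zero p).mem
    · exact (hasJet_casimirZ isAntidiagonal_zero n p).mem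
    · exact (hasDlog_casimirXOdd _ isAntidiagonal_zero
        (hasDlog_matS_odd isAntidiagonal_zero fun _ _ _ => rfl)).mem
  · intro v hv hf
    refine eq_zero_of_casimirs_odd
      (isAntidiagonal_of_support (by rintro (i | ⟨n, i⟩ | i) <;> rfl) hv)
      (fun i hi => hv _ ?_) (fun n hn i => hv _ ?_) (fun i hi => hv _ ?_)
      (fun p => hf (.inl p)) (fun n p => hf (.inr (.inl (n, p)))) fun p => hf (.inr (.inr p))
    · rintro ⟨l | ⟨n, l⟩ | l, h⟩ <;> simp [oddCoord] at h
      have := l.2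
      rw [← h] at hi
      simp only at hi
      omega
    · rintro ⟨l | ⟨n, l⟩ | l, h⟩ <;> simp [oddCoord] at h
      exact hn (Fin.ext (Fin.ext_iff.1 h.1).symm)
    · rintro ⟨l | ⟨n, l⟩ | l, h⟩ <;> simp [oddCoord] at h
      have := l.2
      rw [← h] at hi
      simp only at hi
      omega

theorem isCasimir_evenCasimirs (hj : Even j) (m) : IsCasimir (evenCasimirs N j m) := by
  rcases m with p | ⟨n, p⟩ | p
  · exact isCasimir_casimirY p
  · exact isCasimir_casimirZ n p
  · exact isCasimir_casimirXEven hj _ _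

theorem isCasimir_oddCasimirs (hj : Odd j) (m) : IsCasimir (oddCasimirs N j m) := by
  rcases m with p | ⟨n, p⟩ | p
  · exact isCasimir_casimirY p
  · exact isCasimir_casimirZ n p
  · exact isCasimir_casimirXOdd hj _ _

theorem card_evenCasimirs :
    Fintype.card (Fin (N / 2) ⊕ (Fin j × Fin N) ⊕ Fin ((N + 1) / 2)) = N * (j + 1) := by
  simp only [Fintype.card_sum, Fintype.card_prod, Fintype.card_fin]
  rw [mul_add, mul_comm]
  omega

theorem card_oddCasimirs :
    Fintype.card (Fin (N / 2) ⊕ (Fin j × Fin N) ⊕ Fin (N / 2)) = 2 * (N / 2) + N * j := by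
  simp only [Fintype.card_sum, Fintype.card_prod, Fintype.card_fin]
  ring

end Families

end PoissonChain

/-! ### The main theorem -/

theorem theorem5p5 (N j : ℕ) (hN : 1 ≤ N) :
    ∃ (Y : Fin (N / 2) → PoissonChain.RatFun N j)
      (Z : Fin j → Fin N → PoissonChain.RatFun N j),
      PoissonChain.IsYExpansion N j Y ∧ PoissonChain.IsZExpansion N j Z ∧
      (∀ p, PoissonChain.IsCasimir (Y p)) ∧
      (∀ k p, PoissonChain.IsCasimir (Z k p)) ∧
      (Even j →
        (∀ p : Fin ((N + 1) / 2),
          PoissonChain.IsCasimir (PoissonChain.casimirXEven N j p (by omega))) ∧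
        AlgebraicIndependent ℂ
          (Sum.elim Y (Sum.elim (fun kp : Fin j × Fin N => Z kp.1 kp.2)
            (fun p : Fin ((N + 1) / 2) => PoissonChain.casimirXEven N j p (by omega)))) ∧
        Fintype.card (Fin (N / 2) ⊕ (Fin j × Fin N) ⊕ Fin ((N + 1) / 2)) = N * (j + 1) ∧
        ∃ d : ℕ, PoissonChain.IsMaxLeafDim N j d ∧
          d + N * (j + 1) = N ^ 2 * (2 * j + 1) ∧ Even d) ∧
      (Odd j →
        (∀ p : Fin (N / 2),
          PoissonChain.IsCasimir (PoissonChain.casimirXOdd N j (p + 1) (by omega))) ∧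
        AlgebraicIndependent ℂ
          (Sum.elim Y (Sum.elim (fun kp : Fin j × Fin N => Z kp.1 kp.2)
            (fun p : Fin (N / 2) => PoissonChain.casimirXOdd N j (p + 1) (by omega)))) ∧
        Fintype.card (Fin (N / 2) ⊕ (Fin j × Fin N) ⊕ Fin (N / 2)) = 2 * (N / 2) + N * j ∧
        ∃ d : ℕ, PoissonChain.IsMaxLeafDim N j d ∧
          d + (2 * (N / 2) + N * j) = N ^ 2 * (2 * j + 1) ∧ Even d) := by
  refine ⟨PoissonChain.casimirY N j, PoissonChain.casimirZ N j,
    PoissonChain.isYExpansion_casimirY hN, PoissonChain.isZExpansion_casimirZ,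
    PoissonChain.isCasimir_casimirY, PoissonChain.isCasimir_casimirZ, fun hj => ?_, fun hj => ?_⟩
  · obtain ⟨P, hP⟩ := PoissonChain.exists_gradient_even (N := N) hj
    have hle := fun x => PoissonChain.leafDim_add_card_le hP
      (PoissonChain.isCasimir_evenCasimirs hj) x
    rw [PoissonChain.card_evenCasimirs] at hle
    obtain ⟨h1, h2⟩ := PoissonChain.isMaxLeafDim_basePoint hle
      (PoissonChain.le_leafDim_basePoint_of_even hj)
    refine ⟨fun p => PoissonChain.isCasimir_casimirXEven hj _ _,
      PoissonChain.algebraicIndependent_of_gradient hP, PoissonChain.card_evenCasimirs, _, h1, h2,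
      ?_⟩
    -- For even `j` both `N ^ 2 * (2 * j + 1)` and `N * (j + 1)` have the parity of `N`, so their
    -- difference is even.
    have h3 := congrArg Even h2
    simp only [Nat.even_add, Nat.even_mul, Nat.even_pow, eq_iff_iff] at h3
    simp only [hj, Nat.not_even_one] at h3
    by_cases hN' : Even N <;> simp_all
  · obtain ⟨P, hP⟩ := PoissonChain.exists_gradient_odd (N := N) hj
    have hle := fun x => PoissonChain.leafDim_add_card_le hP
      (PoissonChain.isCasimir_oddCasimirs hj) x
    rw [PoissonChain.card_oddCasimirs] at hle
    obtain ⟨h1, h2⟩ := PoissonChain.isMaxLeafDim_basePoint hle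
      (PoissonChain.le_leafDim_basePoint_of_odd hj)
    refine ⟨fun p => PoissonChain.isCasimir_casimirXOdd hj _ _,
      PoissonChain.algebraicIndependent_of_gradient hP, PoissonChain.card_oddCasimirs, _, h1, h2,
      ?_⟩
    have h3 := congrArg Even h2
    simp only [Nat.even_add, Nat.even_mul, Nat.even_pow, eq_iff_iff] at h3
    simp only [Nat.not_even_iff_odd.2 hj, Nat.not_even_one] at h3
    by_cases hN' : Even N <;> simp_all
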